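/- **Theorem (Haagerup property).** Let $H_{\mathbf R}$ be a separable real Hilbert space and $(U_t)_{t\in\mathbf R}$ a strongly continuous orthogonal representation of $\mathbf R$ on $H_{\mathbf R}$. Let $H=H_{\mathbf R}\otimes_{\mathbf R}\mathbf C$, with canonical conjugation $J$, and extend $U_t$ to $H$; let $A$ be the positive nonsingular self-adjoint operator on $H$ with $U_t=A^{it}$, put $I=JA^{-1/2}$, $j(\zeta)=\left(\frac{2}{A^{-1}+1}\right)^{1/2}\zeta$ for $\zeta\in H_{\mathbf R}$, and $K_{\mathbf R}=j(H_{\mathbf R})\subset H$. On the full Fock space $\mathcal F(H)=\mathbf C\Omega\oplus\bigoplus_{n\ge1}H^{\otimes n}$ let $\ell(\xi)$ be the left creation operators and $s(\xi)=\frac12(\ell(\xi)+\ell(\xi)^*)$. Let $\mathcal T(H)$ be the (unital) C*-algebra generated by $\{\ell(\xi):\xi\in H\}$, $\Gamma(H_{\mathbf R},U_t)$ the (unital) C*-algebra generated by $\{s(\xi):\xi\in K_{\mathbf R}\}$, and $M=\Gamma(H_{\mathbf R},U_t)''$ the free Araki–Woods von Neumann algebra. Then $M$ has the Haagerup property: there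 is a net $(u_i)$ of normal completely positive maps $M\to M$ such that $u_i(x)\to x$ $\sigma$-weakly for every $x\in M$, and such that for every $i$ and every $\xi\in L^2(M)$ the map $x\mapsto u_i(x)\xi$ is compact from $M$ to $L^2(M)$. Here $L^2(M)$ is the GNS space of a faithful normal state of $M$. More precisely, $\Omega$ is cyclic and separating for $M$, so that $L^2(M)=\mathcal F(H)$, and there is a sequence $(T_k)_{k\in\mathbf N}$ of finite rank contractions of $H$ with $IT_kI=T_k$ (on the domain of $I$) and $T_k\to 1$ pointwise such that, for all $t>0$ and $k$, the second quantization $\Gamma(e^{-t}T_k)$ exists on $M$ and is a normal unital completely positive map $M\to M$ which is a limit, in the norm of bounded linear maps $M\to M$, of finite rank bounded maps; and the net $(\Gamma(e^{-t}T_k))_{t>0,\,k\in\mathbf N}$, as $t\to0$ and $k\to\infty$, has the properties required of $(u_i)$ above. Here, for a contraction $T$ of $H$, the second quantization $\Gamma(T)$ is the unital completely positive map of $\mathcal T(H)$ with $$\Gamma(T)\bigl(\ell(h_1)\cdots\ell(h_k)\ell(h_{k+1})^*\cdots\ell(h_n)^*\bigr)=\ell(Th_1)\cdots\ell(Th_k)\ell(Th_{k+1})^*\cdots\ell(Th_n)^*\qquad(h_i\in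 H),$$ and, on $M$, the normal extension to $M$ of its restriction to $\Gamma(H_{\mathbf R},U_t)$. -/

import Mathlib

open scoped TensorProduct InnerProductSpace ComplexOrder

noncomputable section

set_option linter.unusedSectionVars false

universe u v

/-! ## The complexification of a real Hilbert space -/

/-- The complexification `E ⊗_ℝ ℂ` of a real Hilbert space; the pair `(a, b)` is `a + i b`. -/
def Complexified (E : Type u) : Type u := WithLp 2 (E × E)

namespace Complexified

variable {E : Type u} [NormedAddCommGroup E] [InnerProductSpace ℝ E]

instance : NormedAddCommGroup (Complexified E) :=
  inferInstanceAs (NormedAddCommGroup (WithLp 2 (E × E)))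

instance [CompleteSpace E] : CompleteSpace (Complexified E) :=
  inferInstanceAs (CompleteSpace (WithLp 2 (E × E)))

/-- The vector `a + i b`. -/
def mk (a b : E) : Complexified E := WithLp.toLp 2 (a, b)

/-- The real part `a` of `a + i b`. -/
def re (x : Complexified E) : E := (WithLp.ofLp x).1

/-- The imaginary part `b` of `a + i b`. -/
def im (x : Complexified E) : E := (WithLp.ofLp x).2

@[simp] theorem re_mk (a b : E) : (mk a b).re = a := rfl
@[simp] theorem im_mk (a b : E) : (mk a b).im = b := rfl
@[simp] theorem re_add (x y : Complexified E) : (x + y).re = x.re + y.re := rfl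
@[simp] theorem im_add (x y : Complexified E) : (x + y).im = x.im + y.im := rfl
@[simp] theorem re_zero : (0 : Complexified E).re = 0 := rfl
@[simp] theorem im_zero : (0 : Complexified E).im = 0 := rfl

@[ext] theorem ext {x y : Complexified E} (h₁ : x.re = y.re) (h₂ : x.im = y.im) : x = y :=
  (WithLp.ofLp_injective 2) (Prod.ext h₁ h₂)

theorem norm_sq (x : Complexified E) : ‖x‖ ^ 2 = ‖x.re‖ ^ 2 + ‖x.im‖ ^ 2 :=
  WithLp.prod_norm_sq_eq_of_L2 (α := E) (β := E) x

instance : SMul ℂ (Complexified E) :=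
  ⟨fun c x => mk (c.re • x.re - c.im • x.im) (c.re • x.im + c.im • x.re)⟩

@[simp] theorem re_smul (c : ℂ) (x : Complexified E) :
    (c • x).re = c.re • x.re - c.im • x.im := rfl
@[simp] theorem im_smul (c : ℂ) (x : Complexified E) :
    (c • x).im = c.re • x.im + c.im • x.re := rfl

instance : Module ℂ (Complexified E) where
  one_smul x := by ext <;> simp
  mul_smul c d x := by ext <;> simp <;> module
  smul_zero c := by ext <;> simp
  smul_add c x y := by ext <;> simp <;> module
  add_smul c d x := by ext <;> simp <;> module
  zero_smul x := by ext <;> simp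

instance : Inner ℂ (Complexified E) :=
  ⟨fun x y => ⟨⟪x.re, y.re⟫_ℝ + ⟪x.im, y.im⟫_ℝ, ⟪x.re, y.im⟫_ℝ - ⟪x.im, y.re⟫_ℝ⟩⟩

theorem inner_def (x y : Complexified E) : ⟪x, y⟫_ℂ =
    ⟨⟪x.re, y.re⟫_ℝ + ⟪x.im, y.im⟫_ℝ, ⟪x.re, y.im⟫_ℝ - ⟪x.im, y.re⟫_ℝ⟩ := rfl

instance : InnerProductSpace ℂ (Complexified E) where
  norm_smul_le c x := by
    refine le_of_eq ((sq_eq_sq₀ (norm_nonneg _) (by positivity)).1 ?_)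
    rw [mul_pow, norm_sq, norm_sq, re_smul, im_smul, norm_sub_sq_real, norm_add_sq_real,
      Complex.sq_norm, Complex.normSq_apply]
    simp only [norm_smul, mul_pow, inner_smul_left, inner_smul_right, Real.norm_eq_abs, sq_abs,
      real_inner_comm x.re x.im]
    simp
    ring
  norm_sq_eq_re_inner x := by
    rw [norm_sq, inner_def]
    simp
  conj_inner_symm x y := by
    rw [inner_def, inner_def]
    apply Complex.ext
    · simp [real_inner_comm]
    · simp [real_inner_comm]
  add_left x y z := by
    simp only [inner_def]
    apply Complex.ext
    · simp [inner_add_left]; ring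
    · simp [inner_add_left]; ring
  smul_left x y c := by
    simp only [inner_def]
    apply Complex.ext
    · simp [inner_add_left, inner_sub_left, inner_smul_left]; ring
    · simp [inner_add_left, inner_sub_left, inner_smul_left]; ring

/-- The canonical anti-unitary involution `J (a + i b) = a - i b`. -/
def conj (x : Complexified E) : Complexified E := mk x.re (-x.im)

/-- The inclusion of the real Hilbert space in its complexification. -/
def ofReal (a : E) : Complexified E := mk a 0

end Complexified

/-! ## The full Fock space -/

/-- A complex Hilbert space, bundled. -/
structure HilbertObj : Type (u + 1) where
  /-- The underlying type. -/
  carrier : Type u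
  [group : NormedAddCommGroup carrier]
  [inner : InnerProductSpace ℂ carrier]
  [complete : CompleteSpace carrier]

attribute [instance] HilbertObj.group HilbertObj.inner HilbertObj.complete

section Fock

variable (H : Type u) [NormedAddCommGroup H] [InnerProductSpace ℂ H] [CompleteSpace H]

/-- `tensorPowObj H n` is the Hilbert space tensor power `H^{⊗ (n+1)}`, defined by
`H^{⊗ 1} = H` and `H^{⊗ (n+2)} = H ⊗ H^{⊗ (n+1)}` (completed tensor product). -/
def tensorPowObj : ℕ → HilbertObj.{u}
  | 0 => ⟨H⟩
  | n + 1 => ⟨UniformSpace.Completion (H ⊗[ℂ] (tensorPowObj n).carrier)⟩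

/-- The Hilbert space `H^{⊗ (n+1)}`. -/
abbrev TensorPow (n : ℕ) : Type u := (tensorPowObj H n).carrier

/-- The full Fock space `ℂ Ω ⊕ ⨁_{n ≥ 1} H^{⊗ n}` (Hilbert space direct sum). -/
abbrev Fock : Type u := WithLp 2 (ℂ × lp (fun n : ℕ => TensorPow H n) 2)

/-- The vacuum vector. -/
def vacuum : Fock H := WithLp.toLp 2 (1, 0)

variable {H}

/-- `η ↦ ξ ⊗ η` from `H^{⊗ (n+1)}` to `H^{⊗ (n+2)}`. -/
def tensorLeft (ξ : H) (n : ℕ) : TensorPow H n →L[ℂ] TensorPow H (n + 1) :=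
  (UniformSpace.Completion.toComplL (𝕜 := ℂ) (E := H ⊗[ℂ] TensorPow H n)).comp
    (TensorProduct.mkL ℂ H (TensorPow H n) ξ)

theorem norm_tensorLeft (ξ : H) (n : ℕ) (η : TensorPow H n) :
    ‖tensorLeft ξ n η‖ = ‖ξ‖ * ‖η‖ := by
  have h : tensorLeft ξ n η =
      ((ξ ⊗ₜ[ℂ] η : H ⊗[ℂ] TensorPow H n) :
        UniformSpace.Completion (H ⊗[ℂ] TensorPow H n)) := rfl
  rw [h]
  exact (UniformSpace.Completion.norm_coe _).trans (TensorProduct.norm_tmul ξ η)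

/-- The components of positive degree of `ℓ(ξ) x`. -/
def creationSeq (ξ : H) (x : Fock H) : (n : ℕ) → TensorPow H n
  | 0 => (x.fst • ξ : H)
  | n + 1 => tensorLeft ξ n (x.snd n)

theorem summable_lp_sq {G : ℕ → Type u} [∀ n, NormedAddCommGroup (G n)] (f : lp G 2) :
    Summable fun n => ‖f n‖ ^ 2 := by
  have := (lp.memℓp f).summable (by simp)
  simpa using this

theorem lp_norm_sq {G : ℕ → Type u} [∀ n, NormedAddCommGroup (G n)] (f : lp G 2) :
    ‖f‖ ^ 2 = ∑' n, ‖f n‖ ^ 2 := by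
  have := lp.norm_rpow_eq_tsum (p := 2) (by simp) f
  simpa using this

theorem creationSeq_summable (ξ : H) (x : Fock H) :
    Summable fun n => ‖creationSeq ξ x n‖ ^ 2 := by
  rw [← summable_nat_add_iff 1]
  simp only [creationSeq, norm_tensorLeft, mul_pow]
  exact (summable_lp_sq x.snd).mul_left _

theorem creationSeq_memℓp (ξ : H) (x : Fock H) : Memℓp (creationSeq ξ x) 2 := by
  apply memℓp_gen
  simpa using creationSeq_summable ξ x

/-- The left creation operator `ℓ(ξ)`: `ℓ(ξ) Ω = ξ` and
`ℓ(ξ) (ξ₁ ⊗ ⋯ ⊗ ξₙ) = ξ ⊗ ξ₁ ⊗ ⋯ ⊗ ξₙ`. -/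
def creation (ξ : H) : Fock H →L[ℂ] Fock H :=
  LinearMap.mkContinuous
    { toFun := fun x => WithLp.toLp 2 (0, ⟨creationSeq ξ x, creationSeq_memℓp ξ x⟩)
      map_add' := fun x y => by
        apply WithLp.ofLp_injective 2
        refine Prod.ext (by simp) (Subtype.ext (funext fun n => ?_))
        cases n with
        | zero => exact add_smul x.fst y.fst ξ
        | succ n => exact (tensorLeft ξ n).map_add (x.snd n) (y.snd n)
      map_smul' := fun c x => by
        apply WithLp.ofLp_injective 2
        refine Prod.ext (by simp) (Subtype.ext (funext fun n => ?_))
        cases n with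
        | zero => exact mul_smul c x.fst ξ
        | succ n => exact (tensorLeft ξ n).map_smul c (x.snd n) }
    ‖ξ‖ (fun x => by
      refine le_of_eq ((sq_eq_sq₀ (norm_nonneg _) (by positivity)).1 ?_)
      have h0 : ‖creationSeq ξ x 0‖ = ‖x.fst‖ * ‖ξ‖ := norm_smul x.fst ξ
      have h1 : ∀ n, ‖creationSeq ξ x (n + 1)‖ = ‖ξ‖ * ‖x.snd n‖ :=
        fun n => norm_tensorLeft ξ n (x.snd n)
      rw [mul_pow, WithLp.prod_norm_sq_eq_of_L2, WithLp.prod_norm_sq_eq_of_L2]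
      rw [lp_norm_sq, lp_norm_sq]
      change ‖(0 : ℂ)‖ ^ 2 + ∑' n, ‖creationSeq ξ x n‖ ^ 2 = _
      rw [(creationSeq_summable ξ x).tsum_eq_zero_add, h0]
      simp only [h1, mul_pow, tsum_mul_left, norm_zero]
      ring)

/-- The real part `s(ξ) = (ℓ(ξ) + ℓ(ξ)^*) / 2`. -/
def semicircular (ξ : H) : Fock H →L[ℂ] Fock H :=
  (2⁻¹ : ℂ) • (creation ξ + star (creation ξ))

variable (H) in
/-- The C*-algebra `𝒯(H)` generated by the left creation operators. -/
def toeplitz : StarSubalgebra ℂ (Fock H →L[ℂ] Fock H) :=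
  (StarAlgebra.adjoin ℂ (Set.range (creation (H := H)))).topologicalClosure

/-- The product `ℓ(h₁) ⋯ ℓ(h_k) ℓ(h_{k+1})^* ⋯ ℓ(h_n)^*`. -/
def creationWord (a b : List H) : Fock H →L[ℂ] Fock H :=
  (a.map creation).prod * (b.map fun h => star (creation h)).prod

theorem creation_mem_toeplitz (ξ : H) : creation ξ ∈ toeplitz H :=
  StarSubalgebra.le_topologicalClosure _ (StarAlgebra.subset_adjoin ℂ _ ⟨ξ, rfl⟩)

theorem creationWord_mem_toeplitz (a b : List H) : creationWord a b ∈ toeplitz H := by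
  refine mul_mem (list_prod_mem fun x hx => ?_) (list_prod_mem fun x hx => ?_)
  · obtain ⟨h, -, rfl⟩ := List.mem_map.1 hx
    exact creation_mem_toeplitz h
  · obtain ⟨h, -, rfl⟩ := List.mem_map.1 hx
    exact star_mem (creation_mem_toeplitz h)

theorem semicircular_mem_toeplitz (ξ : H) : semicircular ξ ∈ toeplitz H :=
  (toeplitz H).smul_mem (add_mem (creation_mem_toeplitz ξ) (star_mem (creation_mem_toeplitz ξ))) _

end Fock

/-! ## Operator algebraic notions -/

section OperatorAlgebras

variable {K : Type u} [NormedAddCommGroup K] [InnerProductSpace ℂ K] [CompleteSpace K]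
variable {L : Type v} [NormedAddCommGroup L] [InnerProductSpace ℂ L] [CompleteSpace L]

/-- The von Neumann algebra `S''` generated by a set `S` of operators:
the double commutant of `S ∪ S^*`. -/
def generatedVN (S : Set (K →L[ℂ] K)) : VonNeumannAlgebra K where
  toStarSubalgebra := StarSubalgebra.centralizer ℂ
    (StarSubalgebra.centralizer ℂ S : Set (K →L[ℂ] K))
  centralizer_centralizer' := by
    simp

variable (K) in
/-- The pairs of square summable sequences of vectors; `(ξ, η)` stands for the normal functional
`x ↦ ∑ₙ ⟨ξₙ, x ηₙ⟩` on `B(K)`. -/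
def SqSummablePairs : Type u :=
  {p : (ℕ → K) × (ℕ → K) // (Summable fun n => ‖p.1 n‖ ^ 2) ∧ Summable fun n => ‖p.2 n‖ ^ 2}

variable (K) in
/-- The `σ`-weak topology on `B(K)`: the coarsest topology for which all the functionals
`x ↦ ∑ₙ ⟨ξₙ, x ηₙ⟩`, with `∑ ‖ξₙ‖² < ∞` and `∑ ‖ηₙ‖² < ∞`, are continuous. -/
@[reducible] def sigmaWeak : TopologicalSpace (K →L[ℂ] K) :=
  ⨅ p : SqSummablePairs K, TopologicalSpace.induced
    (fun x : K →L[ℂ] K => ∑' n, ⟪p.1.1 n, x (p.1.2 n)⟫_ℂ) inferInstance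

/-- The `σ`-weak topology on a subalgebra of `B(K)`. -/
@[reducible] def sigmaWeakOn (A : StarSubalgebra ℂ (K →L[ℂ] K)) : TopologicalSpace A :=
  TopologicalSpace.induced (fun x : A => (x : K →L[ℂ] K)) (sigmaWeak K)

/-- Normality, that is `σ`-weak continuity, of a map `M → B(L)`. -/
def IsNormalMap (M : VonNeumannAlgebra K) (Φ : M.toStarSubalgebra → (L →L[ℂ] L)) : Prop :=
  @Continuous _ _ (sigmaWeakOn M.toStarSubalgebra) (sigmaWeak L) Φ

/-- Complete positivity: for every `n` and every positive matrix `Xᴴ X` over `A`, the operator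
matrix `(Φ ((Xᴴ X)ᵢⱼ))ᵢⱼ` is a positive operator on `L^n`. -/
def IsCompletelyPositive (A : StarSubalgebra ℂ (K →L[ℂ] K)) (Φ : A → (L →L[ℂ] L)) : Prop :=
  ∀ (n : ℕ) (X : Matrix (Fin n) (Fin n) A) (ξ : Fin n → L),
    0 ≤ ∑ i, ∑ j, ⟪ξ i, Φ ((X.conjTranspose * X) i j) (ξ j)⟫_ℂ

/-- `(L, π, η)` is the GNS triple of a faithful normal (positive) functional on `M`: `π` is a
normal representation with cyclic and separating vector `η`. Then `L` with this action of `M`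
is the standard representation space `L²(M)` of the `σ`-finite von Neumann algebra `M`. -/
structure IsL2Representation (M : VonNeumannAlgebra K)
    (π : M.toStarSubalgebra →⋆ₐ[ℂ] (L →L[ℂ] L)) (η : L) : Prop where
  normal : IsNormalMap M π
  cyclic : Dense (Set.range fun x => π x η)
  separating : Function.Injective fun x => π x η

/-- The net `u` (along the filter `l`) of normal completely positive maps on `M` witnesses the
Haagerup property of `M`, where `L²(M)` is the space `L` on which `M` acts through `π`. -/
structure IsHaagerupNet (M : VonNeumannAlgebra K)
    (π : M.toStarSubalgebra →⋆ₐ[ℂ] (L →L[ℂ] L)) {ι : Type*} (l : Filter ι)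
    (u : ι → (M.toStarSubalgebra →L[ℂ] M.toStarSubalgebra)) : Prop where
  completelyPositive : ∀ i, IsCompletelyPositive M.toStarSubalgebra
    fun x => (u i x : K →L[ℂ] K)
  normal : ∀ i, IsNormalMap M fun x => (u i x : K →L[ℂ] K)
  tendsto : ∀ x, Filter.Tendsto (fun i => u i x) l
    (@nhds _ (sigmaWeakOn M.toStarSubalgebra) x)
  compact : ∀ (i : ι) (ξ : L), IsCompactOperator fun x => π (u i x) ξ

/-- The Haagerup property of a (`σ`-finite) von Neumann algebra `M`: there is a net `(uᵢ)` of normal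
completely positive maps on `M` with `uᵢ(x) → x` `σ`-weakly for every `x`, such that
`x ↦ uᵢ(x) ξ` is compact from `M` to `L²(M)` for all `i` and all `ξ ∈ L²(M)`. -/
def HasHaagerupProperty (M : VonNeumannAlgebra K) : Prop :=
  ∃ (L : Type u) (_ : NormedAddCommGroup L) (_ : InnerProductSpace ℂ L) (_ : CompleteSpace L)
    (π : M.toStarSubalgebra →⋆ₐ[ℂ] (L →L[ℂ] L)) (η : L), IsL2Representation M π η ∧
  ∃ (ι : Type u) (_ : Preorder ι) (_ : IsDirectedOrder ι) (_ : Nonempty ι)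
    (u : ι → (M.toStarSubalgebra →L[ℂ] M.toStarSubalgebra)),
    IsHaagerupNet M π Filter.atTop u

/-- The bounded map `Φ` is a norm limit of finite rank bounded maps. -/
def IsNormLimitOfFiniteRank (A : StarSubalgebra ℂ (K →L[ℂ] K)) (Φ : A →L[ℂ] A) : Prop :=
  Φ ∈ closure {R : A →L[ℂ] A | FiniteDimensional ℂ R.range}

end OperatorAlgebras

/-! ## Free Araki–Woods algebras -/

/-- A (strongly continuous) orthogonal representation of `ℝ` on a real Hilbert space. -/
structure OrthogonalRep (E : Type u) [NormedAddCommGroup E] [InnerProductSpace ℝ E] where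
  /-- The orthogonal operator `U_t`. -/
  U : ℝ → (E ≃ₗᵢ[ℝ] E)
  map_zero : U 0 = LinearIsometryEquiv.refl ℝ E
  map_add : ∀ s t ξ, U (s + t) ξ = U s (U t ξ)
  continuous : ∀ ξ, Continuous fun t => U t ξ

namespace OrthogonalRep

variable {E : Type u} [NormedAddCommGroup E] [InnerProductSpace ℝ E] [CompleteSpace E]
variable (V : OrthogonalRep E)

/-- The unitary extension of `U_t` to the complexification. -/
def complexU (t : ℝ) (ξ : Complexified E) : Complexified E :=
  Complexified.mk (V.U t ξ.re) (V.U t ξ.im)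

/-- Let `A` be the positive nonsingular self-adjoint operator with `U_t = A^{it}` (the analytic
generator of `U_t`). `V.Pow s ξ η` says that `ξ` is in the domain of `A^s` and `A^s ξ = η`: the
orbit `t ↦ A^{it} ξ` extends to a function `F(z) = A^{iz} ξ`, continuous on the closed strip
between the lines `Im z = 0` and `Im z = -s` and holomorphic in its interior, and
`F(-is) = η`. -/
def Pow (s : ℝ) (ξ η : Complexified E) : Prop :=
  ∃ F : ℂ → Complexified E,
    ContinuousOn F {z | z.im ∈ Set.uIcc 0 (-s)} ∧
    DifferentiableOn ℂ F {z | z.im ∈ Set.uIoo 0 (-s)} ∧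
    (∀ t : ℝ, F t = V.complexU t ξ) ∧ F (-Complex.I * s) = η

/-- `V.Inv ξ η` says that `ξ` is in the domain of the involution `I = J A^{-1/2}` and `I ξ = η`. -/
def Inv (ξ η : Complexified E) : Prop :=
  ∃ ζ, V.Pow (-1 / 2) ξ ζ ∧ η = ζ.conj

/-- `B` is the bounded operator `(2 / (A⁻¹ + 1))^{1/2}`: it is positive, and for every `ζ` the vector
`B² ζ` is in the domain of `A⁻¹` with `(A⁻¹ + 1) B² ζ = 2 ζ`. -/
def IsDeformation (B : Complexified E →L[ℂ] Complexified E) : Prop :=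
  B.IsPositive ∧ ∀ ζ, ∃ η, V.Pow (-1) (B (B ζ)) η ∧ η + B (B ζ) = (2 : ℂ) • ζ

open Classical in
/-- The operator `(2 / (A⁻¹ + 1))^{1/2}`. -/
def deformation : Complexified E →L[ℂ] Complexified E :=
  if h : ∃ B, V.IsDeformation B then h.choose else 0

/-- The embedding `j(ζ) = (2 / (A⁻¹ + 1))^{1/2} ζ` of the real Hilbert space in its
complexification. -/
def j (ζ : E) : Complexified E := V.deformation (Complexified.ofReal ζ)

/-- The real subspace `K_ℝ = j(H_ℝ)`. -/
def KR : Set (Complexified E) := Set.range V.j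

/-- The (unital) C*-algebra `Γ(H_ℝ, U_t)` generated by the `s(ξ)`, `ξ ∈ K_ℝ`. -/
def arakiWoodsCStar : StarSubalgebra ℂ (Fock (Complexified E) →L[ℂ] Fock (Complexified E)) :=
  (StarAlgebra.adjoin ℂ (semicircular '' V.KR)).topologicalClosure

/-- The free Araki–Woods von Neumann algebra `Γ(H_ℝ, U_t)'' = {s(ξ) : ξ ∈ K_ℝ}''`. -/
def arakiWoods : VonNeumannAlgebra (Fock (Complexified E)) :=
  generatedVN (semicircular '' V.KR)

theorem mem_toeplitz_of_mem {x : Fock (Complexified E) →L[ℂ] Fock (Complexified E)}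
    (hx : x ∈ V.arakiWoodsCStar) : x ∈ toeplitz (Complexified E) := by
  refine StarSubalgebra.topologicalClosure_minimal (StarAlgebra.adjoin_le ?_)
    (StarSubalgebra.isClosed_topologicalClosure _) hx
  rintro _ ⟨ξ, -, rfl⟩
  exact semicircular_mem_toeplitz ξ

theorem mem_arakiWoods_of_mem {x : Fock (Complexified E) →L[ℂ] Fock (Complexified E)}
    (hx : x ∈ V.arakiWoodsCStar) : x ∈ V.arakiWoods.toStarSubalgebra :=
  StarSubalgebra.topologicalClosure_adjoin_le_centralizer_centralizer ℂ _ hx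

/-- `I T I = T` for a bounded operator `T`: for `ξ` in the domain of `I`, the vector `T I ξ` is in
the domain of `I` and `I T I ξ = T ξ`. -/
def CommutesWithInv (T : Complexified E →L[ℂ] Complexified E) : Prop :=
  ∀ ξ η, V.Inv ξ η → V.Inv (T η) (T ξ)

/-- `Φ` is the second quantization `Γ(T)` on `Γ(H_ℝ, U_t)''`: there is a unital completely positive
map `Ψ` on `𝒯(H)` with
`Ψ(ℓ(h₁) ⋯ ℓ(h_k) ℓ(h_{k+1})^* ⋯ ℓ(h_n)^*) = ℓ(T h₁) ⋯ ℓ(T h_k) ℓ(T h_{k+1})^* ⋯ ℓ(T h_n)^*`, and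
`Φ` is the normal extension to `Γ(H_ℝ, U_t)''` of the restriction of `Ψ` to `Γ(H_ℝ, U_t)`. -/
def IsSecondQuantization (T : Complexified E →L[ℂ] Complexified E)
    (Φ : V.arakiWoods.toStarSubalgebra →L[ℂ] V.arakiWoods.toStarSubalgebra) : Prop :=
  (∃ Ψ : toeplitz (Complexified E) →L[ℂ] toeplitz (Complexified E),
    Ψ 1 = 1 ∧
    IsCompletelyPositive (toeplitz (Complexified E))
      (fun x => (Ψ x : Fock (Complexified E) →L[ℂ] Fock (Complexified E))) ∧
    (∀ a b : List (Complexified E),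
      Ψ ⟨creationWord a b, creationWord_mem_toeplitz a b⟩ =
        ⟨creationWord (a.map T) (b.map T), creationWord_mem_toeplitz _ _⟩) ∧
    ∀ x (hx : x ∈ V.arakiWoodsCStar),
      (Φ ⟨x, V.mem_arakiWoods_of_mem hx⟩ : Fock (Complexified E) →L[ℂ] Fock (Complexified E)) =
        Ψ ⟨x, V.mem_toeplitz_of_mem hx⟩) ∧
  IsNormalMap V.arakiWoods
    (fun x => (Φ x : Fock (Complexified E) →L[ℂ] Fock (Complexified E)))

end OrthogonalRep

end

/-! For a finite rank `T` with ‖T‖ < 1, the second quantization Γ(T) is realized as x ↦ W^*(x ⊗ 1)W,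
where W is an isometry from the Fock space F into F ⊗ F (written as square summable families in F)
with (ℓ(h)^* ⊗ 1)W = Wℓ(Th)^*. Maps of this form are normal and completely positive on all of B(F),
and the intertwining relation gives Γ(T)(ℓ(h)x) = ℓ(Th)Γ(T)(x) and its adjoint version. With an
orthonormal basis (e_a) of the range of T that diagonalizes TT^*, W is the sum of the pieces E_0 = Ω
⊗ D(·) and E_{j+1} = ∑_a (ℓ(T^*e_a) ⊗ 1) E_j ℓ(e_a)^*. Their norms decay like ‖T‖^j, and the defect
operator D makes W^*W telescope to 1 (`dilate_krausOp_one`).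

The maps E_i^*(· ⊗ 1)E_j have finite rank but need not preserve M. Grouped by total degree i + j and
corrected by one subtraction (`degreePart`), they agree with Γ(T) on Wick words of one length and
vanish on those of other lengths. Wick words in K_ℝ span a σ-weakly dense *-algebra of M, so if T
preserves K_ℝ the degree parts preserve M, and their norm convergent sum is Γ(T) on M
(`isNormLimitOfFiniteRank_quantization`).

To find the T_k, put B = (2/(A⁻¹ + 1))^{1/2} and B' = JBJ. Since A^{-1/2}B = B'
(`pow_half_deformation`), every BQB' with QJ = JQ is compatible with I and preserves K_ℝ. A suitable
Q of finite rank, with BQB' a contraction close to 1, comes from a mean of Krylov projections that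
almost commutes with B (`exists_finiteRank_sandwich`). The unbounded A is handled only through
analytic continuation of orbits in a strip: uniqueness, symmetry, positivity and closedness of
A^{-s} are proved there, and surjectivity of 1 + A⁻¹ follows from Liouville's theorem
(`rangeOneAddInv_eq_top`).

For the convergence, WΩ = Ω ⊗ Ω gives ‖Γ(T)(x)Ω‖ ≤ ‖xΩ‖, so Γ(T_i)(x)Ω → xΩ need only be checked on
Wick words. The right semicircular operators of vectors in B'H_ℝ lie in M' and make Ω cyclic for M'.
Hence Ω separates M, and convergence on Ω spreads to strong, then σ-weak, convergence. -/

set_option linter.unusedSectionVars false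

/-! ## Amplifications of operators and the `σ`-weak topology -/

section Amplification

variable {K : Type u} [NormedAddCommGroup K] [InnerProductSpace ℂ K] [CompleteSpace K]
variable {κ : Type v}

theorem summable_norm_sq_lp (f : lp (fun _ : κ => K) 2) : Summable fun k => ‖f k‖ ^ 2 := by
  simpa using (lp.memℓp f).summable (by simp)

theorem norm_sq_lp (f : lp (fun _ : κ => K) 2) : ‖f‖ ^ 2 = ∑' k, ‖f k‖ ^ 2 := by
  simpa using lp.norm_rpow_eq_tsum (p := 2) (by simp) f

theorem memℓp_two_of_summable {f : κ → K} (h : Summable fun k => ‖f k‖ ^ 2) :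
    Memℓp (fun k => f k : (k : κ) → (fun _ : κ => K) k) 2 :=
  memℓp_gen (by simpa using h)

theorem norm_sq_apply_le (x : K →L[ℂ] K) (ξ : K) : ‖x ξ‖ ^ 2 ≤ ‖x‖ ^ 2 * ‖ξ‖ ^ 2 := by
  rw [← mul_pow]
  gcongr
  exact x.le_opNorm ξ

theorem summable_norm_sq_apply (x : K →L[ℂ] K) (f : lp (fun _ : κ => K) 2) :
    Summable fun k => ‖x (f k)‖ ^ 2 :=
  Summable.of_nonneg_of_le (fun _ => by positivity) (fun k => norm_sq_apply_le x (f k))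
    ((summable_norm_sq_lp f).mul_left _)

/-- The diagonal action of an operator on a Hilbert space of square summable families. -/
noncomputable def amplify (κ : Type v) (x : K →L[ℂ] K) :
    lp (fun _ : κ => K) 2 →L[ℂ] lp (fun _ : κ => K) 2 :=
  LinearMap.mkContinuous
    { toFun := fun f => ⟨fun k => x (f k), memℓp_two_of_summable (summable_norm_sq_apply x f)⟩
      map_add' := fun f g => by ext k; exact x.map_add (f k) (g k)
      map_smul' := fun c f => by ext k; simp }
    ‖x‖ fun f => by
      refine le_of_sq_le_sq ?_ (by positivity)
      rw [mul_pow, norm_sq_lp, norm_sq_lp, ← tsum_mul_left]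
      exact (summable_norm_sq_apply x f).tsum_le_tsum (fun k => norm_sq_apply_le x (f k))
        ((summable_norm_sq_lp f).mul_left _)

@[simp] theorem amplify_apply (x : K →L[ℂ] K) (f : lp (fun _ : κ => K) 2) (k : κ) :
    amplify κ x f k = x (f k) := rfl

/-- The diagonal representation of `B(K)` on square summable families. -/
noncomputable def amplification (K : Type u) [NormedAddCommGroup K] [InnerProductSpace ℂ K]
    [CompleteSpace K] (κ : Type v) :
    (K →L[ℂ] K) →⋆ₐ[ℂ] (lp (fun _ : κ => K) 2 →L[ℂ] lp (fun _ : κ => K) 2) where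
  toFun := amplify κ
  map_one' := by ext f k; simp
  map_mul' x y := by ext f k; simp
  map_zero' := by ext f k; simp
  map_add' x y := by ext f k; simp
  commutes' c := by ext f k; simp [Algebra.algebraMap_eq_smul_one]
  map_star' x := by
    rw [ContinuousLinearMap.star_eq_adjoint (amplify κ x), ContinuousLinearMap.eq_adjoint_iff]
    intro f g
    rw [lp.inner_eq_tsum, lp.inner_eq_tsum]
    refine tsum_congr fun k => ?_
    simp [ContinuousLinearMap.star_eq_adjoint, ContinuousLinearMap.adjoint_inner_left]

@[simp] theorem amplification_apply (x : K →L[ℂ] K) (f : lp (fun _ : κ => K) 2) (k : κ) :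
    amplification K κ x f k = x (f k) := rfl

theorem norm_amplification_le (x : K →L[ℂ] K) : ‖amplification K κ x‖ ≤ ‖x‖ :=
  NonUnitalStarAlgHom.norm_apply_le (amplification K κ) x

/-- Amplified vector functionals are `σ`-weakly continuous, whatever the multiplicity. -/
theorem continuous_inner_amplification (u w : lp (fun _ : κ => K) 2) :
    @Continuous _ _ (sigmaWeak K) _ fun x => ⟪u, amplification K κ x w⟫_ℂ := by
  -- A summable family has countable support. The support is injected into ℕ by `e`, and the vectors
  -- are extended by zero, which yields an admissible pair of sequences.
  set s : Set κ := {k | ‖u k‖ ^ 2 + ‖w k‖ ^ 2 ≠ 0}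
  have hs : s.Countable :=
    ((summable_norm_sq_lp u).add (summable_norm_sq_lp w)).countable_support
  obtain ⟨e, he⟩ := Set.countable_iff_exists_injective.1 hs
  have hzero : ∀ k ∉ s, u k = 0 ∧ w k = 0 := by
    intro k hk
    have h : ‖u k‖ ^ 2 + ‖w k‖ ^ 2 = 0 := not_not.1 hk
    constructor
    · have : ‖u k‖ ^ 2 = 0 := by nlinarith [sq_nonneg ‖u k‖, sq_nonneg ‖w k‖]
      simpa using this
    · have : ‖w k‖ ^ 2 = 0 := by nlinarith [sq_nonneg ‖u k‖, sq_nonneg ‖w k‖]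
      simpa using this
  have hsum : ∀ f : lp (fun _ : κ => K) 2,
      Summable fun n => ‖Function.extend e (fun k : s => f k) 0 n‖ ^ 2 := by
    intro f
    have h1 : Summable (Function.extend e (fun k : s => ‖f k‖ ^ 2) 0) :=
      (summable_extend_zero he).2 ((summable_norm_sq_lp f).subtype _)
    refine h1.congr fun n => ?_
    by_cases hn : ∃ k, e k = n
    · obtain ⟨k, rfl⟩ := hn
      simp [he.extend_apply]
    · simp [Function.extend_apply' _ _ _ hn]
  let p : SqSummablePairs K := ⟨(Function.extend e (fun k : s => u k) 0,
    Function.extend e (fun k : s => w k) 0), hsum u, hsum w⟩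
  have hp : @Continuous _ _ (sigmaWeak K) _
      fun x : K →L[ℂ] K => ∑' n, ⟪p.1.1 n, x (p.1.2 n)⟫_ℂ :=
    continuous_iInf_dom (i := p) continuous_induced_dom
  convert hp using 2 with x
  rw [lp.inner_eq_tsum]
  have h1 : ∀ n, ⟪p.1.1 n, x (p.1.2 n)⟫_ℂ =
      Function.extend e (fun k : s => ⟪u k, x (w k)⟫_ℂ) 0 n := by
    intro n
    by_cases hn : ∃ k, e k = n
    · obtain ⟨k, rfl⟩ := hn
      simp [p, he.extend_apply]
    · simp [p, Function.extend_apply' _ _ _ hn]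
  rw [tsum_congr h1, tsum_extend_zero he]
  refine (tsum_subtype_eq_of_support_subset (s := s) (f := fun k => ⟪u k, x (w k)⟫_ℂ) ?_).symm
  intro k hk
  by_contra hks
  exact hk (by simp [(hzero k hks).1])

/-- The coordinates of a normal functional as a pair of vectors. -/
noncomputable def SqSummablePairs.left (p : SqSummablePairs K) : lp (fun _ : ℕ => K) 2 :=
  ⟨p.1.1, memℓp_two_of_summable p.2.1⟩

/-- The coordinates of a normal functional as a pair of vectors. -/
noncomputable def SqSummablePairs.right (p : SqSummablePairs K) : lp (fun _ : ℕ => K) 2 :=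
  ⟨p.1.2, memℓp_two_of_summable p.2.2⟩

theorem SqSummablePairs.tsum_eq (p : SqSummablePairs K) (x : K →L[ℂ] K) :
    ∑' n, ⟪p.1.1 n, x (p.1.2 n)⟫_ℂ = ⟪p.left, amplification K ℕ x p.right⟫_ℂ :=
  (lp.inner_eq_tsum (𝕜 := ℂ) p.left (amplification K ℕ x p.right)).symm

theorem continuous_sigmaWeak_rng {Y : Type*} [TopologicalSpace Y] {f : Y → (K →L[ℂ] K)}
    (h : ∀ p : SqSummablePairs K,
      Continuous fun y => ⟪p.left, amplification K ℕ (f y) p.right⟫_ℂ) :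
    @Continuous _ _ _ (sigmaWeak K) f := by
  refine continuous_iInf_rng.2 fun p => continuous_induced_rng.2 ?_
  have := h p
  simp only [← SqSummablePairs.tsum_eq] at this
  exact this

theorem tendsto_sigmaWeak {α : Type*} {l : Filter α} {f : α → (K →L[ℂ] K)} {x : K →L[ℂ] K}
    (h : ∀ p : SqSummablePairs K,
      Filter.Tendsto (fun y => ⟪p.left, amplification K ℕ (f y) p.right⟫_ℂ) l
        (nhds ⟪p.left, amplification K ℕ x p.right⟫_ℂ)) :
    Filter.Tendsto f l (@nhds _ (sigmaWeak K) x) := by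
  rw [nhds_iInf, Filter.tendsto_iInf]
  intro p
  rw [nhds_induced, Filter.tendsto_comap_iff]
  have := h p
  simp only [← SqSummablePairs.tsum_eq] at this
  exact this

/-- A bounded family of operators which converges strongly converges `σ`-weakly. -/
theorem tendsto_sigmaWeak_of_strong {α : Type*} {l : Filter α} {f : α → (K →L[ℂ] K)}
    {x : K →L[ℂ] K} {C : ℝ} (hC : ∀ a, ‖f a‖ ≤ C)
    (h : ∀ ξ, Filter.Tendsto (fun a => f a ξ) l (nhds (x ξ))) :
    Filter.Tendsto f l (@nhds _ (sigmaWeak K) x) := by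
  refine tendsto_sigmaWeak fun p => ?_
  simp only [lp.inner_eq_tsum, amplification_apply]
  refine tendsto_tsum_of_dominated_convergence
    (bound := fun n => C * (‖p.left n‖ ^ 2 + ‖p.right n‖ ^ 2))
    (((summable_norm_sq_lp _).add (summable_norm_sq_lp _)).mul_left _)
    (fun n => tendsto_const_nhds.inner (h _)) (Filter.Eventually.of_forall fun a n => ?_)
  have hC0 : 0 ≤ C := (norm_nonneg _).trans (hC a)
  calc ‖⟪p.left n, f a (p.right n)⟫_ℂ‖ ≤ ‖p.left n‖ * ‖f a (p.right n)‖ := norm_inner_le_norm _ _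
    _ ≤ ‖p.left n‖ * (C * ‖p.right n‖) := by
        gcongr
        exact (f a).le_of_opNorm_le (hC a) _
    _ ≤ C * (‖p.left n‖ ^ 2 + ‖p.right n‖ ^ 2) := by
        have h1 : ‖p.left n‖ * ‖p.right n‖ ≤ ‖p.left n‖ ^ 2 + ‖p.right n‖ ^ 2 := by
          nlinarith [sq_nonneg (‖p.left n‖ - ‖p.right n‖), norm_nonneg (p.left n),
            norm_nonneg (p.right n)]
        calc _ = C * (‖p.left n‖ * ‖p.right n‖) := by ring
          _ ≤ _ := by gcongr

end Amplification

/-! ### Normal completely positive maps in Stinespring form -/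

section NormalMaps

variable {K : Type u} [NormedAddCommGroup K] [InnerProductSpace ℂ K] [CompleteSpace K]
variable {κ : Type v}

theorem summable_norm_sq_amplified (W : K →L[ℂ] lp (fun _ : κ => K) 2)
    (f : lp (fun _ : ℕ => K) 2) : Summable fun q : ℕ × κ => ‖W (f q.1) q.2‖ ^ 2 := by
  refine (summable_prod_of_nonneg fun _ => by positivity).2
    ⟨fun n => summable_norm_sq_lp (W (f n)), ?_⟩
  simp only [← norm_sq_lp]
  refine Summable.of_nonneg_of_le (fun _ => by positivity) (fun n => ?_)
    ((summable_norm_sq_lp f).mul_left (‖W‖ ^ 2))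
  rw [← mul_pow]
  gcongr
  exact W.le_opNorm _

/-- Apply an operator `K → ℓ²(κ, K)` to each member of a sequence. -/
noncomputable def amplifiedVector (W : K →L[ℂ] lp (fun _ : κ => K) 2)
    (f : lp (fun _ : ℕ => K) 2) : lp (fun _ : ℕ × κ => K) 2 :=
  ⟨fun q => W (f q.1) q.2, memℓp_two_of_summable (summable_norm_sq_amplified W f)⟩

/-- The normal map `x ↦ W'^* (x ⊗ 1) W`. -/
noncomputable def dilate (W' W : K →L[ℂ] lp (fun _ : κ => K) 2) :
    (K →L[ℂ] K) →L[ℂ] (K →L[ℂ] K) :=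
  LinearMap.mkContinuous
    { toFun := fun x => (ContinuousLinearMap.adjoint W').comp ((amplification K κ x).comp W)
      map_add' := fun x y => by ext ξ; simp
      map_smul' := fun c x => by ext ξ; simp }
    (‖W'‖ * ‖W‖) fun x => by
      refine (ContinuousLinearMap.opNorm_comp_le _ _).trans ?_
      rw [LinearIsometryEquiv.norm_map, mul_assoc]
      gcongr
      refine (ContinuousLinearMap.opNorm_comp_le _ _).trans ?_
      rw [mul_comm]
      gcongr
      exact norm_amplification_le x

theorem dilate_apply (W' W : K →L[ℂ] lp (fun _ : κ => K) 2) (x : K →L[ℂ] K) :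
    dilate W' W x = (ContinuousLinearMap.adjoint W').comp ((amplification K κ x).comp W) := rfl

theorem norm_dilate_le (W' W : K →L[ℂ] lp (fun _ : κ => K) 2) :
    ‖dilate W' W‖ ≤ ‖W'‖ * ‖W‖ :=
  LinearMap.mkContinuous_norm_le _ (by positivity) _

theorem inner_dilate (W' W : K →L[ℂ] lp (fun _ : κ => K) 2) (x : K →L[ℂ] K) (ξ η : K) :
    ⟪ξ, dilate W' W x η⟫_ℂ = ⟪W' ξ, amplification K κ x (W η)⟫_ℂ := by
  simp [dilate_apply, ContinuousLinearMap.adjoint_inner_right]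

/-- Composing a normal functional with `dilate` gives a vector functional of multiplicity ℕ × κ, and
such functionals are σ-weakly continuous. -/
theorem continuous_sigmaWeak_dilate (W' W : K →L[ℂ] lp (fun _ : κ => K) 2) :
    @Continuous _ _ (sigmaWeak K) (sigmaWeak K) (dilate W' W) := by
  let _ := sigmaWeak K
  refine continuous_iInf_rng.2 fun p => continuous_induced_rng.2 ?_
  have h := continuous_inner_amplification (amplifiedVector W' p.left) (amplifiedVector W p.right)
  convert h using 2 with x
  have hs := lp.summable_inner (𝕜 := ℂ) (amplifiedVector W' p.left)
    (amplification K (ℕ × κ) x (amplifiedVector W p.right))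
  rw [lp.inner_eq_tsum, hs.tsum_prod]
  refine tsum_congr fun n => ?_
  change ⟪p.left n, dilate W' W x (p.right n)⟫_ℂ = _
  rw [inner_dilate, lp.inner_eq_tsum]
  rfl

/-- Maps of the form `x ↦ W^* (x ⊗ 1) W` are completely positive. -/
theorem isCompletelyPositive_dilate (W : K →L[ℂ] lp (fun _ : κ => K) 2)
    (A : StarSubalgebra ℂ (K →L[ℂ] K)) :
    IsCompletelyPositive A fun x => dilate W W (x : K →L[ℂ] K) := by
  intro n X ξ
  have h : ∑ i, ∑ j, ⟪ξ i, dilate W W ((X.conjTranspose * X) i j : A) (ξ j)⟫_ℂ =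
      ∑ k, ⟪∑ i, amplification K κ (X k i) (W (ξ i)),
        ∑ j, amplification K κ (X k j) (W (ξ j))⟫_ℂ := by
    have h1 : ∀ i j, ⟪ξ i, dilate W W ((X.conjTranspose * X) i j : A) (ξ j)⟫_ℂ =
        ∑ k, ⟪amplification K κ (X k i) (W (ξ i)), amplification K κ (X k j) (W (ξ j))⟫_ℂ := by
      intro i j
      have h2 : (((X.conjTranspose * X) i j : A) : K →L[ℂ] K) =
          ∑ k, star (X k i : K →L[ℂ] K) * (X k j : K →L[ℂ] K) := by
        simp [Matrix.mul_apply]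
      rw [inner_dilate, h2, map_sum, sum_apply, inner_sum]
      refine Finset.sum_congr rfl fun k _ => ?_
      rw [map_mul, map_star, mul_apply_eq_comp, ContinuousLinearMap.star_eq_adjoint,
        ContinuousLinearMap.adjoint_inner_right]
    simp only [h1, sum_inner, inner_sum]
    rw [Finset.sum_comm]
    refine (Finset.sum_congr rfl fun j _ => Finset.sum_comm).trans ?_
    exact Finset.sum_comm
  rw [h]
  exact Finset.sum_nonneg fun k _ => by
    rw [inner_self_eq_norm_sq_to_K]
    positivity

theorem continuous_inner_apply (ξ η : K) :
    @Continuous _ _ (sigmaWeak K) _ fun x : K →L[ℂ] K => ⟪ξ, x η⟫_ℂ := by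
  have h := continuous_inner_amplification (κ := Unit) (lp.single 2 () ξ) (lp.single 2 () η)
  convert h using 2 with x
  rw [lp.inner_single_left]
  simp

theorem mem_generatedVN_iff {S : Set (K →L[ℂ] K)} {x : K →L[ℂ] K} :
    x ∈ (generatedVN S).toStarSubalgebra ↔
      ∀ y ∈ StarSubalgebra.centralizer ℂ S, y * x = x * y := by
  change x ∈ StarSubalgebra.centralizer ℂ (StarSubalgebra.centralizer ℂ S : Set (K →L[ℂ] K)) ↔ _
  rw [StarSubalgebra.mem_centralizer_iff]
  exact ⟨fun h y hy => (h y hy).1, fun h y hy => ⟨h y hy, h _ (star_mem hy)⟩⟩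

/-- Commutation with `y` is tested by the equalities ⟨y^*ξ, xη⟩ = ⟨ξ, xyη⟩, both sides of which are
σ-weakly continuous in x. -/
theorem isClosed_sigmaWeak_generatedVN (S : Set (K →L[ℂ] K)) :
    @IsClosed _ (sigmaWeak K) ((generatedVN S).toStarSubalgebra : Set (K →L[ℂ] K)) := by
  let _ := sigmaWeak K
  have : ((generatedVN S).toStarSubalgebra : Set (K →L[ℂ] K)) =
      ⋂ y ∈ StarSubalgebra.centralizer ℂ S, ⋂ ξ : K, ⋂ η : K,
        {x | ⟪star y ξ, x η⟫_ℂ = ⟪ξ, x (y η)⟫_ℂ} := by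
    ext x
    simp only [SetLike.mem_coe, mem_generatedVN_iff, Set.mem_iInter, Set.mem_ofPred_eq]
    refine forall₂_congr fun y _ => ?_
    simp only [ContinuousLinearMap.star_eq_adjoint, ContinuousLinearMap.adjoint_inner_left]
    constructor
    · intro h ξ η
      rw [← mul_apply_eq_comp, h, mul_apply_eq_comp]
    · intro h
      ext η
      exact ext_inner_left ℂ fun ξ => h ξ η
  rw [this]
  refine isClosed_biInter fun y _ => isClosed_iInter fun ξ => isClosed_iInter fun η => ?_
  exact isClosed_eq (continuous_inner_apply _ _) (continuous_inner_apply _ _)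

end NormalMaps

/-! ### The double commutant theorem with multiplicity and σ-weak density -/

section DoubleCommutant

variable {K : Type u} [NormedAddCommGroup K] [InnerProductSpace ℂ K] [CompleteSpace K]
variable {κ : Type v}

theorem amplification_single [DecidableEq κ] (x : K →L[ℂ] K) (k : κ) (ξ : K) :
    amplification K κ x (lp.single 2 k ξ) = lp.single 2 k (x ξ) := by
  ext i
  by_cases h : i = k
  · subst h; simp
  · simp [h]

/-- Operators commuting with the amplifications of `A` commute with those of `A''`. -/
theorem commute_amplification {S : Set (K →L[ℂ] K)} {x : K →L[ℂ] K}
    (hx : x ∈ (generatedVN S).toStarSubalgebra)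
    (P : lp (fun _ : κ => K) 2 →L[ℂ] lp (fun _ : κ => K) 2)
    (hP : ∀ a ∈ StarAlgebra.adjoin ℂ S, P * amplification K κ a = amplification K κ a * P) :
    P * amplification K κ x = amplification K κ x * P := by
  classical
  have hentry : ∀ k l, ∀ ξ, P (lp.single 2 l (x ξ)) k = x (P (lp.single 2 l ξ) k) := by
    intro k l
    -- The matrix entries of `P` commute with `S` and its adjoints, so they lie in the commutant and
    -- therefore commute with `x`.
    let Q : K →L[ℂ] K := (lp.evalCLM ℂ (fun _ : κ => K) 2 k).comp
      (P.comp (lp.singleContinuousLinearMap ℂ (fun _ : κ => K) 2 l))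
    have hQ : ∀ ξ, Q ξ = P (lp.single 2 l ξ) k := fun _ => rfl
    have hc : ∀ a ∈ StarAlgebra.adjoin ℂ S, a * Q = Q * a := by
      intro a ha
      ext ξ
      have := congrArg (fun f => f k) (DFunLike.congr_fun (hP a ha) (lp.single 2 l ξ))
      simp only [mul_apply_eq_comp, amplification_single, amplification_apply] at this
      simp only [mul_apply_eq_comp, hQ]
      exact this.symm
    have hQS : Q ∈ StarSubalgebra.centralizer ℂ S := by
      rw [StarSubalgebra.mem_centralizer_iff]
      intro g hg
      have hg' := StarAlgebra.subset_adjoin ℂ S hg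
      exact ⟨hc g hg', hc _ (star_mem hg')⟩
    intro ξ
    exact DFunLike.congr_fun (mem_generatedVN_iff.1 hx Q hQS) ξ
  have hsing : ∀ l ξ, P (amplification K κ x (lp.single 2 l ξ)) =
      amplification K κ x (P (lp.single 2 l ξ)) := by
    intro l ξ
    ext k
    rw [amplification_single, amplification_apply, hentry]
  ext1 f
  have h1 := lp.hasSum_single (p := 2) (by simp) f
  have h2 := h1.mapL (P * amplification K κ x)
  have h3 := h1.mapL (amplification K κ x * P)
  refine h2.unique ?_
  convert h3 using 2 with l
  exact hsing l (f l)

/-- The strong form of the double commutant theorem, with multiplicity. -/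
theorem exists_amplification_near {S : Set (K →L[ℂ] K)} {x : K →L[ℂ] K}
    (hx : x ∈ (generatedVN S).toStarSubalgebra) (w : lp (fun _ : κ => K) 2) {ε : ℝ} (hε : 0 < ε) :
    ∃ a ∈ StarAlgebra.adjoin ℂ S, ‖amplification K κ (x - a) w‖ < ε := by
  -- The projection onto the closed orbit of `w` under the amplified *-algebra commutes with that
  -- algebra, hence with the amplification of `x`. Since `w` is in the orbit, x w stays in its
  -- closure.
  let N₀ : Submodule ℂ (lp (fun _ : κ => K) 2) :=
    ((StarAlgebra.adjoin ℂ S).toSubalgebra.toSubmodule).map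
      ((ContinuousLinearMap.apply ℂ (lp (fun _ : κ => K) 2) w).toLinearMap.comp
        (amplification K κ).toAlgHom.toLinearMap)
  have hN₀ : ∀ f, f ∈ N₀ ↔ ∃ a ∈ StarAlgebra.adjoin ℂ S, amplification K κ a w = f :=
    fun f => Iff.rfl
  let N := N₀.topologicalClosure
  have hinv : ∀ a ∈ StarAlgebra.adjoin ℂ S, ∀ f ∈ N, amplification K κ a f ∈ N := by
    intro a ha f hf
    refine map_mem_closure (amplification K κ a).continuous hf fun g hg => ?_
    obtain ⟨b, hb, rfl⟩ := hg
    exact (hN₀ _).2 ⟨a * b, mul_mem ha hb, by simp⟩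
  have : CompleteSpace N := N₀.isClosed_topologicalClosure.completeSpace_coe
  have hcomm : ∀ a ∈ StarAlgebra.adjoin ℂ S,
      N.starProjection * amplification K κ a = amplification K κ a * N.starProjection := by
    intro a ha
    ext1 f
    refine Submodule.eq_starProjection_of_mem_of_inner_eq_zero ?_ ?_
    · exact hinv a ha _ (Submodule.starProjection_apply_mem _ _)
    · intro g hg
      change ⟪amplification K κ a f - amplification K κ a (N.starProjection f), g⟫_ℂ = 0
      rw [← map_sub, ← ContinuousLinearMap.adjoint_inner_right,
        ← ContinuousLinearMap.star_eq_adjoint, ← map_star]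
      exact Submodule.starProjection_inner_eq_zero _ _ (hinv _ (star_mem ha) _ hg)
  have hw : w ∈ N := N₀.le_topologicalClosure ((hN₀ _).2 ⟨1, one_mem _, by simp⟩)
  have hxw : amplification K κ x w ∈ N := by
    have h := DFunLike.congr_fun (commute_amplification hx N.starProjection hcomm) w
    rw [mul_apply_eq_comp, mul_apply_eq_comp,
      Submodule.starProjection_eq_self_iff.2 hw] at h
    rw [← h]
    exact Submodule.starProjection_apply_mem _ _
  obtain ⟨f, ⟨a, ha, rfl⟩, hd⟩ := Metric.mem_closure_iff.1 hxw ε hε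
  refine ⟨a, ha, ?_⟩
  rw [map_sub, sub_apply, ← dist_eq_norm]
  exact hd

/-- The `σ`-weak density part of the double commutant theorem. -/
theorem generatedVN_subset_closure (S : Set (K →L[ℂ] K)) :
    ((generatedVN S).toStarSubalgebra : Set (K →L[ℂ] K)) ⊆
      @closure _ (sigmaWeak K) (StarAlgebra.adjoin ℂ S : Set (K →L[ℂ] K)) := by
  let _ := sigmaWeak K
  intro x hx
  rw [mem_closure_iff_nhds]
  intro t ht
  rw [nhds_iInf, Filter.mem_iInf] at ht
  obtain ⟨I, hI, V, hV, rfl⟩ := ht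
  have hball : ∀ i : I, ∃ δ > 0, ∀ y, ‖⟪(i : SqSummablePairs K).left,
      amplification K ℕ (x - y) (i : SqSummablePairs K).right⟫_ℂ‖ < δ → y ∈ V i := by
    intro i
    have h := hV i
    rw [nhds_induced, Filter.mem_comap] at h
    obtain ⟨s, hs, hsV⟩ := h
    obtain ⟨δ, hδ, hb⟩ := Metric.mem_nhds_iff.1 hs
    refine ⟨δ, hδ, fun y hy => hsV (hb ?_)⟩
    rw [Metric.mem_ball', dist_eq_norm, SqSummablePairs.tsum_eq]
    change ‖_ - ∑' n, ⟪i.1.1.1 n, y (i.1.1.2 n)⟫_ℂ‖ < δ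
    rw [SqSummablePairs.tsum_eq, ← inner_sub_right, ← sub_apply, ← map_sub]
    exact hy
  choose δ hδ hδV using hball
  have := hI.fintype
  -- The finitely many functionals of a basic neighbourhood are put into one vector of multiplicity
  -- `I × ℕ`, so that a single approximant serves all of them.
  have hsum : Summable fun q : I × ℕ => ‖(q.1 : SqSummablePairs K).right q.2‖ ^ 2 := by
    refine (summable_prod_of_nonneg fun _ => by positivity).2
      ⟨fun i => summable_norm_sq_lp (i : SqSummablePairs K).right, Summable.of_finite⟩
  let w : lp (fun _ : I × ℕ => K) 2 :=
    ⟨fun q => (q.1 : SqSummablePairs K).right q.2, memℓp_two_of_summable hsum⟩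
  have hle : ∀ (y : K →L[ℂ] K) (i : I), ‖amplification K ℕ y (i : SqSummablePairs K).right‖ ≤
      ‖amplification K (I × ℕ) y w‖ := by
    intro y i
    refine le_of_sq_le_sq ?_ (norm_nonneg _)
    rw [norm_sq_lp, norm_sq_lp]
    exact Summable.tsum_le_tsum_of_inj (Prod.mk i) (Prod.mk_right_injective i)
      (fun _ _ => by positivity) (fun n => le_rfl) (summable_norm_sq_lp _) (summable_norm_sq_lp _)
  obtain ⟨ε, hε, hεδ⟩ : ∃ ε > 0, ∀ i : I, ‖(i : SqSummablePairs K).left‖ * ε < δ i := by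
    have h : ∀ᶠ ε in nhdsWithin (0 : ℝ) (Set.Ioi 0),
        ∀ i : I, ‖(i : SqSummablePairs K).left‖ * ε < δ i := by
      refine Filter.eventually_all.2 fun i => ?_
      have hc : Filter.Tendsto (fun ε : ℝ => ‖(i : SqSummablePairs K).left‖ * ε)
          (nhdsWithin (0 : ℝ) (Set.Ioi 0)) (nhds 0) := by
        have : Continuous fun ε : ℝ => ‖(i : SqSummablePairs K).left‖ * ε := by fun_prop
        simpa using (this.tendsto 0).mono_left nhdsWithin_le_nhds
      exact hc.eventually (gt_mem_nhds (hδ i))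
    obtain ⟨ε, h1, h2⟩ := (h.and self_mem_nhdsWithin).exists
    exact ⟨ε, h2, h1⟩
  obtain ⟨a, ha, hnear⟩ := exists_amplification_near hx w hε
  refine ⟨a, Set.mem_iInter.2 fun i => hδV i a ?_, ha⟩
  calc _ ≤ ‖(i : SqSummablePairs K).left‖ * ‖amplification K ℕ (x - a) _‖ := norm_inner_le_norm _ _
    _ ≤ ‖(i : SqSummablePairs K).left‖ * ε := by
        gcongr
        exact (hle _ i).trans hnear.le
    _ < δ i := hεδ i

/-- A `σ`-weakly continuous map which sends the generated `*`-algebra to the von Neumann algebra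
preserves the von Neumann algebra. -/
theorem mapsTo_generatedVN {S : Set (K →L[ℂ] K)} {Φ : (K →L[ℂ] K) → (K →L[ℂ] K)}
    (hΦ : @Continuous _ _ (sigmaWeak K) (sigmaWeak K) Φ)
    (h : ∀ a ∈ StarAlgebra.adjoin ℂ S, Φ a ∈ (generatedVN S).toStarSubalgebra)
    {x : K →L[ℂ] K} (hx : x ∈ (generatedVN S).toStarSubalgebra) :
    Φ x ∈ (generatedVN S).toStarSubalgebra := by
  let _ := sigmaWeak K
  have h1 := map_mem_closure hΦ (generatedVN_subset_closure S hx) h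
  rwa [(isClosed_sigmaWeak_generatedVN S).closure_eq] at h1

theorem eqOn_generatedVN {S : Set (K →L[ℂ] K)} {Φ Ψ : (K →L[ℂ] K) → (K →L[ℂ] K)}
    (hΦ : @Continuous _ _ (sigmaWeak K) (sigmaWeak K) Φ)
    (hΨ : @Continuous _ _ (sigmaWeak K) (sigmaWeak K) Ψ)
    (h : ∀ a ∈ StarAlgebra.adjoin ℂ S, Φ a = Ψ a)
    {x : K →L[ℂ] K} (hx : x ∈ (generatedVN S).toStarSubalgebra) : Φ x = Ψ x := by
  let _ := sigmaWeak K
  ext η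
  refine ext_inner_left ℂ fun ξ => ?_
  have h1 : IsClosed {x | ⟪ξ, Φ x η⟫_ℂ = ⟪ξ, Ψ x η⟫_ℂ} :=
    isClosed_eq ((continuous_inner_apply ξ η).comp hΦ) ((continuous_inner_apply ξ η).comp hΨ)
  exact closure_minimal (fun a ha => by simp only [Set.mem_ofPred_eq, h a ha]) h1
    (generatedVN_subset_closure S hx)

end DoubleCommutant

/-! ## Creation operators on the full Fock space -/

section FockBasics

variable {H : Type u} [NormedAddCommGroup H] [InnerProductSpace ℂ H] [CompleteSpace H]

theorem inner_tensorLeft (a b : H) (n : ℕ) (x y : TensorPow H n) :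
    ⟪tensorLeft a n x, tensorLeft b n y⟫_ℂ = ⟪a, b⟫_ℂ * ⟪x, y⟫_ℂ :=
  (UniformSpace.Completion.inner_coe (𝕜 := ℂ) (a ⊗ₜ[ℂ] x : H ⊗[ℂ] TensorPow H n)
    (b ⊗ₜ[ℂ] y)).trans (TensorProduct.inner_tmul ..)

theorem creation_fst (ξ : H) (x : Fock H) : (creation ξ x).fst = 0 := rfl

theorem creation_snd (ξ : H) (x : Fock H) (n : ℕ) :
    (creation ξ x).snd n = creationSeq ξ x n := rfl

theorem inner_creation (a b : H) (x y : Fock H) :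
    ⟪creation a x, creation b y⟫_ℂ = ⟪a, b⟫_ℂ * ⟪x, y⟫_ℂ := by
  have h0 : ⟪creationSeq a x 0, creationSeq b y 0⟫_ℂ = ⟪a, b⟫_ℂ * ⟪x.fst, y.fst⟫_ℂ := by
    change ⟪x.fst • a, y.fst • b⟫_ℂ = _
    rw [inner_smul_left, inner_smul_right]
    simp
    ring
  have hs := lp.summable_inner (𝕜 := ℂ) (creation a x).snd (creation b y).snd
  simp only [creation_snd] at hs
  rw [WithLp.prod_inner_apply, WithLp.prod_inner_apply]
  change ⟪(creation a x).fst, (creation b y).fst⟫_ℂ + ⟪(creation a x).snd, (creation b y).snd⟫_ℂ =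
    _ * (⟪x.fst, y.fst⟫_ℂ + ⟪x.snd, y.snd⟫_ℂ)
  rw [lp.inner_eq_tsum, lp.inner_eq_tsum]
  simp only [creation_snd]
  rw [hs.tsum_eq_zero_add, h0, creation_fst, creation_fst, inner_zero_left, zero_add, mul_add]
  congr 1
  rw [← tsum_mul_left]
  exact tsum_congr fun n => inner_tensorLeft a b n _ _

theorem star_creation_apply_creation (a b : H) (x : Fock H) :
    star (creation a) (creation b x) = ⟪a, b⟫_ℂ • x := by
  refine ext_inner_left ℂ fun y => ?_
  rw [ContinuousLinearMap.star_eq_adjoint, ContinuousLinearMap.adjoint_inner_right,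
    inner_creation, inner_smul_right]

theorem star_creation_mul_creation (a b : H) :
    star (creation a) * creation b = ⟪a, b⟫_ℂ • (1 : Fock H →L[ℂ] Fock H) := by
  ext1 x
  exact star_creation_apply_creation a b x

theorem inner_vacuum_creation (a : H) (x : Fock H) : ⟪vacuum H, creation a x⟫_ℂ = 0 := by
  rw [WithLp.prod_inner_apply]
  change ⟪(1 : ℂ), (0 : ℂ)⟫_ℂ + ⟪(0 : lp (fun n : ℕ => TensorPow H n) 2), (creation a x).snd⟫_ℂ = 0
  simp

theorem inner_creation_vacuum (a : H) (x : Fock H) : ⟪creation a x, vacuum H⟫_ℂ = 0 := by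
  rw [← inner_conj_symm, inner_vacuum_creation, map_zero]

@[simp] theorem star_creation_vacuum (a : H) : star (creation a) (vacuum H) = 0 := by
  refine ext_inner_left ℂ fun y => ?_
  rw [ContinuousLinearMap.star_eq_adjoint, ContinuousLinearMap.adjoint_inner_right,
    inner_creation_vacuum, inner_zero_right]

variable (H) in
theorem inner_vacuum_vacuum : ⟪vacuum H, vacuum H⟫_ℂ = 1 := by
  rw [WithLp.prod_inner_apply]
  change ⟪(1 : ℂ), (1 : ℂ)⟫_ℂ + ⟪(0 : lp (fun n : ℕ => TensorPow H n) 2), 0⟫_ℂ = 1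
  simp

theorem creation_add (a b : H) : creation (a + b) = creation a + creation b := by
  ext1 x
  apply WithLp.ofLp_injective 2
  refine Prod.ext (add_zero (0 : ℂ)).symm (Subtype.ext (funext fun n => ?_))
  cases n with
  | zero => exact smul_add x.fst a b
  | succ n =>
    change tensorLeft (a + b) n (x.snd n) = tensorLeft a n (x.snd n) + tensorLeft b n (x.snd n)
    simp only [tensorLeft, map_add, ContinuousLinearMap.comp_add]
    rfl

theorem creation_smul (c : ℂ) (a : H) : creation (c • a) = c • creation a := by
  ext1 x
  apply WithLp.ofLp_injective 2
  refine Prod.ext (smul_zero c).symm (Subtype.ext (funext fun n => ?_))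
  cases n with
  | zero => exact smul_comm x.fst c a
  | succ n =>
    change tensorLeft (c • a) n (x.snd n) = c • tensorLeft a n (x.snd n)
    simp only [tensorLeft, map_smul, ContinuousLinearMap.comp_smul]
    rfl

theorem norm_creation_le (a : H) : ‖creation a‖ ≤ ‖a‖ :=
  LinearMap.mkContinuous_norm_le _ (norm_nonneg _) _

variable (H) in
/-- The creation operators as a bounded linear map. -/
noncomputable def creationL : H →L[ℂ] (Fock H →L[ℂ] Fock H) :=
  LinearMap.mkContinuous
    { toFun := creation, map_add' := creation_add, map_smul' := creation_smul } 1
    fun a => by simpa using norm_creation_le a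

@[simp] theorem creationL_apply (a : H) : creationL H a = creation a := rfl

/-- The elementary tensor `h₁ ⊗ ⋯ ⊗ hₙ` in the Fock space. -/
noncomputable def fockVec : List H → Fock H
  | [] => vacuum H
  | h :: a => creation h (fockVec a)

@[simp] theorem fockVec_nil : fockVec ([] : List H) = vacuum H := rfl
@[simp] theorem fockVec_cons (h : H) (a : List H) : fockVec (h :: a) = creation h (fockVec a) := rfl

/-- The inclusion of a tensor power in the Fock space. -/
noncomputable def tensorIncl (n : ℕ) (η : TensorPow H n) : Fock H :=
  WithLp.toLp 2 (0, lp.single 2 n η)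

theorem creation_tensorIncl (h : H) (n : ℕ) (η : TensorPow H n) :
    creation h (tensorIncl n η) = tensorIncl (n + 1) (tensorLeft h n η) := by
  apply WithLp.ofLp_injective 2
  refine Prod.ext rfl (Subtype.ext (funext fun m => ?_))
  change creationSeq h (tensorIncl n η) m = lp.single 2 (n + 1) (tensorLeft h n η) m
  cases m with
  | zero =>
    rw [lp.single_apply_ne _ _ _ (by simp)]
    exact zero_smul ℂ h
  | succ m =>
    change tensorLeft h m ((lp.single 2 n η : lp (fun n : ℕ => TensorPow H n) 2) m) = _
    by_cases hm : m = n
    · subst hm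
      simp
    · rw [lp.single_apply_ne _ _ _ hm, lp.single_apply_ne _ _ _ (by simpa using hm), map_zero]

theorem continuous_tensorIncl (n : ℕ) : Continuous (tensorIncl (H := H) n) := by
  have h1 : Continuous fun η : TensorPow H n =>
      (lp.single 2 n η : lp (fun n : ℕ => TensorPow H n) 2) :=
    (lp.singleContinuousLinearMap ℂ (fun n : ℕ => TensorPow H n) 2 n).continuous
  exact (WithLp.prod_continuous_toLp 2 _ _).comp (continuous_const.prodMk h1)

theorem tensorIncl_zero (h : H) : tensorIncl (H := H) 0 h = creation h (vacuum H) := by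
  apply WithLp.ofLp_injective 2
  refine Prod.ext rfl (Subtype.ext (funext fun m => ?_))
  change (lp.single 2 0 h : lp (fun n : ℕ => TensorPow H n) 2) m = creationSeq h (vacuum H) m
  cases m with
  | zero =>
    exact (lp.single_apply_self (E := fun n : ℕ => TensorPow H n) 2 0 h).trans
      (one_smul ℂ h).symm
  | succ m =>
    exact (lp.single_apply_ne (E := fun n : ℕ => TensorPow H n) 2 0 h (by simp)).trans
      (map_zero (tensorLeft h m)).symm

/-- Elementary tensors h ⊗ x arise from degree `n` by a creation operator. Sums and the completion
are reached because `D` is a closed subspace. -/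
theorem tensorIncl_mem (D : Submodule ℂ (Fock H)) (hD : IsClosed (D : Set (Fock H)))
    (h1 : vacuum H ∈ D) (hc : ∀ h : H, ∀ x ∈ D, creation h x ∈ D) (n : ℕ) (η : TensorPow H n) :
    tensorIncl n η ∈ D := by
  induction n with
  | zero =>
    have := tensorIncl_zero (H := H) η
    rw [this]
    exact hc _ _ h1
  | succ n ih =>
    have hcl : IsClosed {η : TensorPow H (n + 1) | tensorIncl (n + 1) η ∈ D} :=
      hD.preimage (continuous_tensorIncl (n + 1))
    refine UniformSpace.Completion.induction_on (α := H ⊗[ℂ] TensorPow H n) η hcl fun t => ?_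
    induction t using TensorProduct.induction_on with
    | zero =>
      have : tensorIncl (n + 1) (0 : TensorPow H (n + 1)) = 0 := by
        simp [tensorIncl]
      exact this ▸ D.zero_mem
    | tmul h x =>
      have := creation_tensorIncl h n x
      have h2 := hc h _ (ih x)
      rw [this] at h2
      exact h2
    | add x y hx hy =>
      have hadd : ∀ p q : TensorPow H (n + 1),
          tensorIncl (n + 1) (p + q) = tensorIncl (n + 1) p + tensorIncl (n + 1) q := by
        intro p q
        apply WithLp.ofLp_injective 2
        refine Prod.ext (add_zero (0 : ℂ)).symm ?_
        exact map_add (lp.singleContinuousLinearMap ℂ (fun n : ℕ => TensorPow H n) 2 (n + 1)) p q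
      rw [UniformSpace.Completion.coe_add]
      exact (congrArg (· ∈ D) (hadd _ _)).mpr (D.add_mem hx hy)

theorem eq_top_of_creation_mem (D : Submodule ℂ (Fock H)) (hD : IsClosed (D : Set (Fock H)))
    (h1 : vacuum H ∈ D) (hc : ∀ h : H, ∀ x ∈ D, creation h x ∈ D) : D = ⊤ := by
  refine Submodule.eq_top_iff'.2 fun x => ?_
  have hx : x = x.fst • vacuum H + WithLp.toLp 2 (0, x.snd) := by
    apply WithLp.ofLp_injective 2
    refine Prod.ext ?_ ?_
    · change x.fst = x.fst • (1 : ℂ) + 0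
      simp
    · change x.snd = x.fst • (0 : lp (fun n : ℕ => TensorPow H n) 2) + x.snd
      simp
  rw [hx]
  refine D.add_mem (D.smul_mem _ h1) ?_
  have hs := lp.hasSum_single (p := 2) (by simp) x.snd
  have hcont : Continuous fun y : lp (fun n : ℕ => TensorPow H n) 2 =>
      (WithLp.toLp 2 ((0 : ℂ), y) : Fock H) :=
    (WithLp.prod_continuous_toLp 2 _ _).comp (continuous_const.prodMk continuous_id)
  have ht := (hcont.tendsto x.snd).comp hs
  refine hD.mem_of_tendsto ht (Filter.Eventually.of_forall fun s => ?_)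
  change (WithLp.toLp 2 ((0 : ℂ), ∑ i ∈ s, lp.single 2 i (x.snd i)) : Fock H) ∈ D
  have hsum : (WithLp.toLp 2 ((0 : ℂ), ∑ i ∈ s, lp.single 2 i (x.snd i)) : Fock H) =
      ∑ i ∈ s, tensorIncl i (x.snd i) := by
    induction s using Finset.induction_on with
    | empty => simp
    | insert i s his ih =>
      rw [Finset.sum_insert his, Finset.sum_insert his, ← ih]
      apply WithLp.ofLp_injective 2
      exact Prod.ext (add_zero (0 : ℂ)).symm rfl
  rw [hsum]
  exact D.sum_mem fun i _ => tensorIncl_mem D hD h1 hc i _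

theorem fockVec_span_closure :
    (Submodule.span ℂ (Set.range (fockVec (H := H)))).topologicalClosure = ⊤ := by
  refine eq_top_of_creation_mem _ (Submodule.isClosed_topologicalClosure _)
    (Submodule.le_topologicalClosure _ (Submodule.subset_span ⟨[], rfl⟩)) fun h x hx => ?_
  refine map_mem_closure (creation h).continuous hx fun y hy => ?_
  induction hy using Submodule.span_induction with
  | mem y hy =>
    obtain ⟨a, rfl⟩ := hy
    exact Submodule.subset_span ⟨h :: a, rfl⟩
  | zero => simp
  | add y z _ _ h1 h2 => rw [map_add]; exact Submodule.add_mem _ h1 h2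
  | smul c y _ h1 => rw [map_smul]; exact Submodule.smul_mem _ _ h1

theorem eq_top_of_fockVec_mem (D : Submodule ℂ (Fock H)) (hD : IsClosed (D : Set (Fock H)))
    (h : ∀ a : List H, fockVec a ∈ D) : D = ⊤ := by
  refine top_le_iff.1 (fockVec_span_closure.symm.trans_le ?_)
  exact Submodule.topologicalClosure_minimal _
    (Submodule.span_le.2 (Set.range_subset_iff.2 h)) hD

theorem ext_fockVec {G : Type*} [NormedAddCommGroup G] [NormedSpace ℂ G] {f g : Fock H →L[ℂ] G}
    (h : ∀ a : List H, f (fockVec a) = g (fockVec a)) : f = g := by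
  have : LinearMap.eqLocus f.toLinearMap g.toLinearMap = ⊤ :=
    eq_top_of_fockVec_mem _ (isClosed_eq f.continuous g.continuous) h
  ext x
  exact (this ▸ Submodule.mem_top : x ∈ LinearMap.eqLocus f.toLinearMap g.toLinearMap)

theorem ext_inner_fockVec {x y : Fock H} (h : ∀ a : List H, ⟪fockVec a, x⟫_ℂ = ⟪fockVec a, y⟫_ℂ) :
    x = y := by
  have h1 : innerSL ℂ x = innerSL ℂ y := ext_fockVec fun a => by
    rw [innerSL_apply_apply, innerSL_apply_apply, ← inner_conj_symm, h, inner_conj_symm]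
  exact ext_inner_right ℂ fun z => by simpa using DFunLike.congr_fun h1 z

end FockBasics

/-! ### Right creation operators and their commutation with left ones -/

section RightCreation

variable {H : Type u} [NormedAddCommGroup H] [InnerProductSpace ℂ H] [CompleteSpace H]

theorem inner_vacuum_fockVec_append (a : List H) (x : H) :
    ⟪vacuum H, fockVec (a ++ [x])⟫_ℂ = 0 := by
  cases a <;> exact inner_vacuum_creation _ _

/-- First letters are stripped in pairs; if one word ends before the other, both sides vanish
because words of different lengths are orthogonal. -/
theorem inner_fockVec_append (a b : List H) (x y : H) :
    ⟪fockVec (a ++ [x]), fockVec (b ++ [y])⟫_ℂ = ⟪x, y⟫_ℂ * ⟪fockVec a, fockVec b⟫_ℂ := by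
  induction a generalizing b with
  | nil =>
    cases b with
    | nil =>
      simp only [List.nil_append, fockVec_cons, fockVec_nil]
      exact inner_creation x y _ _
    | cons h b =>
      simp only [List.nil_append, fockVec_cons, List.cons_append, inner_creation, fockVec_nil,
        inner_vacuum_creation, inner_vacuum_fockVec_append, mul_zero]
  | cons k a ih =>
    cases b with
    | nil =>
      simp only [List.nil_append, fockVec_cons, List.cons_append, inner_creation, fockVec_nil,
        inner_creation_vacuum, mul_zero]
      rw [← inner_conj_symm (fockVec (a ++ [x])), inner_vacuum_fockVec_append, map_zero, mul_zero]
    | cons h b =>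
      simp only [fockVec_cons, List.cons_append, inner_creation, ih]
      ring

theorem denseRange_linearCombination_fockVec :
    DenseRange (Finsupp.linearCombination ℂ (fockVec (H := H))) := by
  have h := fockVec_span_closure (H := H)
  rw [← Finsupp.range_linearCombination] at h
  exact Submodule.dense_iff_topologicalClosure_eq_top.2 h

/-- Appending `x` multiplies the Gram matrix of the elementary tensors by ‖x‖². This is the bound
that makes right creation well defined and continuous. -/
theorem norm_linearCombination_append (x : H) (c : List H →₀ ℂ) :
    ‖Finsupp.linearCombination ℂ (fun a : List H => fockVec (a ++ [x])) c‖ ≤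
      ‖x‖ * ‖Finsupp.linearCombination ℂ (fockVec (H := H)) c‖ := by
  refine le_of_eq ((sq_eq_sq₀ (norm_nonneg _) (by positivity)).1 ?_)
  have h : ⟪Finsupp.linearCombination ℂ (fun a : List H => fockVec (a ++ [x])) c,
      Finsupp.linearCombination ℂ (fun a : List H => fockVec (a ++ [x])) c⟫_ℂ =
      ⟪x, x⟫_ℂ * ⟪Finsupp.linearCombination ℂ (fockVec (H := H)) c,
        Finsupp.linearCombination ℂ (fockVec (H := H)) c⟫_ℂ := by
    simp only [Finsupp.linearCombination_apply, Finsupp.sum, sum_inner, inner_sum,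
      inner_smul_left, inner_smul_right, inner_fockVec_append, Finset.mul_sum]
    refine Finset.sum_congr rfl fun a _ => Finset.sum_congr rfl fun b _ => ?_
    ring
  rw [inner_self_eq_norm_sq_to_K, inner_self_eq_norm_sq_to_K, inner_self_eq_norm_sq_to_K] at h
  rw [mul_pow]
  exact_mod_cast h

/-- The right creation operator `h₁ ⊗ ⋯ ⊗ hₙ ↦ h₁ ⊗ ⋯ ⊗ hₙ ⊗ x`. -/
noncomputable def rightCreation (x : H) : Fock H →L[ℂ] Fock H :=
  (Finsupp.linearCombination ℂ (fun a : List H => fockVec (a ++ [x]))).extendOfNorm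
    (Finsupp.linearCombination ℂ (fockVec (H := H)))

@[simp] theorem rightCreation_fockVec (x : H) (a : List H) :
    rightCreation x (fockVec a) = fockVec (a ++ [x]) := by
  have h := LinearMap.extendOfNorm_eq
    (f := Finsupp.linearCombination ℂ (fun a : List H => fockVec (a ++ [x])))
    (e := Finsupp.linearCombination ℂ (fockVec (H := H)))
    denseRange_linearCombination_fockVec ⟨‖x‖, norm_linearCombination_append x⟩
    (Finsupp.single a 1)
  rw [Finsupp.linearCombination_single, Finsupp.linearCombination_single, one_smul, one_smul] at h
  exact h

theorem star_rightCreation_fockVec (x y : H) (a : List H) :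
    star (rightCreation x) (fockVec (a ++ [y])) = ⟪x, y⟫_ℂ • fockVec a := by
  refine ext_inner_fockVec fun b => ?_
  rw [ContinuousLinearMap.star_eq_adjoint, ContinuousLinearMap.adjoint_inner_right,
    rightCreation_fockVec, inner_fockVec_append, inner_smul_right]

theorem star_rightCreation_vacuum (x : H) : star (rightCreation x) (vacuum H) = 0 := by
  refine ext_inner_fockVec fun b => ?_
  rw [ContinuousLinearMap.star_eq_adjoint, ContinuousLinearMap.adjoint_inner_right,
    rightCreation_fockVec, ← inner_conj_symm, inner_vacuum_fockVec_append, map_zero,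
    inner_zero_right]

theorem rightCreation_mul_creation (x h : H) :
    rightCreation x * creation h = creation h * rightCreation x :=
  ext_fockVec fun a => by
    simp only [mul_apply_eq_comp]
    rw [← fockVec_cons, rightCreation_fockVec, rightCreation_fockVec, List.cons_append,
      fockVec_cons]

variable (H) in
/-- The projection on the vacuum vector. -/
noncomputable def vacuumProj : Fock H →L[ℂ] Fock H :=
  (innerSL ℂ (vacuum H)).smulRight (vacuum H)

theorem vacuumProj_apply (x : Fock H) : vacuumProj H x = ⟪vacuum H, x⟫_ℂ • vacuum H := rfl

theorem star_vacuumProj : star (vacuumProj H) = vacuumProj H := by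
  rw [ContinuousLinearMap.star_eq_adjoint, eq_comm, ContinuousLinearMap.eq_adjoint_iff]
  intro x y
  rw [vacuumProj_apply, vacuumProj_apply, inner_smul_left, inner_smul_right, inner_conj_symm]
  ring

/-- On a nonempty word the first and last positions do not interfere. On the vacuum, the letter just
created is also the last one, which produces the rank one term. -/
theorem star_rightCreation_mul_creation (x h : H) :
    star (rightCreation x) * creation h =
      creation h * star (rightCreation x) + ⟪x, h⟫_ℂ • vacuumProj H :=
  ext_fockVec fun a => by
    simp only [mul_apply_eq_comp, add_apply, smul_apply, vacuumProj_apply]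
    rcases List.eq_nil_or_concat a with rfl | ⟨b, y, rfl⟩
    · rw [fockVec_nil, star_rightCreation_vacuum, inner_vacuum_vacuum, map_zero, zero_add, one_smul]
      exact star_rightCreation_fockVec x h []
    · rw [List.concat_eq_append, inner_vacuum_fockVec_append, star_rightCreation_fockVec,
        ← fockVec_cons, ← List.cons_append, star_rightCreation_fockVec, map_smul, fockVec_cons]
      simp

/-- The left and the right semicircular operators of vectors with real inner product commute. -/
theorem semicircular_comm_right {x h : H} (hxh : ⟪x, h⟫_ℂ = ⟪h, x⟫_ℂ) :
    semicircular h * (rightCreation x + star (rightCreation x)) =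
      (rightCreation x + star (rightCreation x)) * semicircular h := by
  have h1 := rightCreation_mul_creation x h
  have h2 : star (rightCreation x) * star (creation h) =
      star (creation h) * star (rightCreation x) := by
    rw [← star_mul, ← star_mul, h1]
  have h3 := star_rightCreation_mul_creation x h
  -- The adjoint relation carries ⟨h, x⟩. By reality it equals ⟨x, h⟩, so the two vacuum projections
  -- cancel in the commutator.
  have h4 : star (creation h) * rightCreation x =
      rightCreation x * star (creation h) + ⟪x, h⟫_ℂ • vacuumProj H := by
    have e := congrArg star h3
    rw [star_mul, star_star] at e
    rw [e]
    refine (star_add (R := Fock H →L[ℂ] Fock H) _ _).trans (congrArg₂ _ ?_ ((star_smul (A := Fock H →L[ℂ] Fock H) _ _).trans ?_))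
    · rw [star_mul, star_star]
    · rw [star_vacuumProj, RCLike.star_def, inner_conj_symm, hxh]
  have key : (creation h + star (creation h)) * (rightCreation x + star (rightCreation x)) =
      (rightCreation x + star (rightCreation x)) * (creation h + star (creation h)) := by
    rw [add_mul, mul_add, mul_add, add_mul, mul_add, mul_add, h1, h2, h3, h4]
    abel
  rw [semicircular, smul_mul_assoc, mul_smul_comm, key]

end RightCreation

/-! ### Cyclicity of the vacuum -/

section Cyclicity

variable {H : Type u} [NormedAddCommGroup H] [InnerProductSpace ℂ H] [CompleteSpace H]

/-- If `S` spans a dense subspace, a closed subspace which contains the vacuum and is invariant under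
`ℓ(ξ) + ℓ(ξ)^*` for `ξ ∈ S` is everything. -/
theorem eq_top_of_semicircular_mem {S : Set H}
    (hS : (Submodule.span ℂ S).topologicalClosure = ⊤) (D : Submodule ℂ (Fock H))
    (hD : IsClosed (D : Set (Fock H))) (h1 : vacuum H ∈ D)
    (hc : ∀ ξ ∈ S, ∀ x ∈ D, (creation ξ + star (creation ξ)) x ∈ D) : D = ⊤ := by
  refine eq_top_of_fockVec_mem D hD fun a => ?_
  -- Strong induction is needed because ℓ(ξ)^* shortens a word: h ⊗ b is reached from words of
  -- length |b| and |b| - 1.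
  induction hn : a.length using Nat.strong_induction_on generalizing a with
  | _ n ih =>
    subst hn
    cases a with
    | nil => exact h1
    | cons h b =>
      let L : H →L[ℂ] Fock H := (ContinuousLinearMap.apply ℂ (Fock H) (fockVec b)).comp (creationL H)
      have hL : ∀ k, L k = fockVec (k :: b) := fun _ => rfl
      -- By linearity and continuity in the first letter, it is enough to let that letter run
      -- through `S`.
      have htop : (D.comap L.toLinearMap) = ⊤ := by
        refine top_le_iff.1 (hS.symm.trans_le (Submodule.topologicalClosure_minimal _
          (Submodule.span_le.2 fun ξ hξ => ?_) (hD.preimage L.continuous)))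
        change L ξ ∈ D
        have e : L ξ = (creation ξ + star (creation ξ)) (fockVec b) -
            star (creation ξ) (fockVec b) := by
          rw [hL, fockVec_cons, add_apply, add_sub_cancel_right]
        rw [e]
        refine D.sub_mem (hc ξ hξ _ (ih _ (by simp) b rfl)) ?_
        cases b with
        | nil => simp
        | cons k b =>
          rw [fockVec_cons, star_creation_apply_creation]
          exact D.smul_mem _ (ih _ (by simp) b rfl)
      have : h ∈ D.comap L.toLinearMap := htop ▸ Submodule.mem_top
      exact this

/-- The analogue of `eq_top_of_semicircular_mem` for the right creation operators. -/
theorem eq_top_of_right_semicircular_mem {S : Set H}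
    (hS : (Submodule.span ℂ S).topologicalClosure = ⊤) (D : Submodule ℂ (Fock H))
    (hD : IsClosed (D : Set (Fock H))) (h1 : vacuum H ∈ D)
    (hc : ∀ ξ ∈ S, ∀ x ∈ D, (rightCreation ξ + star (rightCreation ξ)) x ∈ D) : D = ⊤ := by
  -- This records that an elementary tensor depends linearly and continuously on its last letter.
  have happ : ∀ (b : List H), ∃ Q : Fock H →L[ℂ] Fock H,
      ∀ k, fockVec (b ++ [k]) = Q (creation k (vacuum H)) := by
    intro b
    induction b with
    | nil => exact ⟨1, fun k => rfl⟩
    | cons h b ih =>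
      obtain ⟨Q, hQ⟩ := ih
      exact ⟨creation h * Q, fun k => by rw [List.cons_append, fockVec_cons, hQ]; rfl⟩
  refine eq_top_of_fockVec_mem D hD fun a => ?_
  induction hn : a.length using Nat.strong_induction_on generalizing a with
  | _ n ih =>
    subst hn
    rcases List.eq_nil_or_concat a with rfl | ⟨b, h, rfl⟩
    · exact h1
    · rw [List.concat_eq_append] at ih ⊢
      obtain ⟨Q, hQ⟩ := happ b
      let L : H →L[ℂ] Fock H :=
        Q.comp ((ContinuousLinearMap.apply ℂ (Fock H) (vacuum H)).comp (creationL H))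
      have hL : ∀ k, L k = fockVec (b ++ [k]) := fun k => (hQ k).symm
      have htop : (D.comap L.toLinearMap) = ⊤ := by
        refine top_le_iff.1 (hS.symm.trans_le (Submodule.topologicalClosure_minimal _
          (Submodule.span_le.2 fun ξ hξ => ?_) (hD.preimage L.continuous)))
        change L ξ ∈ D
        have e : L ξ = (rightCreation ξ + star (rightCreation ξ)) (fockVec b) -
            star (rightCreation ξ) (fockVec b) := by
          rw [hL, add_apply, rightCreation_fockVec, add_sub_cancel_right]
        rw [e]
        refine D.sub_mem (hc ξ hξ _ (ih _ (by simp) b rfl)) ?_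
        rcases List.eq_nil_or_concat b with rfl | ⟨b', k, rfl⟩
        · simp [star_rightCreation_vacuum]
        · rw [List.concat_eq_append, star_rightCreation_fockVec]
          exact D.smul_mem _ (ih _ (by simp) b' rfl)
      have : h ∈ D.comap L.toLinearMap := htop ▸ Submodule.mem_top
      have h2 : L h ∈ D := this
      rwa [hL] at h2

end Cyclicity

/-! ### Normal ordering and Wick words -/

section Wick

variable {H : Type u} [NormedAddCommGroup H] [InnerProductSpace ℂ H] [CompleteSpace H]

/-- The generated *-algebra is the linear span of the monoid generated by `S ∪ star S`, so stability
under left multiplication by generators suffices. -/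
theorem adjoin_le_of_mul_mem {A : Type*} [Ring A] [StarRing A] [Algebra ℂ A] [StarModule ℂ A]
    {S : Set A} (N : Submodule ℂ A) (h1 : 1 ∈ N)
    (hN : ∀ s ∈ S, ∀ x ∈ N, s * x ∈ N ∧ star s * x ∈ N) {x : A}
    (hx : x ∈ StarAlgebra.adjoin ℂ S) : x ∈ N := by
  have hx' : x ∈ Subalgebra.toSubmodule (Algebra.adjoin ℂ (S ∪ star S)) := hx
  rw [Algebra.adjoin_eq_span] at hx'
  refine Submodule.span_le.2 (fun y hy => ?_) hx'
  induction hy using Submonoid.closure_induction_left with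
  | one => exact h1
  | mul_left s hs y _ ih =>
    rcases hs with hs | hs
    · exact (hN s hs y ih).1
    · simpa using (hN (star s) hs y ih).2

theorem creationWord_cons_left (h : H) (a b : List H) :
    creationWord (h :: a) b = creation h * creationWord a b := by
  simp [creationWord, mul_assoc]

theorem creationWord_nil_cons (h : H) (b : List H) :
    creationWord [] (h :: b) = star (creation h) * creationWord [] b := by
  simp [creationWord]

theorem creationWord_nil_nil : creationWord ([] : List H) [] = 1 := by
  simp [creationWord]

theorem creationWord_append_right (a b : List H) (h : H) :
    creationWord a (b ++ [h]) = creationWord a b * star (creation h) := by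
  simp [creationWord, mul_assoc]

/-- The `*`-algebra generated by the creation operators is spanned by the words in normal order. -/
theorem adjoin_creation_le_span {x : Fock H →L[ℂ] Fock H}
    (hx : x ∈ StarAlgebra.adjoin ℂ (Set.range (creation (H := H)))) :
    x ∈ Submodule.span ℂ (Set.range fun p : List H × List H => creationWord p.1 p.2) := by
  set N := Submodule.span ℂ (Set.range fun p : List H × List H => creationWord p.1 p.2) with hN
  have hword : ∀ a b : List H, creationWord a b ∈ N :=
    fun a b => Submodule.subset_span ⟨(a, b), rfl⟩
  refine adjoin_le_of_mul_mem N (creationWord_nil_nil (H := H) ▸ hword [] []) ?_ hx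
  rintro _ ⟨h, rfl⟩ y hy
  induction hy using Submodule.span_induction with
  | mem y hy =>
    obtain ⟨⟨a, b⟩, rfl⟩ := hy
    refine ⟨creationWord_cons_left h a b ▸ hword _ _, ?_⟩
    cases a with
    | nil => exact creationWord_nil_cons h b ▸ hword _ _
    | cons k a =>
      change star (creation h) * creationWord (k :: a) b ∈ N
      rw [creationWord_cons_left, ← mul_assoc, star_creation_mul_creation, smul_one_mul]
      exact N.smul_mem _ (hword a b)
  | zero => simp
  | add y z _ _ h1 h2 =>
    rw [mul_add, mul_add]
    exact ⟨N.add_mem h1.1 h2.1, N.add_mem h1.2 h2.2⟩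
  | smul c y _ h1 =>
    rw [mul_smul_comm, mul_smul_comm]
    exact ⟨N.smul_mem _ h1.1, N.smul_mem _ h1.2⟩

/-- The Wick word `∑ₖ ℓ(ξ₁) ⋯ ℓ(ξₖ) ℓ(ξₖ₊₁)^* ⋯ ℓ(ξₙ)^*`. -/
noncomputable def wick : List H → (Fock H →L[ℂ] Fock H)
  | [] => 1
  | ξ :: a => creation ξ * wick a + creationWord [] (ξ :: a)

/-- The only contraction is ℓ(ξ)^*ℓ(η) = ⟨ξ, η⟩. This three-term recursion identifies the *-algebra
generated by the semicircular operators with the span of Wick words. -/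
theorem semicircular_mul_wick_cons (ξ η : H) (a : List H) :
    semicircular ξ * wick (η :: a) =
      (2⁻¹ : ℂ) • (wick (ξ :: η :: a) + ⟪ξ, η⟫_ℂ • wick a) := by
  have h : (creation ξ + star (creation ξ)) * wick (η :: a) =
      wick (ξ :: η :: a) + ⟪ξ, η⟫_ℂ • wick a := by
    rw [wick, wick, wick, creationWord_nil_cons ξ, add_mul, mul_add (star (creation ξ)),
      ← mul_assoc (star (creation ξ)), star_creation_mul_creation, smul_one_mul]
    abel
  rw [semicircular, smul_mul_assoc, h]

theorem semicircular_mul_wick_nil (ξ : H) :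
    semicircular ξ * wick [] = (2⁻¹ : ℂ) • wick [ξ] := by
  simp [semicircular, wick, creationWord_nil_cons, creationWord_nil_nil]

theorem star_semicircular (ξ : H) : star (semicircular ξ) = semicircular ξ := by
  rw [semicircular]
  refine (star_smul (A := Fock H →L[ℂ] Fock H) _ _).trans (congrArg₂ _ (by simp) ?_)
  refine (star_add (R := Fock H →L[ℂ] Fock H) _ _).trans ?_
  rw [star_star, add_comm]

/-- The recursion is solved for its longest Wick word; it involves words one and two letters
shorter, whence the strong induction. -/
theorem wick_mem_adjoin {S : Set H} (a : List H) (ha : ∀ ξ ∈ a, ξ ∈ S) :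
    wick a ∈ StarAlgebra.adjoin ℂ (semicircular '' S) := by
  induction hn : a.length using Nat.strong_induction_on generalizing a with
  | _ n ih =>
    subst hn
    cases a with
    | nil => exact one_mem _
    | cons ξ a =>
      have hξ := StarAlgebra.subset_adjoin ℂ _ (Set.mem_image_of_mem semicircular (ha ξ (by simp)))
      have h2 : (2 : ℂ) • (semicircular ξ * wick a) ∈ StarAlgebra.adjoin ℂ (semicircular '' S) :=
        SMulMemClass.smul_mem _ (mul_mem hξ
          (ih _ (by simp) a (fun η hη => ha η (List.mem_cons_of_mem _ hη)) rfl))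
      cases a with
      | nil =>
        rw [semicircular_mul_wick_nil, smul_smul] at h2
        simpa using h2
      | cons η a =>
        rw [semicircular_mul_wick_cons, smul_smul] at h2
        have h3 : wick a ∈ StarAlgebra.adjoin ℂ (semicircular '' S) :=
          ih _ (by simp) a (fun ζ hζ => ha ζ (by simp [hζ])) rfl
        have h4 := sub_mem h2 (SMulMemClass.smul_mem ⟪ξ, η⟫_ℂ h3)
        simpa using h4

theorem adjoin_semicircular_le_span {S : Set H} {x : Fock H →L[ℂ] Fock H}
    (hx : x ∈ StarAlgebra.adjoin ℂ (semicircular '' S)) :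
    x ∈ Submodule.span ℂ (wick '' {a : List H | ∀ ξ ∈ a, ξ ∈ S}) := by
  set N := Submodule.span ℂ (wick '' {a : List H | ∀ ξ ∈ a, ξ ∈ S}) with hN
  have hword : ∀ a : List H, (∀ ξ ∈ a, ξ ∈ S) → wick a ∈ N :=
    fun a ha => Submodule.subset_span ⟨a, ha, rfl⟩
  refine adjoin_le_of_mul_mem N (hword [] (by simp)) ?_ hx
  rintro _ ⟨ξ, hξ, rfl⟩ y hy
  rw [star_semicircular, and_self]
  induction hy using Submodule.span_induction with
  | mem y hy =>
    obtain ⟨a, ha, rfl⟩ := hy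
    cases a with
    | nil =>
      rw [semicircular_mul_wick_nil]
      exact N.smul_mem _ (hword _ (by simpa using hξ))
    | cons η a =>
      rw [semicircular_mul_wick_cons]
      refine N.smul_mem _ (N.add_mem (hword _ ?_) (N.smul_mem _ (hword _ ?_)))
      · intro ζ hζ
        rcases List.mem_cons.1 hζ with rfl | hζ
        · exact hξ
        · exact ha ζ hζ
      · exact fun ζ hζ => ha ζ (List.mem_cons_of_mem _ hζ)
  | zero => simp
  | add y z _ _ h1 h2 => rw [mul_add]; exact N.add_mem h1 h2
  | smul c y _ h1 => rw [mul_smul_comm]; exact N.smul_mem _ h1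

end Wick

/-! ## Second quantization of finite rank strict contractions -/

section DilateAlgebra

variable {K : Type u} [NormedAddCommGroup K] [InnerProductSpace ℂ K] [CompleteSpace K]
variable {κ : Type v}

theorem dilate_add_left (V V' W : K →L[ℂ] lp (fun _ : κ => K) 2) :
    dilate (V + V') W = dilate V W + dilate V' W := by
  ext x ξ
  simp [dilate_apply]

theorem dilate_add_right (V W W' : K →L[ℂ] lp (fun _ : κ => K) 2) :
    dilate V (W + W') = dilate V W + dilate V W' := by
  ext x ξ
  simp [dilate_apply]

theorem dilate_zero_left (W : K →L[ℂ] lp (fun _ : κ => K) 2) : dilate 0 W = 0 := by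
  ext x ξ
  simp [dilate_apply]

theorem dilate_zero_right (V : K →L[ℂ] lp (fun _ : κ => K) 2) : dilate V 0 = 0 := by
  ext x ξ
  simp [dilate_apply]

theorem dilate_sub_right (V W W' : K →L[ℂ] lp (fun _ : κ => K) 2) :
    dilate V (W - W') = dilate V W - dilate V W' := by
  rw [eq_sub_iff_add_eq, ← dilate_add_right, sub_add_cancel]

theorem hasSum_dilate_right (V : K →L[ℂ] lp (fun _ : κ => K) 2)
    {f : ℕ → (K →L[ℂ] lp (fun _ : κ => K) 2)} {W : K →L[ℂ] lp (fun _ : κ => K) 2}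
    (h : HasSum f W) : HasSum (fun n => dilate V (f n)) (dilate V W) := by
  let g : (K →L[ℂ] lp (fun _ : κ => K) 2) →+ ((K →L[ℂ] K) →L[ℂ] (K →L[ℂ] K)) :=
    { toFun := dilate V, map_zero' := dilate_zero_right V, map_add' := dilate_add_right V }
  exact h.map g (AddMonoidHomClass.continuous_of_bound g ‖V‖ fun W => norm_dilate_le V W)

theorem hasSum_dilate_left (W : K →L[ℂ] lp (fun _ : κ => K) 2)
    {f : ℕ → (K →L[ℂ] lp (fun _ : κ => K) 2)} {V : K →L[ℂ] lp (fun _ : κ => K) 2}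
    (h : HasSum f V) : HasSum (fun n => dilate (f n) W) (dilate V W) := by
  let g : (K →L[ℂ] lp (fun _ : κ => K) 2) →+ ((K →L[ℂ] K) →L[ℂ] (K →L[ℂ] K)) :=
    { toFun := fun V => dilate V W
      map_zero' := dilate_zero_left W
      map_add' := fun V V' => dilate_add_left V V' W }
  exact h.map g (AddMonoidHomClass.continuous_of_bound g ‖W‖ fun V =>
    (norm_dilate_le V W).trans_eq (mul_comm _ _))

/-- The Cauchy product of two series of operators under `dilate`. -/
theorem hasSum_dilate_antidiagonal {f g : ℕ → (K →L[ℂ] lp (fun _ : κ => K) 2)}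
    {V W : K →L[ℂ] lp (fun _ : κ => K) 2} (hf : Summable fun n => ‖f n‖)
    (hg : Summable fun n => ‖g n‖) (hV : HasSum f V) (hW : HasSum g W) :
    HasSum (fun n => ∑ q ∈ Finset.HasAntidiagonal.antidiagonal n, dilate (f q.1) (g q.2)) (dilate V W) := by
  have hs : Summable fun q : ℕ × ℕ => dilate (f q.1) (g q.2) :=
    Summable.of_norm_bounded (hf.mul_of_nonneg hg (fun n => norm_nonneg (f n)) (fun n => norm_nonneg (g n)))
      fun q => norm_dilate_le _ _
  have hsum : HasSum (fun q : ℕ × ℕ => dilate (f q.1) (g q.2)) (dilate V W) := by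
    have h1 := hs.hasSum.prod_fiberwise fun n => hasSum_dilate_right (f n) hW
    rw [← h1.unique (hasSum_dilate_left W hV)]
    exact hs.hasSum
  refine ((Finset.HasAntidiagonal.sigmaAntidiagonalEquivProd (A := ℕ)).hasSum_iff.2 hsum).sigma fun n => ?_
  have := hasSum_fintype fun q : Finset.HasAntidiagonal.antidiagonal n => dilate (f q.1.1) (g q.1.2)
  rw [Finset.sum_coe_sort (Finset.HasAntidiagonal.antidiagonal n) fun q : ℕ × ℕ => dilate (f q.1) (g q.2)] at this
  exact this

theorem star_dilate (V W : K →L[ℂ] lp (fun _ : κ => K) 2) (x : K →L[ℂ] K) :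
    star (dilate V W x) = dilate W V (star x) := by
  rw [ContinuousLinearMap.star_eq_adjoint, eq_comm, ContinuousLinearMap.eq_adjoint_iff]
  intro ξ η
  rw [inner_dilate, ← inner_conj_symm, inner_dilate, map_star, ContinuousLinearMap.star_eq_adjoint,
    ContinuousLinearMap.adjoint_inner_right, inner_conj_symm]

theorem dilate_comp_right (V W : K →L[ℂ] lp (fun _ : κ => K) 2) (y x : K →L[ℂ] K) :
    dilate V (W.comp y) x = dilate V W x * y := rfl

theorem dilate_comp_left (V W : K →L[ℂ] lp (fun _ : κ => K) 2) (y x : K →L[ℂ] K) :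
    dilate (V.comp y) W x = star y * dilate V W x := by
  ext ξ
  refine ext_inner_left ℂ fun η => ?_
  rw [inner_dilate, mul_apply_eq_comp, ContinuousLinearMap.star_eq_adjoint,
    ContinuousLinearMap.adjoint_inner_right, inner_dilate]
  rfl

theorem dilate_amplification_right (V W : K →L[ℂ] lp (fun _ : κ => K) 2) (y x : K →L[ℂ] K) :
    dilate V ((amplification K κ y).comp W) x = dilate V W (x * y) := by
  rw [dilate_apply, dilate_apply, map_mul]
  rfl

theorem dilate_amplification_left (V W : K →L[ℂ] lp (fun _ : κ => K) 2) (y x : K →L[ℂ] K) :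
    dilate ((amplification K κ y).comp V) W x = dilate V W (star y * x) := by
  rw [← star_star (dilate _ W x), star_dilate, dilate_amplification_right, star_dilate]
  simp

theorem dilate_sum_right {n : ℕ} (V : K →L[ℂ] lp (fun _ : κ => K) 2)
    (W : Fin n → (K →L[ℂ] lp (fun _ : κ => K) 2)) (x : K →L[ℂ] K) :
    dilate V (∑ a, W a) x = ∑ a, dilate V (W a) x := by
  ext ξ
  simp [dilate_apply, sum_apply, map_sum]

theorem dilate_sum_left {n : ℕ} (V : Fin n → (K →L[ℂ] lp (fun _ : κ => K) 2))
    (W : K →L[ℂ] lp (fun _ : κ => K) 2) (x : K →L[ℂ] K) :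
    dilate (∑ a, V a) W x = ∑ a, dilate (V a) W x := by
  rw [← star_star (dilate _ W x), star_dilate, dilate_sum_right, star_sum]
  simp [star_dilate]

theorem continuous_sigmaWeak_add {Φ Ψ : (K →L[ℂ] K) → (K →L[ℂ] K)}
    (hΦ : @Continuous _ _ (sigmaWeak K) (sigmaWeak K) Φ)
    (hΨ : @Continuous _ _ (sigmaWeak K) (sigmaWeak K) Ψ) :
    @Continuous _ _ (sigmaWeak K) (sigmaWeak K) (fun x => Φ x + Ψ x) := by
  let _ := sigmaWeak K
  refine continuous_sigmaWeak_rng fun p => ?_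
  simp only [map_add, add_apply, inner_add_right]
  exact ((continuous_inner_amplification p.left p.right).comp hΦ).add
    ((continuous_inner_amplification p.left p.right).comp hΨ)

theorem continuous_sigmaWeak_neg {Φ : (K →L[ℂ] K) → (K →L[ℂ] K)}
    (hΦ : @Continuous _ _ (sigmaWeak K) (sigmaWeak K) Φ) :
    @Continuous _ _ (sigmaWeak K) (sigmaWeak K) (fun x => - Φ x) := by
  let _ := sigmaWeak K
  refine continuous_sigmaWeak_rng fun p => ?_
  simp only [map_neg, neg_apply, inner_neg_right]
  exact ((continuous_inner_amplification p.left p.right).comp hΦ).neg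

theorem continuous_sigmaWeak_sum {ι : Type*} (s : Finset ι)
    {Φ : ι → ((K →L[ℂ] K) →L[ℂ] (K →L[ℂ] K))}
    (hΦ : ∀ i, @Continuous _ _ (sigmaWeak K) (sigmaWeak K) (Φ i)) :
    @Continuous _ _ (sigmaWeak K) (sigmaWeak K) (fun x => ∑ i ∈ s, Φ i x) := by
  classical
  induction s using Finset.induction_on with
  | empty =>
    let _ := sigmaWeak K
    simpa using continuous_const
  | insert i s his ih =>
    simp only [Finset.sum_insert his]
    exact continuous_sigmaWeak_add (hΦ i) ih

end DilateAlgebra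

/-! ### Bases adapted to the range of a finite rank operator -/

section RangeBasis

variable {H : Type u} [NormedAddCommGroup H] [InnerProductSpace ℂ H] [CompleteSpace H]

/-- An orthonormal basis of the range of `T` which diagonalizes `T T^*`. -/
structure IsRangeBasis (T : H →L[ℂ] H) {n : ℕ} (e : Fin n → H) : Prop where
  orthonormal : Orthonormal ℂ e
  expand : ∀ h, ∑ a, ⟪e a, T h⟫_ℂ • e a = T h
  diag : ∀ a b, a ≠ b → ⟪star T (e a), star T (e b)⟫_ℂ = 0

/-- The finite-dimensional spectral theorem is applied to TT^* on the range of T: for eigenvectors,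
⟨T^*e_a, T^*e_b⟩ = ⟨e_a, TT^*e_b⟩ vanishes when a ≠ b. -/
theorem exists_isRangeBasis (T : H →L[ℂ] H) [FiniteDimensional ℂ T.range] :
    ∃ (n : ℕ) (e : Fin n → H), IsRangeBasis T e := by
  let S : T.range →ₗ[ℂ] T.range :=
    ((T * star T).toLinearMap.comp T.range.subtype).codRestrict T.range
      fun x => ⟨star T x, rfl⟩
  have hS : S.IsSymmetric := by
    intro x y
    change ⟪T (star T x), (y : H)⟫_ℂ = ⟪(x : H), T (star T y)⟫_ℂ
    rw [ContinuousLinearMap.star_eq_adjoint, ← ContinuousLinearMap.adjoint_inner_right,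
      ContinuousLinearMap.adjoint_inner_left]
  let b := hS.eigenvectorBasis rfl
  refine ⟨_, fun a => (b a : H), ?_, ?_, ?_⟩
  · exact b.orthonormal.comp_linearIsometry T.range.subtypeₗᵢ
  · intro h
    have h1 := congrArg (Subtype.val) (b.sum_repr' ⟨T h, h, rfl⟩)
    simpa using h1
  · intro a c hac
    have h1 : T (star T (b c)) = ((hS.eigenvalues rfl c : ℂ) • (b c : H)) :=
      congrArg Subtype.val (hS.apply_eigenvectorBasis rfl c)
    rw [ContinuousLinearMap.star_eq_adjoint, ContinuousLinearMap.adjoint_inner_left,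
      ← ContinuousLinearMap.star_eq_adjoint, h1, inner_smul_right]
    have h2 : ⟪(b a : H), (b c : H)⟫_ℂ = 0 := b.orthonormal.2 hac
    rw [h2, mul_zero]

end RangeBasis

theorem inner_self_eq_ofReal_norm_sq {E : Type*} [NormedAddCommGroup E] [InnerProductSpace ℂ E]
    (x : E) : ⟪x, x⟫_ℂ = ((‖x‖ ^ 2 : ℝ) : ℂ) := by
  rw [inner_self_eq_norm_sq_to_K]
  simp

/-! ### The pieces of the Kraus operator -/

section Kraus

variable {H : Type u} [NormedAddCommGroup H] [InnerProductSpace ℂ H] [CompleteSpace H]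
variable {K : Type u} [NormedAddCommGroup K] [InnerProductSpace ℂ K] [CompleteSpace K]
variable {κ : Type u}

/-- Operators `ℓ(h)` with the relations of the left creation operators, and a vacuum vector. -/
structure IsToeplitzFamily (ℓ : H →L[ℂ] (K →L[ℂ] K)) (Ω : K) : Prop where
  star_mul : ∀ a b, star (ℓ a) * ℓ b = ⟪a, b⟫_ℂ • (1 : K →L[ℂ] K)
  star_vacuum : ∀ a, star (ℓ a) Ω = 0
  inner_vacuum : ⟪Ω, Ω⟫_ℂ = 1

/-- The map `ζ ↦ Ω ⊗ ζ`, in the coordinates given by a Hilbert basis. -/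
noncomputable def vacuumTensor (b : HilbertBasis κ ℂ K) (Ω : K) : K →L[ℂ] lp (fun _ : κ => K) 2 :=
  LinearMap.mkContinuous
    { toFun := fun ζ => ⟨fun i => ⟪b i, ζ⟫_ℂ • Ω, memℓp_two_of_summable (by
        have h := (summable_norm_sq_lp (b.repr ζ)).mul_right (‖Ω‖ ^ 2)
        simpa [norm_smul, mul_pow, b.repr_apply_apply] using h)⟩
      map_add' := fun ζ ζ' => by
        ext i
        change ⟪b i, ζ + ζ'⟫_ℂ • Ω = ⟪b i, ζ⟫_ℂ • Ω + ⟪b i, ζ'⟫_ℂ • Ω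
        rw [inner_add_right, add_smul]
      map_smul' := fun c ζ => by
        ext i
        change ⟪b i, c • ζ⟫_ℂ • Ω = c • ⟪b i, ζ⟫_ℂ • Ω
        rw [inner_smul_right, mul_smul] }
    ‖Ω‖ fun ζ => by
      refine le_of_eq ((sq_eq_sq₀ (norm_nonneg _) (by positivity)).1 ?_)
      rw [mul_pow, norm_sq_lp, ← b.repr.norm_map ζ, norm_sq_lp, ← tsum_mul_left]
      refine tsum_congr fun i => ?_
      simp [norm_smul, mul_pow, b.repr_apply_apply, mul_comm]

theorem vacuumTensor_apply (b : HilbertBasis κ ℂ K) (Ω ζ : K) (i : κ) :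
    vacuumTensor b Ω ζ i = ⟪b i, ζ⟫_ℂ • Ω := rfl

theorem inner_vacuumTensor (b : HilbertBasis κ ℂ K) (Ω ζ ζ' : K) (x : K →L[ℂ] K) :
    ⟪vacuumTensor b Ω ζ', amplification K κ x (vacuumTensor b Ω ζ)⟫_ℂ =
      ⟪Ω, x Ω⟫_ℂ * ⟪ζ', ζ⟫_ℂ := by
  rw [lp.inner_eq_tsum, ← b.tsum_inner_mul_inner ζ' ζ, ← tsum_mul_left]
  refine tsum_congr fun i => ?_
  rw [amplification_apply, vacuumTensor_apply, vacuumTensor_apply, map_smul, inner_smul_left,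
    inner_smul_right, inner_conj_symm]
  ring

/-- Compressing x ⊗ 1 to Ω ⊗ K leaves the scalar vacuum expectation of x. This is the source of all
the finite rank statements. -/
theorem dilate_vacuumTensor (b : HilbertBasis κ ℂ K) (Ω : K) (x : K →L[ℂ] K) :
    dilate (vacuumTensor b Ω) (vacuumTensor b Ω) x = ⟪Ω, x Ω⟫_ℂ • (1 : K →L[ℂ] K) := by
  ext ζ
  refine ext_inner_left ℂ fun ζ' => ?_
  rw [inner_dilate, inner_vacuumTensor]
  simp [inner_smul_right]

variable {ℓ : H →L[ℂ] (K →L[ℂ] K)} {Ω : K}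

namespace IsToeplitzFamily

theorem inner_amplification (hℓ : IsToeplitzFamily ℓ Ω) (a b : H) (f g : lp (fun _ : κ => K) 2) :
    ⟪amplification K κ (ℓ a) f, amplification K κ (ℓ b) g⟫_ℂ = ⟪a, b⟫_ℂ * ⟪f, g⟫_ℂ := by
  rw [← ContinuousLinearMap.adjoint_inner_right, ← ContinuousLinearMap.star_eq_adjoint, ← map_star,
    ← mul_apply_eq_comp, ← map_mul, hℓ.star_mul, map_smul, map_one, smul_apply, one_apply_eq_self,
    inner_smul_right]

theorem inner_apply (hℓ : IsToeplitzFamily ℓ Ω) (a b : H) (f g : K) :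
    ⟪ℓ a f, ℓ b g⟫_ℂ = ⟪a, b⟫_ℂ * ⟪f, g⟫_ℂ := by
  rw [← ContinuousLinearMap.adjoint_inner_right, ← ContinuousLinearMap.star_eq_adjoint,
    ← mul_apply_eq_comp, hℓ.star_mul, smul_apply, one_apply_eq_self, inner_smul_right]

/-- Bessel's inequality: the ℓ(e_a) are isometries with orthogonal ranges, and `z` is the projection
of ζ on the sum of these ranges. -/
theorem sum_norm_sq_star_le (hℓ : IsToeplitzFamily ℓ Ω) {n : ℕ} {e : Fin n → H}
    (he : Orthonormal ℂ e) (ζ : K) : ∑ a, ‖star (ℓ (e a)) ζ‖ ^ 2 ≤ ‖ζ‖ ^ 2 := by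
  set z : K := ∑ a, ℓ (e a) (star (ℓ (e a)) ζ) with hz
  have h1 : ⟪z, ζ⟫_ℂ = ((∑ a, ‖star (ℓ (e a)) ζ‖ ^ 2 : ℝ) : ℂ) := by
    rw [hz, sum_inner]
    push_cast
    refine Finset.sum_congr rfl fun a _ => ?_
    rw [← ContinuousLinearMap.adjoint_inner_right, ← ContinuousLinearMap.star_eq_adjoint,
      inner_self_eq_norm_sq_to_K]
    rfl
  have h2 : ⟪z, z⟫_ℂ = ((∑ a, ‖star (ℓ (e a)) ζ‖ ^ 2 : ℝ) : ℂ) := by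
    rw [hz, sum_inner]
    push_cast
    refine Finset.sum_congr rfl fun a _ => ?_
    rw [inner_sum, Finset.sum_eq_single a]
    · rw [hℓ.inner_apply, inner_self_eq_norm_sq_to_K, inner_self_eq_norm_sq_to_K, he.1 a]
      simp
    · intro b _ hb
      rw [hℓ.inner_apply, he.2 hb.symm, zero_mul]
    · simp
  have h3 : ‖z‖ ^ 2 = ∑ a, ‖star (ℓ (e a)) ζ‖ ^ 2 := by
    rw [inner_self_eq_ofReal_norm_sq] at h2
    exact Complex.ofReal_injective h2
  have h4 : ‖z‖ ^ 2 ≤ ‖z‖ * ‖ζ‖ := by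
    have := norm_inner_le_norm (𝕜 := ℂ) z ζ
    rw [h1, Complex.norm_real, ← h3, Real.norm_of_nonneg (by positivity)] at this
    exact this
  rw [← h3]
  have h5 : ‖z‖ ≤ ‖ζ‖ := by
    by_contra hlt
    push Not at hlt
    nlinarith [norm_nonneg ζ, norm_nonneg z]
  gcongr

end IsToeplitzFamily

/-- The pieces of the Kraus operator of a second quantization. -/
noncomputable def krausPiece (ℓ : H →L[ℂ] (K →L[ℂ] K)) (Ω : K) (b : HilbertBasis κ ℂ K)
    (T : H →L[ℂ] H) {n : ℕ} (e : Fin n → H) (Y : K →L[ℂ] K) :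
    ℕ → (K →L[ℂ] lp (fun _ : κ => K) 2)
  | 0 => (vacuumTensor b Ω).comp Y
  | j + 1 => ∑ a, (amplification K κ (ℓ (star T (e a)))).comp
      ((krausPiece ℓ Ω b T e Y j).comp (star (ℓ (e a))))

variable {b : HilbertBasis κ ℂ K} {T : H →L[ℂ] H} {n : ℕ} {e : Fin n → H}

/-- Since the vectors T^*e_a are orthogonal, the summands of a piece are orthogonal, with norms
‖T^*e_a‖ ‖E_j ℓ(e_a)^*ζ‖. Bessel's inequality then costs only a factor ‖T‖ per degree, with no
dependence on the rank. -/
theorem norm_krausPiece_apply_le (hℓ : IsToeplitzFamily ℓ Ω) (he : IsRangeBasis T e)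
    (Y : K →L[ℂ] K) (j : ℕ) (ζ : K) :
    ‖krausPiece ℓ Ω b T e Y j ζ‖ ≤ ‖T‖ ^ j * ‖Y‖ * ‖ζ‖ := by
  induction j generalizing ζ with
  | zero =>
    have hΩ : ‖Ω‖ = 1 := by
      have h := hℓ.inner_vacuum
      rw [inner_self_eq_ofReal_norm_sq] at h
      have h' : ‖Ω‖ ^ 2 = 1 := by exact_mod_cast h
      nlinarith [norm_nonneg Ω]
    have h1 : ‖vacuumTensor b Ω‖ ≤ 1 :=
      hΩ ▸ LinearMap.mkContinuous_norm_le _ (norm_nonneg _) _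
    rw [pow_zero, one_mul]
    calc ‖vacuumTensor b Ω (Y ζ)‖ ≤ 1 * ‖Y ζ‖ := ContinuousLinearMap.le_of_opNorm_le _ h1 _
      _ ≤ ‖Y‖ * ‖ζ‖ := by rw [one_mul]; exact Y.le_opNorm ζ
  | succ j ih =>
    refine le_of_sq_le_sq ?_ (by positivity)
    set g : Fin n → lp (fun _ : κ => K) 2 := fun a => krausPiece ℓ Ω b T e Y j (star (ℓ (e a)) ζ)
    have h1 : krausPiece ℓ Ω b T e Y (j + 1) ζ =
        ∑ a, amplification K κ (ℓ (star T (e a))) (g a) := by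
      simp [krausPiece, sum_apply, g]
    have h2 : ‖krausPiece ℓ Ω b T e Y (j + 1) ζ‖ ^ 2 = ∑ a, ‖star T (e a)‖ ^ 2 * ‖g a‖ ^ 2 := by
      have h3 : ⟪krausPiece ℓ Ω b T e Y (j + 1) ζ, krausPiece ℓ Ω b T e Y (j + 1) ζ⟫_ℂ =
          ((∑ a, ‖star T (e a)‖ ^ 2 * ‖g a‖ ^ 2 : ℝ) : ℂ) := by
        rw [h1, sum_inner]
        push_cast
        refine Finset.sum_congr rfl fun a _ => ?_
        rw [inner_sum, Finset.sum_eq_single a]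
        · rw [hℓ.inner_amplification, inner_self_eq_norm_sq_to_K, inner_self_eq_norm_sq_to_K]
          rfl
        · intro c _ hc
          rw [hℓ.inner_amplification, he.diag a c hc.symm, zero_mul]
        · simp
      rw [inner_self_eq_ofReal_norm_sq] at h3
      exact Complex.ofReal_injective h3
    rw [h2]
    have hT : ∀ a, ‖star T (e a)‖ ≤ ‖T‖ := fun a => by
      have := (star T).le_opNorm (e a)
      rwa [he.orthonormal.1 a, mul_one, norm_star] at this
    calc ∑ a, ‖star T (e a)‖ ^ 2 * ‖g a‖ ^ 2
        ≤ ∑ a, ‖T‖ ^ 2 * (‖T‖ ^ j * ‖Y‖ * ‖star (ℓ (e a)) ζ‖) ^ 2 := by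
          gcongr with a
          · exact hT a
          · exact ih _
      _ = (‖T‖ * (‖T‖ ^ j * ‖Y‖)) ^ 2 * ∑ a, ‖star (ℓ (e a)) ζ‖ ^ 2 := by
          rw [Finset.mul_sum]
          exact Finset.sum_congr rfl fun a _ => by ring
      _ ≤ (‖T‖ * (‖T‖ ^ j * ‖Y‖)) ^ 2 * ‖ζ‖ ^ 2 := by
          gcongr
          exact hℓ.sum_norm_sq_star_le he.orthonormal ζ
      _ = _ := by ring

theorem norm_krausPiece_le (hℓ : IsToeplitzFamily ℓ Ω) (he : IsRangeBasis T e)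
    (Y : K →L[ℂ] K) (j : ℕ) : ‖krausPiece ℓ Ω b T e Y j‖ ≤ ‖T‖ ^ j * ‖Y‖ :=
  ContinuousLinearMap.opNorm_le_bound _ (by positivity) (norm_krausPiece_apply_le hℓ he Y j)

theorem summable_norm_krausPiece (hℓ : IsToeplitzFamily ℓ Ω) (he : IsRangeBasis T e)
    (hT : ‖T‖ < 1) (Y : K →L[ℂ] K) : Summable fun j => ‖krausPiece ℓ Ω b T e Y j‖ :=
  Summable.of_nonneg_of_le (fun j => norm_nonneg (krausPiece ℓ Ω b T e Y j))
    (norm_krausPiece_le hℓ he Y)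
    ((summable_geometric_of_lt_one (norm_nonneg _) hT).mul_right _)

theorem amplification_star_comp_krausPiece_zero (hℓ : IsToeplitzFamily ℓ Ω) (h : H)
    (Y : K →L[ℂ] K) :
    (amplification K κ (star (ℓ h))).comp (krausPiece ℓ Ω b T e Y 0) = 0 := by
  ext ζ i
  change star (ℓ h) (⟪b i, Y ζ⟫_ℂ • Ω) = 0
  rw [map_smul, hℓ.star_vacuum, smul_zero]

/-- The contraction ℓ(h)^*ℓ(T^*e_a) is the scalar ⟨Th, e_a⟩, and summing ⟨e_a, Th⟩e_a rebuilds Th.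
Summed over the degree, this becomes the intertwining relation of W. -/
theorem amplification_star_comp_krausPiece_succ (hℓ : IsToeplitzFamily ℓ Ω)
    (he : IsRangeBasis T e) (h : H) (Y : K →L[ℂ] K) (j : ℕ) :
    (amplification K κ (star (ℓ h))).comp (krausPiece ℓ Ω b T e Y (j + 1)) =
      (krausPiece ℓ Ω b T e Y j).comp (star (ℓ (T h))) := by
  ext1 ζ
  have h1 : ∀ a, amplification K κ (star (ℓ h)) (amplification K κ (ℓ (star T (e a)))
      (krausPiece ℓ Ω b T e Y j (star (ℓ (e a)) ζ))) =
      krausPiece ℓ Ω b T e Y j (star (ℓ (⟪e a, T h⟫_ℂ • e a)) ζ) := by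
    intro a
    rw [← mul_apply_eq_comp, ← map_mul, hℓ.star_mul, map_smul (amplification K κ), map_one,
      smul_apply, one_apply_eq_self, map_smul ℓ, star_smul, smul_apply, map_smul, RCLike.star_def,
      inner_conj_symm, ContinuousLinearMap.star_eq_adjoint T,
      ContinuousLinearMap.adjoint_inner_right]
  have h2 : star (ℓ (T h)) ζ = ∑ a, star (ℓ (⟪e a, T h⟫_ℂ • e a)) ζ := by
    conv_lhs => rw [← he.expand h, map_sum, star_sum, sum_apply]
  simp only [krausPiece, ContinuousLinearMap.comp_apply, sum_apply, map_sum, h1]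
  rw [← map_sum, h2]

/-- The completely positive map `y ↦ ∑ₐ ‖T^* eₐ‖² ℓ(eₐ) y ℓ(eₐ)^*`. -/
noncomputable def shiftMap (ℓ : H →L[ℂ] (K →L[ℂ] K)) (T : H →L[ℂ] H) {n : ℕ} (e : Fin n → H)
    (y : K →L[ℂ] K) : K →L[ℂ] K :=
  ∑ a, ((‖star T (e a)‖ ^ 2 : ℝ) : ℂ) • (ℓ (e a) * y * star (ℓ (e a)))

theorem dilate_krausPiece_zero_zero (Z Y x : K →L[ℂ] K) :
    dilate (krausPiece ℓ Ω b T e Z 0) (krausPiece ℓ Ω b T e Y 0) x =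
      ⟪Ω, x Ω⟫_ℂ • (star Z * Y) := by
  rw [krausPiece, krausPiece, dilate_comp_left, dilate_comp_right, dilate_vacuumTensor,
    smul_one_mul, mul_smul_comm]

theorem dilate_krausPiece_succ_right (W : K →L[ℂ] lp (fun _ : κ => K) 2) (Y x : K →L[ℂ] K)
    (j : ℕ) : dilate W (krausPiece ℓ Ω b T e Y (j + 1)) x =
      ∑ a, dilate W (krausPiece ℓ Ω b T e Y j) (x * ℓ (star T (e a))) * star (ℓ (e a)) := by
  simp only [krausPiece, dilate_sum_right, dilate_amplification_right, dilate_comp_right]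

theorem dilate_krausPiece_succ_left (W : K →L[ℂ] lp (fun _ : κ => K) 2) (Y x : K →L[ℂ] K)
    (j : ℕ) : dilate (krausPiece ℓ Ω b T e Y (j + 1)) W x =
      ∑ a, ℓ (e a) * dilate (krausPiece ℓ Ω b T e Y j) W (star (ℓ (star T (e a))) * x) := by
  simp only [krausPiece, dilate_sum_left, dilate_amplification_left, dilate_comp_left, star_star]

theorem dilate_krausPiece_right_mul_star (hℓ : IsToeplitzFamily ℓ Ω) (he : IsRangeBasis T e)
    (W : K →L[ℂ] lp (fun _ : κ => K) 2) (Y x : K →L[ℂ] K) (h : H) (j : ℕ) :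
    dilate W (krausPiece ℓ Ω b T e Y (j + 1)) (x * star (ℓ h)) =
      dilate W (krausPiece ℓ Ω b T e Y j) x * star (ℓ (T h)) := by
  rw [← dilate_amplification_right, amplification_star_comp_krausPiece_succ hℓ he,
    dilate_comp_right]

theorem dilate_krausPiece_right_zero_mul_star (hℓ : IsToeplitzFamily ℓ Ω)
    (W : K →L[ℂ] lp (fun _ : κ => K) 2) (Y x : K →L[ℂ] K) (h : H) :
    dilate W (krausPiece ℓ Ω b T e Y 0) (x * star (ℓ h)) = 0 := by
  rw [← dilate_amplification_right, amplification_star_comp_krausPiece_zero hℓ,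
    dilate_zero_right, zero_apply]

theorem dilate_krausPiece_left_mul (hℓ : IsToeplitzFamily ℓ Ω) (he : IsRangeBasis T e)
    (W : K →L[ℂ] lp (fun _ : κ => K) 2) (Y x : K →L[ℂ] K) (h : H) (j : ℕ) :
    dilate (krausPiece ℓ Ω b T e Y (j + 1)) W (ℓ h * x) =
      ℓ (T h) * dilate (krausPiece ℓ Ω b T e Y j) W x := by
  rw [← star_star (ℓ h), ← dilate_amplification_left,
    amplification_star_comp_krausPiece_succ hℓ he, dilate_comp_left, star_star]

theorem dilate_krausPiece_left_zero_mul (hℓ : IsToeplitzFamily ℓ Ω)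
    (W : K →L[ℂ] lp (fun _ : κ => K) 2) (Y x : K →L[ℂ] K) (h : H) :
    dilate (krausPiece ℓ Ω b T e Y 0) W (ℓ h * x) = 0 := by
  rw [← star_star (ℓ h), ← dilate_amplification_left,
    amplification_star_comp_krausPiece_zero hℓ, dilate_zero_left, zero_apply]

/-- Orthogonality of the T^*e_a removes the off-diagonal terms of the double sum. -/
theorem dilate_krausPiece_succ_succ_one (hℓ : IsToeplitzFamily ℓ Ω) (he : IsRangeBasis T e)
    (Z Y : K →L[ℂ] K) (i j : ℕ) :
    dilate (krausPiece ℓ Ω b T e Z (i + 1)) (krausPiece ℓ Ω b T e Y (j + 1)) 1 =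
      shiftMap ℓ T e (dilate (krausPiece ℓ Ω b T e Z i) (krausPiece ℓ Ω b T e Y j) 1) := by
  rw [dilate_krausPiece_succ_right]
  simp only [one_mul, dilate_krausPiece_succ_left, shiftMap, hℓ.star_mul, Finset.sum_mul]
  refine Finset.sum_congr rfl fun a _ => ?_
  rw [Finset.sum_eq_single a]
  · rw [map_smul, inner_self_eq_norm_sq_to_K, mul_smul_comm, smul_mul_assoc]
    simp
  · intro c _ hc
    rw [he.diag c a hc, zero_smul, map_zero, mul_zero, zero_mul]
  · simp

theorem dilate_krausPiece_zero_succ_one (hℓ : IsToeplitzFamily ℓ Ω)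
    (Z Y : K →L[ℂ] K) (j : ℕ) :
    dilate (krausPiece ℓ Ω b T e Z 0) (krausPiece ℓ Ω b T e Y (j + 1)) 1 = 0 := by
  rw [dilate_krausPiece_succ_right]
  refine Finset.sum_eq_zero fun a _ => ?_
  rw [one_mul, ← mul_one (ℓ _), dilate_krausPiece_left_zero_mul hℓ, zero_mul]

theorem dilate_krausPiece_succ_zero_one (hℓ : IsToeplitzFamily ℓ Ω)
    (Z Y : K →L[ℂ] K) (j : ℕ) :
    dilate (krausPiece ℓ Ω b T e Z (j + 1)) (krausPiece ℓ Ω b T e Y 0) 1 = 0 := by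
  rw [dilate_krausPiece_succ_left]
  refine Finset.sum_eq_zero fun a _ => ?_
  rw [mul_one, ← one_mul (star (ℓ _)), dilate_krausPiece_right_zero_mul_star hℓ, mul_zero]

/-- Both indices are lowered together until one is zero; the remaining creation operator then meets
the vacuum from the wrong side. -/
theorem dilate_krausPiece_of_ne (hℓ : IsToeplitzFamily ℓ Ω) (he : IsRangeBasis T e)
    (Z Y : K →L[ℂ] K) {i j : ℕ} (hij : i ≠ j) :
    dilate (krausPiece ℓ Ω b T e Z i) (krausPiece ℓ Ω b T e Y j) 1 = 0 := by
  induction i generalizing j with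
  | zero =>
    obtain ⟨j, rfl⟩ := Nat.exists_eq_succ_of_ne_zero hij.symm
    exact dilate_krausPiece_zero_succ_one hℓ Z Y j
  | succ i ih =>
    cases j with
    | zero => exact dilate_krausPiece_succ_zero_one hℓ Z Y i
    | succ j =>
      rw [dilate_krausPiece_succ_succ_one hℓ he, ih (by simpa using hij)]
      simp [shiftMap]

theorem dilate_krausPiece_self (hℓ : IsToeplitzFamily ℓ Ω) (he : IsRangeBasis T e)
    (Z Y : K →L[ℂ] K) (i : ℕ) :
    dilate (krausPiece ℓ Ω b T e Z i) (krausPiece ℓ Ω b T e Y i) 1 =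
      (shiftMap ℓ T e)^[i] (star Z * Y) := by
  induction i with
  | zero =>
    rw [dilate_krausPiece_zero_zero, one_apply_eq_self, hℓ.inner_vacuum, one_smul]
    rfl
  | succ i ih => rw [dilate_krausPiece_succ_succ_one hℓ he, ih, Function.iterate_succ_apply']

/-- The maps `x ↦ Eᵢ^* (x ⊗ 1) Eⱼ` have finite rank. -/
theorem exists_finiteDimensional_dilate_krausPiece (Z Y : K →L[ℂ] K) (i j : ℕ) :
    ∃ Q : Submodule ℂ (K →L[ℂ] K), FiniteDimensional ℂ Q ∧
      ∀ x, dilate (krausPiece ℓ Ω b T e Z i) (krausPiece ℓ Ω b T e Y j) x ∈ Q := by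
  induction i with
  | zero =>
    induction j with
    | zero =>
      refine ⟨Submodule.span ℂ {star Z * Y}, inferInstance, fun x => ?_⟩
      rw [dilate_krausPiece_zero_zero]
      exact Submodule.smul_mem _ _ (Submodule.mem_span_singleton_self _)
    | succ j ih =>
      obtain ⟨Q, hQ, hmem⟩ := ih
      -- Raising an index multiplies values already in `Q` by finitely many fixed operators,
      -- starting from the rank one map of indices 0, 0.
      refine ⟨⨆ a, Q.map (LinearMap.mulRight ℂ (star (ℓ (e a)))), inferInstance, fun x => ?_⟩
      rw [dilate_krausPiece_succ_right]
      exact Submodule.sum_mem _ fun a _ => Submodule.mem_iSup_of_mem a ⟨_, hmem _, rfl⟩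
  | succ i ih =>
    obtain ⟨Q, hQ, hmem⟩ := ih
    refine ⟨⨆ a, Q.map (LinearMap.mulLeft ℂ (ℓ (e a))), inferInstance, fun x => ?_⟩
    rw [dilate_krausPiece_succ_left]
    exact Submodule.sum_mem _ fun a _ => Submodule.mem_iSup_of_mem a ⟨_, hmem _, rfl⟩

end Kraus

theorem summable_clm_of_norm {K G : Type*} [NormedAddCommGroup K] [NormedSpace ℂ K]
    [NormedAddCommGroup G] [NormedSpace ℂ G] [CompleteSpace G] {f : ℕ → (K →L[ℂ] G)}
    (h : Summable fun n => ‖f n‖) : Summable f :=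
  Summable.of_norm h

/-! ### The Kraus isometry and the degree decomposition -/

section SecondQuantization

variable {H : Type u} [NormedAddCommGroup H] [InnerProductSpace ℂ H] [CompleteSpace H]
variable {K : Type u} [NormedAddCommGroup K] [InnerProductSpace ℂ K] [CompleteSpace K]
variable {κ : Type u} {ℓ : H →L[ℂ] (K →L[ℂ] K)} {Ω : K}
variable {b : HilbertBasis κ ℂ K} {T : H →L[ℂ] H} {n : ℕ} {e : Fin n → H}

theorem shiftMap_sub (x y : K →L[ℂ] K) :
    shiftMap ℓ T e (x - y) = shiftMap ℓ T e x - shiftMap ℓ T e y := by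
  simp only [shiftMap, mul_sub, sub_mul, smul_sub, Finset.sum_sub_distrib]

theorem iterate_shiftMap_sub (i : ℕ) (x y : K →L[ℂ] K) :
    (shiftMap ℓ T e)^[i] (x - y) = (shiftMap ℓ T e)^[i] x - (shiftMap ℓ T e)^[i] y := by
  induction i with
  | zero => rfl
  | succ i ih => simp only [Function.iterate_succ_apply', ih, shiftMap_sub]

/-- The defect operator, a square root of `1 - ∑ₐ ‖T^* eₐ‖² ℓ(eₐ) ℓ(eₐ)^*`. -/
noncomputable def defect (ℓ : H →L[ℂ] (K →L[ℂ] K)) (T : H →L[ℂ] H) {n : ℕ} (e : Fin n → H) :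
    K →L[ℂ] K :=
  1 + ∑ a, ((√(1 - ‖star T (e a)‖ ^ 2) - 1 : ℝ) : ℂ) • (ℓ (e a) * star (ℓ (e a)))

theorem star_defect : star (defect ℓ T e) = defect ℓ T e := by
  simp [defect, star_sum, star_add, star_smul]

/-- The ℓ(e_a)ℓ(e_a)^* are orthogonal projections, and the defect is diagonal: √(1 - ‖T^*e_a‖²) on
the range of each, and 1 on the orthogonal complement of their sum. -/
theorem defect_mul_defect (hℓ : IsToeplitzFamily ℓ Ω) (he : IsRangeBasis T e) (hT : ‖T‖ < 1) :
    defect ℓ T e * defect ℓ T e = 1 - shiftMap ℓ T e 1 := by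
  have hmul : ∀ a c, (ℓ (e a) * star (ℓ (e a))) * (ℓ (e c) * star (ℓ (e c))) =
      if a = c then ℓ (e a) * star (ℓ (e a)) else 0 := by
    intro a c
    rw [mul_assoc, ← mul_assoc (star (ℓ (e a))), hℓ.star_mul,
      orthonormal_iff_ite.1 he.orthonormal a c]
    split_ifs with hac
    · subst hac
      rw [one_smul, one_mul]
    · rw [zero_smul, zero_mul, mul_zero]
  have hT' : ∀ a, ‖star T (e a)‖ ^ 2 ≤ 1 := fun a => by
    have h1 := (star T).le_opNorm (e a)
    rw [he.orthonormal.1 a, mul_one, norm_star] at h1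
    have h2 : ‖star T (e a)‖ ≤ 1 := h1.trans hT.le
    exact pow_le_one₀ (norm_nonneg _) h2
  set c : Fin n → ℂ := fun a => ((√(1 - ‖star T (e a)‖ ^ 2) - 1 : ℝ) : ℂ) with hc
  have hc2 : ∀ a, 2 * c a + c a * c a = -((‖star T (e a)‖ ^ 2 : ℝ) : ℂ) := by
    intro a
    have h := Real.mul_self_sqrt (sub_nonneg.2 (hT' a))
    have h' : 2 * (√(1 - ‖star T (e a)‖ ^ 2) - 1) +
        (√(1 - ‖star T (e a)‖ ^ 2) - 1) * (√(1 - ‖star T (e a)‖ ^ 2) - 1) =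
        -‖star T (e a)‖ ^ 2 := by nlinarith
    simp only [hc]
    exact_mod_cast h'
  have hsq : (∑ a, c a • (ℓ (e a) * star (ℓ (e a)))) * (∑ a, c a • (ℓ (e a) * star (ℓ (e a)))) =
      ∑ a, (c a * c a) • (ℓ (e a) * star (ℓ (e a))) := by
    rw [Finset.sum_mul]
    refine Finset.sum_congr rfl fun a _ => ?_
    rw [Finset.mul_sum, Finset.sum_eq_single a]
    · rw [smul_mul_smul_comm, hmul, if_pos rfl]
    · intro d _ hd
      rw [smul_mul_smul_comm, hmul, if_neg hd.symm, smul_zero]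
    · simp
  have hsh : shiftMap ℓ T e 1 = - ∑ a, (2 * c a + c a * c a) • (ℓ (e a) * star (ℓ (e a))) := by
    rw [shiftMap, ← Finset.sum_neg_distrib]
    refine Finset.sum_congr rfl fun a _ => ?_
    rw [hc2, neg_smul, neg_neg, mul_one]
  have hdef : defect ℓ T e = 1 + ∑ a, c a • (ℓ (e a) * star (ℓ (e a))) := rfl
  rw [hsh, hdef, add_mul, one_mul, mul_add, mul_one, hsq]
  simp only [add_smul, two_mul, Finset.sum_add_distrib]
  abel

theorem defect_vacuum (hℓ : IsToeplitzFamily ℓ Ω) : defect ℓ T e Ω = Ω := by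
  simp [defect, sum_apply, hℓ.star_vacuum]

/-- The Kraus operator of the second quantization of `T`. -/
noncomputable def krausOp (ℓ : H →L[ℂ] (K →L[ℂ] K)) (Ω : K) (b : HilbertBasis κ ℂ K)
    (T : H →L[ℂ] H) {n : ℕ} (e : Fin n → H) (Y : K →L[ℂ] K) : K →L[ℂ] lp (fun _ : κ => K) 2 :=
  ∑' j, krausPiece ℓ Ω b T e Y j

theorem hasSum_krausOp (hℓ : IsToeplitzFamily ℓ Ω) (he : IsRangeBasis T e) (hT : ‖T‖ < 1)
    (Y : K →L[ℂ] K) : HasSum (krausPiece ℓ Ω b T e Y) (krausOp ℓ Ω b T e Y) := by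
  have h : Summable (krausPiece ℓ Ω b T e Y) :=
    summable_clm_of_norm (summable_norm_krausPiece hℓ he hT Y)
  exact h.hasSum

/-- Applying ℓ(h)^* kills the piece of degree 0 and turns degree j + 1 into degree j, so the series
reproduces itself after an index shift. -/
theorem amplification_star_comp_krausOp (hℓ : IsToeplitzFamily ℓ Ω) (he : IsRangeBasis T e)
    (hT : ‖T‖ < 1) (Y : K →L[ℂ] K) (h : H) :
    (amplification K κ (star (ℓ h))).comp (krausOp ℓ Ω b T e Y) =
      (krausOp ℓ Ω b T e Y).comp (star (ℓ (T h))) := by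
  have h0 := hasSum_krausOp (b := b) hℓ he hT Y
  ext1 ζ
  have h1 := (h0.mapL (ContinuousLinearMap.apply ℂ _ ζ)).mapL (amplification K κ (star (ℓ h)))
  have h2 := h0.mapL (ContinuousLinearMap.apply ℂ _ (star (ℓ (T h)) ζ))
  have h3 := (hasSum_nat_add_iff' 1).2 h1
  have h4 : amplification K κ (star (ℓ h)) (krausPiece ℓ Ω b T e Y 0 ζ) = 0 :=
    DFunLike.congr_fun (amplification_star_comp_krausPiece_zero hℓ h Y) ζ
  simp only [ContinuousLinearMap.apply_apply, Finset.sum_range_one, h4, sub_zero] at h2 h3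
  refine h3.unique ?_
  change HasSum _ (krausOp ℓ Ω b T e Y (star (ℓ (T h)) ζ))
  convert h2 using 1
  funext j
  exact DFunLike.congr_fun (amplification_star_comp_krausPiece_succ hℓ he h Y j) ζ

/-- Only degree 0 survives, because ℓ(e_a)^* annihilates the vacuum. This identity makes the second
quantization contractive for the norm ‖xΩ‖. -/
theorem krausOp_vacuum (hℓ : IsToeplitzFamily ℓ Ω) (he : IsRangeBasis T e)
    (hT : ‖T‖ < 1) : krausOp ℓ Ω b T e (defect ℓ T e) Ω = vacuumTensor b Ω Ω := by
  have h0 := (hasSum_krausOp (b := b) hℓ he hT (defect ℓ T e)).mapL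
    (ContinuousLinearMap.apply ℂ _ Ω)
  simp only [ContinuousLinearMap.apply_apply] at h0
  refine h0.unique ?_
  have h1 : krausPiece ℓ Ω b T e (defect ℓ T e) 0 Ω = vacuumTensor b Ω Ω := by
    simp [krausPiece, defect_vacuum hℓ]
  rw [← h1]
  refine hasSum_single 0 fun j hj => ?_
  obtain ⟨j, rfl⟩ := Nat.exists_eq_succ_of_ne_zero hj
  simp [krausPiece, sum_apply, hℓ.star_vacuum]

theorem norm_amplification_vacuumTensor (hℓ : IsToeplitzFamily ℓ Ω) (x : K →L[ℂ] K) :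
    ‖amplification K κ x (vacuumTensor b Ω Ω)‖ = ‖x Ω‖ := by
  refine (sq_eq_sq₀ (norm_nonneg _) (norm_nonneg _)).1 (Complex.ofReal_injective ?_)
  rw [← inner_self_eq_ofReal_norm_sq, ← inner_self_eq_ofReal_norm_sq,
    ← ContinuousLinearMap.adjoint_inner_right, ← ContinuousLinearMap.star_eq_adjoint, ← map_star,
    ← mul_apply_eq_comp, ← map_mul, inner_vacuumTensor, hℓ.inner_vacuum, mul_one,
    mul_apply_eq_comp, ContinuousLinearMap.star_eq_adjoint, ContinuousLinearMap.adjoint_inner_right]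

/-- With S = `shiftMap ℓ T e`, the cross terms vanish and the diagonal ones are S^i(D²) = S^i(1) -
S^{i+1}(1), so the sum telescopes to 1. -/
theorem dilate_krausOp_one (hℓ : IsToeplitzFamily ℓ Ω) (he : IsRangeBasis T e) (hT : ‖T‖ < 1) :
    dilate (krausOp ℓ Ω b T e (defect ℓ T e)) (krausOp ℓ Ω b T e (defect ℓ T e)) 1 = 1 := by
  set D := defect ℓ T e with hD
  have hW := hasSum_krausOp (b := b) hℓ he hT D
  have h1 : HasSum (fun i => dilate (krausPiece ℓ Ω b T e D i) (krausOp ℓ Ω b T e D) 1)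
      (dilate (krausOp ℓ Ω b T e D) (krausOp ℓ Ω b T e D) 1) :=
    (hasSum_dilate_left (krausOp ℓ Ω b T e D) hW).mapL (ContinuousLinearMap.apply ℂ _ 1)
  have h2 : ∀ i, dilate (krausPiece ℓ Ω b T e D i) (krausOp ℓ Ω b T e D) 1 =
      (shiftMap ℓ T e)^[i] 1 - (shiftMap ℓ T e)^[i + 1] 1 := by
    intro i
    have h3 : HasSum (fun j => dilate (krausPiece ℓ Ω b T e D i) (krausPiece ℓ Ω b T e D j) 1)
        (dilate (krausPiece ℓ Ω b T e D i) (krausOp ℓ Ω b T e D) 1) :=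
      (hasSum_dilate_right (krausPiece ℓ Ω b T e D i) hW).mapL (ContinuousLinearMap.apply ℂ _ 1)
    rw [h3.unique (hasSum_single i fun j hj => dilate_krausPiece_of_ne hℓ he D D hj.symm),
      dilate_krausPiece_self hℓ he, hD, star_defect, defect_mul_defect hℓ he hT,
      iterate_shiftMap_sub, Function.iterate_succ_apply]
  simp only [h2] at h1
  have h4 := h1.tendsto_sum_nat
  simp only [Finset.sum_range_sub'] at h4
  refine tendsto_nhds_unique h4 ?_
  -- The iterate S^N(1) is E_N^*E_N for the pieces with `Y = 1`, and these tend to 0 in norm.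
  have h5 : Filter.Tendsto (fun N => (shiftMap ℓ T e)^[N] (1 : K →L[ℂ] K)) Filter.atTop (nhds 0) := by
    have hk := (summable_norm_krausPiece (b := b) hℓ he hT 1).tendsto_atTop_zero
    refine squeeze_zero_norm (a := fun N => ‖krausPiece ℓ Ω b T e 1 N‖ *
      ‖krausPiece ℓ Ω b T e 1 N‖ * ‖(1 : K →L[ℂ] K)‖) (fun N => ?_) (by simpa using (hk.mul hk).mul_const ‖(1 : K →L[ℂ] K)‖)
    have h6 := dilate_krausPiece_self (b := b) hℓ he 1 1 N
    rw [star_one, one_mul] at h6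
    rw [← h6]
    exact ContinuousLinearMap.le_of_opNorm_le _ (norm_dilate_le _ _) _
  simpa using tendsto_const_nhds.sub h5

/-- The sum of the terms of total degree `m`. -/
noncomputable def degreeSum (ℓ : H →L[ℂ] (K →L[ℂ] K)) (Ω : K) (b : HilbertBasis κ ℂ K)
    (T : H →L[ℂ] H) {n : ℕ} (e : Fin n → H) (Y : K →L[ℂ] K) (m : ℕ) :
    (K →L[ℂ] K) →L[ℂ] (K →L[ℂ] K) :=
  ∑ q ∈ Finset.HasAntidiagonal.antidiagonal m,
    dilate (krausPiece ℓ Ω b T e 1 q.1) (krausPiece ℓ Ω b T e Y q.2)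

theorem degreeSum_succ_mul_star (hℓ : IsToeplitzFamily ℓ Ω) (he : IsRangeBasis T e)
    (Y x : K →L[ℂ] K) (h : H) (m : ℕ) :
    degreeSum ℓ Ω b T e Y (m + 1) (x * star (ℓ h)) =
      degreeSum ℓ Ω b T e Y m x * star (ℓ (T h)) := by
  rw [degreeSum, degreeSum, Finset.Nat.sum_antidiagonal_succ', add_apply,
    dilate_krausPiece_right_zero_mul_star hℓ, zero_add, sum_apply, sum_apply, Finset.sum_mul]
  exact Finset.sum_congr rfl fun q _ => dilate_krausPiece_right_mul_star hℓ he _ _ _ _ _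

theorem degreeSum_zero_mul_star (hℓ : IsToeplitzFamily ℓ Ω) (Y x : K →L[ℂ] K) (h : H) :
    degreeSum ℓ Ω b T e Y 0 (x * star (ℓ h)) = 0 := by
  rw [degreeSum, Finset.Nat.antidiagonal_zero, Finset.sum_singleton,
    dilate_krausPiece_right_zero_mul_star hℓ]

theorem degreeSum_succ_mul (hℓ : IsToeplitzFamily ℓ Ω) (he : IsRangeBasis T e)
    (Y x : K →L[ℂ] K) (h : H) (m : ℕ) :
    degreeSum ℓ Ω b T e Y (m + 1) (ℓ h * x) = ℓ (T h) * degreeSum ℓ Ω b T e Y m x := by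
  rw [degreeSum, degreeSum, Finset.Nat.sum_antidiagonal_succ, add_apply,
    dilate_krausPiece_left_zero_mul hℓ, zero_add, sum_apply, sum_apply, Finset.mul_sum]
  exact Finset.sum_congr rfl fun q _ => dilate_krausPiece_left_mul hℓ he _ _ _ _ _

theorem degreeSum_zero_mul (hℓ : IsToeplitzFamily ℓ Ω) (Y x : K →L[ℂ] K) (h : H) :
    degreeSum ℓ Ω b T e Y 0 (ℓ h * x) = 0 := by
  rw [degreeSum, Finset.Nat.antidiagonal_zero, Finset.sum_singleton,
    dilate_krausPiece_left_zero_mul hℓ]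

/-- Only diagonal terms contribute, and S^{i+1}(1) = S^i(S(1)): lowering both indices by one is paid
for by replacing `Y = 1` with `Y = S(1)`. -/
theorem degreeSum_shift_one (hℓ : IsToeplitzFamily ℓ Ω) (he : IsRangeBasis T e) (m : ℕ) :
    degreeSum ℓ Ω b T e 1 (m + 2) 1 = degreeSum ℓ Ω b T e (shiftMap ℓ T e 1) m 1 := by
  rw [degreeSum, Finset.Nat.sum_antidiagonal_succ, Finset.Nat.sum_antidiagonal_succ', degreeSum,
    add_apply, add_apply, dilate_krausPiece_zero_succ_one hℓ, dilate_krausPiece_succ_zero_one hℓ,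
    zero_add, zero_add, sum_apply, sum_apply]
  refine Finset.sum_congr rfl fun q _ => ?_
  rcases eq_or_ne q.1 q.2 with hq | hq
  · rw [← hq, dilate_krausPiece_self hℓ he, dilate_krausPiece_self hℓ he, star_one, one_mul,
      one_mul, Function.iterate_succ_apply]
  · rw [dilate_krausPiece_of_ne hℓ he _ _ hq, dilate_krausPiece_of_ne hℓ he _ _ (by simpa using hq)]

theorem continuous_sigmaWeak_degreeSum (Y : K →L[ℂ] K) (m : ℕ) :
    @Continuous _ _ (sigmaWeak K) (sigmaWeak K) (degreeSum ℓ Ω b T e Y m) := by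
  have h := continuous_sigmaWeak_sum (Finset.HasAntidiagonal.antidiagonal m) fun q : ℕ × ℕ =>
    continuous_sigmaWeak_dilate (krausPiece ℓ Ω b T e 1 q.1) (krausPiece ℓ Ω b T e Y q.2)
  convert h using 1
  funext x
  rw [degreeSum, sum_apply]

theorem exists_finiteDimensional_degreeSum (Y : K →L[ℂ] K) (m : ℕ) :
    ∃ Q : Submodule ℂ (K →L[ℂ] K), FiniteDimensional ℂ Q ∧
      ∀ x, degreeSum ℓ Ω b T e Y m x ∈ Q := by
  choose Q hQ hmem using fun q : ℕ × ℕ =>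
    exists_finiteDimensional_dilate_krausPiece (ℓ := ℓ) (Ω := Ω) (b := b) (T := T) (e := e) 1 Y q.1 q.2
  refine ⟨⨆ q : Finset.HasAntidiagonal.antidiagonal m, Q q, inferInstance, fun x => ?_⟩
  rw [degreeSum, sum_apply]
  exact Submodule.sum_mem _ fun q hq =>
    Submodule.mem_iSup_of_mem (p := fun q : Finset.HasAntidiagonal.antidiagonal m => Q q)
      ⟨q, hq⟩ (hmem q x)

/-- The component of degree `m` of the second quantization of `T`. -/
noncomputable def degreePart (ℓ : H →L[ℂ] (K →L[ℂ] K)) (Ω : K) (b : HilbertBasis κ ℂ K)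
    (T : H →L[ℂ] H) {n : ℕ} (e : Fin n → H) : ℕ → ((K →L[ℂ] K) →L[ℂ] (K →L[ℂ] K))
  | 0 => degreeSum ℓ Ω b T e 1 0
  | 1 => degreeSum ℓ Ω b T e 1 1
  | m + 2 => degreeSum ℓ Ω b T e 1 (m + 2) - degreeSum ℓ Ω b T e (shiftMap ℓ T e 1) m

theorem degreePart_succ_mul_star (hℓ : IsToeplitzFamily ℓ Ω) (he : IsRangeBasis T e)
    (x : K →L[ℂ] K) (h : H) (m : ℕ) :
    degreePart ℓ Ω b T e (m + 1) (x * star (ℓ h)) =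
      degreePart ℓ Ω b T e m x * star (ℓ (T h)) := by
  match m with
  | 0 => exact degreeSum_succ_mul_star hℓ he _ _ _ _
  -- The correction first appears in degree 2, where it is `degreeSum` of degree 0 and is killed by
  -- ℓ(h)^*; degree 1 has none, so the relation still holds.
  | 1 =>
    simp only [degreePart, sub_apply, degreeSum_succ_mul_star hℓ he, degreeSum_zero_mul_star hℓ,
      sub_zero]
  | m + 2 => simp only [degreePart, sub_apply, degreeSum_succ_mul_star hℓ he, sub_mul]

theorem degreePart_succ_mul (hℓ : IsToeplitzFamily ℓ Ω) (he : IsRangeBasis T e)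
    (x : K →L[ℂ] K) (h : H) (m : ℕ) :
    degreePart ℓ Ω b T e (m + 1) (ℓ h * x) = ℓ (T h) * degreePart ℓ Ω b T e m x := by
  match m with
  | 0 => exact degreeSum_succ_mul hℓ he _ _ _ _
  | 1 =>
    simp only [degreePart, sub_apply, degreeSum_succ_mul hℓ he, degreeSum_zero_mul hℓ, sub_zero]
  | m + 2 => simp only [degreePart, sub_apply, degreeSum_succ_mul hℓ he, mul_sub]

theorem degreePart_zero_mul_star (hℓ : IsToeplitzFamily ℓ Ω) (x : K →L[ℂ] K) (h : H) :
    degreePart ℓ Ω b T e 0 (x * star (ℓ h)) = 0 := degreeSum_zero_mul_star hℓ _ _ _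

theorem degreePart_zero_mul (hℓ : IsToeplitzFamily ℓ Ω) (x : K →L[ℂ] K) (h : H) :
    degreePart ℓ Ω b T e 0 (ℓ h * x) = 0 := degreeSum_zero_mul hℓ _ _ _

theorem degreePart_zero_one (hℓ : IsToeplitzFamily ℓ Ω) : degreePart ℓ Ω b T e 0 1 = 1 := by
  rw [degreePart, degreeSum, Finset.Nat.antidiagonal_zero, Finset.sum_singleton,
    dilate_krausPiece_zero_zero, one_apply_eq_self, hℓ.inner_vacuum, star_one, one_mul, one_smul]

/-- Uncorrected, the identity would also leak into the positive even degrees; the term subtracted in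
`degreePart` removes exactly this. -/
theorem degreePart_succ_one (hℓ : IsToeplitzFamily ℓ Ω) (he : IsRangeBasis T e) (m : ℕ) :
    degreePart ℓ Ω b T e (m + 1) 1 = 0 := by
  cases m with
  | zero =>
    rw [degreePart, degreeSum, Finset.Nat.sum_antidiagonal_succ, Finset.Nat.antidiagonal_zero,
      Finset.sum_singleton, add_apply, dilate_krausPiece_zero_succ_one hℓ,
      dilate_krausPiece_succ_zero_one hℓ, add_zero]
  | succ m => rw [degreePart, sub_apply, degreeSum_shift_one hℓ he, sub_self]

theorem continuous_sigmaWeak_degreePart (m : ℕ) :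
    @Continuous _ _ (sigmaWeak K) (sigmaWeak K) (degreePart ℓ Ω b T e m) := by
  match m with
  | 0 => exact continuous_sigmaWeak_degreeSum _ _
  | 1 => exact continuous_sigmaWeak_degreeSum _ _
  | m + 2 =>
    rw [degreePart, sub_eq_add_neg]
    exact continuous_sigmaWeak_add (continuous_sigmaWeak_degreeSum _ _)
      (continuous_sigmaWeak_neg (continuous_sigmaWeak_degreeSum _ _))

theorem exists_finiteDimensional_degreePart (m : ℕ) :
    ∃ Q : Submodule ℂ (K →L[ℂ] K), FiniteDimensional ℂ Q ∧
      ∀ x, degreePart ℓ Ω b T e m x ∈ Q := by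
  match m with
  | 0 => exact exists_finiteDimensional_degreeSum _ _
  | 1 => exact exists_finiteDimensional_degreeSum _ _
  | m + 2 =>
    obtain ⟨Q, hQ, h⟩ := exists_finiteDimensional_degreeSum (ℓ := ℓ) (Ω := Ω) (b := b) (T := T)
      (e := e) 1 (m + 2)
    obtain ⟨Q', hQ', h'⟩ := exists_finiteDimensional_degreeSum (ℓ := ℓ) (Ω := Ω) (b := b) (T := T)
      (e := e) (shiftMap ℓ T e 1) m
    exact ⟨Q ⊔ Q', inferInstance, fun x => Submodule.sub_mem _
      (Submodule.mem_sup_left (h x)) (Submodule.mem_sup_right (h' x))⟩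

/-- The degree components sum, in norm, to a normal map. -/
theorem hasSum_degreePart (hℓ : IsToeplitzFamily ℓ Ω) (he : IsRangeBasis T e) (hT : ‖T‖ < 1) :
    HasSum (degreePart ℓ Ω b T e) (dilate (krausOp ℓ Ω b T e 1)
      (krausOp ℓ Ω b T e 1 - krausOp ℓ Ω b T e (shiftMap ℓ T e 1))) := by
  have hs : ∀ Y, HasSum (degreeSum ℓ Ω b T e Y)
      (dilate (krausOp ℓ Ω b T e 1) (krausOp ℓ Ω b T e Y)) := fun Y =>
    hasSum_dilate_antidiagonal (summable_norm_krausPiece hℓ he hT 1)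
      (summable_norm_krausPiece hℓ he hT Y) (hasSum_krausOp hℓ he hT 1) (hasSum_krausOp hℓ he hT Y)
  -- The correction is delayed by two degrees, so the first two terms are split off before
  -- subtracting the series.
  rw [dilate_sub_right, ← hasSum_nat_add_iff' 2]
  have h1 := ((hasSum_nat_add_iff' 2).2 (hs 1)).sub (hs (shiftMap ℓ T e 1))
  convert h1 using 1
  simp only [degreePart]
  abel

end SecondQuantization

/-! ## The complexified orthogonal representation -/

namespace Complexified

variable {E : Type u} [NormedAddCommGroup E] [InnerProductSpace ℝ E]

@[simp] theorem re_conj (x : Complexified E) : x.conj.re = x.re := rfl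
@[simp] theorem im_conj (x : Complexified E) : x.conj.im = -x.im := rfl

@[simp] theorem conj_conj (x : Complexified E) : x.conj.conj = x := by
  ext <;> simp

theorem conj_add (x y : Complexified E) : (x + y).conj = x.conj + y.conj := by
  ext <;> simp
  abel

theorem conj_smul (c : ℂ) (x : Complexified E) :
    (c • x).conj = starRingEnd ℂ c • x.conj := by
  ext
  · simp
  · simp [add_comm]

@[simp] theorem norm_conj (x : Complexified E) : ‖x.conj‖ = ‖x‖ := by
  refine (sq_eq_sq₀ (norm_nonneg _) (norm_nonneg _)).1 ?_
  simp [norm_sq]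

/-- The conjugation as an antilinear isometry. -/
noncomputable def conjL : Complexified E →ₗᵢ⋆[ℂ] Complexified E where
  toFun := conj
  map_add' := conj_add
  map_smul' := conj_smul
  norm_map' := norm_conj

@[simp] theorem conjL_apply (x : Complexified E) : conjL x = x.conj := rfl

theorem continuous_conj : Continuous (conj : Complexified E → Complexified E) :=
  (conjL (E := E)).continuous

theorem conj_sub (x y : Complexified E) : (x - y).conj = x.conj - y.conj :=
  map_sub (conjL (E := E)) x y

@[simp] theorem conj_zero : (0 : Complexified E).conj = 0 := map_zero (conjL (E := E))

theorem inner_conj_conj (x y : Complexified E) : ⟪x.conj, y.conj⟫_ℂ = ⟪y, x⟫_ℂ := by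
  rw [inner_def, inner_def]
  apply Complex.ext
  · simp [real_inner_comm]
  · simp [real_inner_comm]
    ring

theorem inner_conj_left (x y : Complexified E) : ⟪x.conj, y⟫_ℂ = ⟪y.conj, x⟫_ℂ := by
  rw [← inner_conj_conj, conj_conj]

@[simp] theorem conj_ofReal (a : E) : (ofReal a).conj = ofReal a := by
  ext <;> simp [ofReal]

theorem eq_ofReal_of_conj_eq {x : Complexified E} (h : x.conj = x) : x = ofReal x.re := by
  have h1 : -x.im = x.im := congrArg im h
  ext
  · rfl
  · have h2 : (2 : ℝ) • x.im = 0 := by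
      rw [two_smul]
      nth_rewrite 1 [← h1]
      exact neg_add_cancel _
    exact (smul_eq_zero.1 h2).resolve_left two_ne_zero

theorem eq_ofReal_add (x : Complexified E) : x = ofReal x.re + Complex.I • ofReal x.im := by
  ext <;> simp [ofReal]

end Complexified

namespace OrthogonalRep

variable {E : Type u} [NormedAddCommGroup E] [InnerProductSpace ℝ E] [CompleteSpace E]
variable (V : OrthogonalRep E)

@[simp] theorem re_complexU (t : ℝ) (x : Complexified E) : (V.complexU t x).re = V.U t x.re := rfl
@[simp] theorem im_complexU (t : ℝ) (x : Complexified E) : (V.complexU t x).im = V.U t x.im := rfl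

theorem inner_complexU (t : ℝ) (x y : Complexified E) :
    ⟪V.complexU t x, V.complexU t y⟫_ℂ = ⟪x, y⟫_ℂ := by
  rw [Complexified.inner_def, Complexified.inner_def]
  simp

/-- The unitary operator `U_t` as a linear isometry. -/
noncomputable def unitary (t : ℝ) : Complexified E →ₗᵢ[ℂ] Complexified E where
  toFun := V.complexU t
  map_add' x y := by ext <;> simp
  map_smul' c x := by ext <;> simp
  norm_map' x := by
    refine (sq_eq_sq₀ (norm_nonneg _) (norm_nonneg _)).1 ?_
    simp [Complexified.norm_sq, complexU]

@[simp] theorem unitary_apply (t : ℝ) (x : Complexified E) : V.unitary t x = V.complexU t x := rfl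

@[simp] theorem complexU_zero (x : Complexified E) : V.complexU 0 x = x := by
  ext <;> simp [V.map_zero]

theorem complexU_add (s t : ℝ) (x : Complexified E) :
    V.complexU (s + t) x = V.complexU s (V.complexU t x) := by
  ext <;> simp [V.map_add]

theorem conj_complexU (t : ℝ) (x : Complexified E) :
    (V.complexU t x).conj = V.complexU t x.conj := by
  ext <;> simp

@[simp] theorem norm_complexU (t : ℝ) (x : Complexified E) : ‖V.complexU t x‖ = ‖x‖ :=
  (V.unitary t).norm_map x

theorem continuous_complexU_apply (x : Complexified E) : Continuous fun t => V.complexU t x := by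
  have h : Continuous fun t => (V.U t x.re, V.U t x.im) :=
    (V.continuous x.re).prodMk (V.continuous x.im)
  exact (WithLp.prod_continuous_toLp 2 E E).comp h

theorem inner_complexU_left (t : ℝ) (x y : Complexified E) :
    ⟪V.complexU t x, y⟫_ℂ = ⟪x, V.complexU (-t) y⟫_ℂ := by
  rw [← V.inner_complexU (-t), ← complexU_add, neg_add_cancel, complexU_zero]

end OrthogonalRep

/-! ## Uniqueness of analytic continuation from the boundary of a strip -/

section Strip

open Complex Set

theorem isOpen_strip (s : ℝ) : IsOpen {z : ℂ | 0 < z.im ∧ z.im < s} :=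
  (isOpen_lt continuous_const continuous_im).inter (isOpen_lt continuous_im continuous_const)

theorem closure_strip {s : ℝ} (hs : 0 < s) :
    closure {z : ℂ | 0 < z.im ∧ z.im < s} = {z : ℂ | 0 ≤ z.im ∧ z.im ≤ s} := by
  have h := closure_preimage_im (Ioo 0 s)
  rw [closure_Ioo hs.ne] at h
  exact h

/-- A function which is continuous on a closed square and holomorphic inside, and which vanishes on
one side, vanishes at the centre. -/
theorem eq_zero_of_eq_zero_on_real {s : ℝ} {f : ℂ → ℂ}
    (hc : ContinuousOn f {z : ℂ | 0 ≤ z.im ∧ z.im ≤ s})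
    (hd : DifferentiableOn ℂ f {z : ℂ | 0 < z.im ∧ z.im < s}) (h0 : ∀ t : ℝ, f t = 0)
    {a : ℂ} (ha : 0 < a.im) (has : 2 * a.im ≤ s) : f a = 0 := by
  set ε := a.im with hε
  set U : Set ℂ := Ioo (-ε) ε ×ℂ Ioo (-ε) ε with hU
  have hne : (-ε) ≠ ε := by linarith
  have hcl : closure U = Icc (-ε) ε ×ℂ Icc (-ε) ε := by
    rw [hU, closure_reProdIm, closure_Ioo hne]
  have hcl' : ∀ w ∈ closure U, w ∈ Icc (-ε) ε ×ℂ Icc (-ε) ε := fun w hw => by rwa [hcl] at hw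
  -- On each side of the square one of the four factors is evaluated on the real line, so `g`
  -- vanishes on the whole boundary. The maximum principle gives g(0) = f(a)⁴ = 0.
  set g : ℂ → ℂ := fun w => f (a + w) * f (a + I * w) * f (a + -w) * f (a + -(I * w)) with hg
  have key : ∀ (c : ℂ → ℂ), Continuous c → Differentiable ℂ c →
      (∀ w ∈ U, |(c w).im| < ε) → (∀ w ∈ closure U, |(c w).im| ≤ ε) →
      DiffContOnCl ℂ (fun w => f (a + c w)) U := by
    intro c hcc hcd h1 h2
    constructor
    · refine hd.comp (by fun_prop) fun w hw => ?_
      have := abs_lt.1 (h1 w hw)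
      simp only [mem_ofPred_eq, add_im]
      constructor <;> linarith
    · refine hc.comp (by fun_prop) fun w hw => ?_
      have := abs_le.1 (h2 w hw)
      simp only [mem_ofPred_eq, add_im]
      constructor <;> linarith
  have hgd : DiffContOnCl ℂ g U := by
    have k1 := key (fun w => w) continuous_id differentiable_id
      (fun w hw => abs_lt.2 hw.2) (fun w hw => abs_le.2 (hcl' w hw).2)
    have k2 := key (fun w => I * w) (by fun_prop) (by fun_prop)
      (fun w hw => by simpa using abs_lt.2 hw.1)
      (fun w hw => by simpa using abs_le.2 (hcl' w hw).1)
    have k3 := key (fun w => -w) (by fun_prop) (by fun_prop)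
      (fun w hw => by simpa using abs_lt.2 hw.2)
      (fun w hw => by simpa using abs_le.2 (hcl' w hw).2)
    have k4 := key (fun w => -(I * w)) (by fun_prop) (by fun_prop)
      (fun w hw => by simpa using abs_lt.2 hw.1)
      (fun w hw => by simpa using abs_le.2 (hcl' w hw).1)
    exact ((k1.smul k2).smul k3).smul k4
  have hreal : ∀ z : ℂ, z.im = 0 → f z = 0 := by
    intro z hz
    have : z = (z.re : ℂ) := Complex.ext (by simp) (by simpa using hz)
    rw [this]
    exact h0 _
  have hfr : ∀ w ∈ frontier U, ‖g w‖ ≤ 0 := by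
    intro w hw
    rw [hU, frontier_reProdIm, closure_Ioo hne, frontier_Ioo (by linarith)] at hw
    have hz : g w = 0 := by
      rcases hw with ⟨-, hw⟩ | ⟨hw, -⟩
      · rcases hw with hw | hw
        · have : f (a + w) = 0 := hreal _ (by rw [add_im, hw]; ring)
          simp [hg, this]
        · have hw' : w.im = ε := hw
          have : f (a + -w) = 0 := hreal _ (by rw [add_im, neg_im, hw']; ring)
          simp [hg, this]
      · rcases hw with hw | hw
        · have hw' : w.re = -ε := hw
          have : f (a + I * w) = 0 := hreal _ (by simp [hw', hε])
          simp [hg, this]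
        · have hw' : w.re = ε := hw
          have : f (a + -(I * w)) = 0 := hreal _ (by simp [hw', hε])
          simp [hg, this]
    simp [hz]
  have hbd : Bornology.IsBounded U :=
    (Metric.isBounded_Ioo (-ε) ε).reProdIm (Metric.isBounded_Ioo (-ε) ε)
  have h00 : (0 : ℂ) ∈ closure U := by
    rw [hcl]
    exact ⟨by simp [ha.le], by simp [ha.le]⟩
  have hfin := norm_le_of_forall_mem_frontier_norm_le hbd hgd hfr h00
  have hga : g 0 = f a ^ 4 := by simp [hg]; ring
  have : g 0 = 0 := norm_le_zero_iff.1 hfin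
  rw [hga] at this
  exact pow_eq_zero_iff (by norm_num) |>.1 this

/-- The square argument gives vanishing in the lower half of the strip. The identity theorem and
continuity extend it to the closed strip. -/
theorem eqOn_zero_strip {s : ℝ} (hs : 0 < s) {f : ℂ → ℂ}
    (hc : ContinuousOn f {z : ℂ | 0 ≤ z.im ∧ z.im ≤ s})
    (hd : DifferentiableOn ℂ f {z : ℂ | 0 < z.im ∧ z.im < s}) (h0 : ∀ t : ℝ, f t = 0) :
    ∀ z : ℂ, 0 ≤ z.im → z.im ≤ s → f z = 0 := by
  have han : AnalyticOnNhd ℂ f {z : ℂ | 0 < z.im ∧ z.im < s} := hd.analyticOnNhd (isOpen_strip s)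
  have hconv : Convex ℝ {z : ℂ | 0 < z.im ∧ z.im < s} :=
    (convex_halfSpace_im_gt 0).inter (convex_halfSpace_im_lt s)
  have hz₀ : (I * (s / 4 : ℝ) : ℂ) ∈ {z : ℂ | 0 < z.im ∧ z.im < s} := by
    simp only [mem_ofPred_eq, mul_im, I_re, I_im, ofReal_re, ofReal_im]
    constructor <;> linarith
  have hev : f =ᶠ[nhds (I * (s / 4 : ℝ) : ℂ)] 0 := by
    have hop : IsOpen {z : ℂ | 0 < z.im ∧ z.im < s / 2} := isOpen_strip _
    refine Filter.eventually_of_mem (hop.mem_nhds ?_) fun z hz => ?_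
    · simp only [mem_ofPred_eq, mul_im, I_re, I_im, ofReal_re, ofReal_im]
      constructor <;> linarith
    · exact eq_zero_of_eq_zero_on_real hc hd h0 hz.1 (by linarith [hz.2])
  have heq := han.eqOn_zero_of_preconnected_of_eventuallyEq_zero hconv.isPreconnected hz₀ hev
  have hfull : EqOn f 0 {z : ℂ | 0 ≤ z.im ∧ z.im ≤ s} :=
    heq.of_subset_closure hc continuousOn_const
      (fun z hz => ⟨hz.1.le, hz.2.le⟩) (closure_strip hs).ge
  exact fun z h1 h2 => hfull ⟨h1, h2⟩

theorem eqOn_strip {G : Type*} [NormedAddCommGroup G] [InnerProductSpace ℂ G] {s : ℝ} (hs : 0 < s)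
    {F F' : ℂ → G} (hc : ContinuousOn F {z : ℂ | 0 ≤ z.im ∧ z.im ≤ s})
    (hc' : ContinuousOn F' {z : ℂ | 0 ≤ z.im ∧ z.im ≤ s})
    (hd : DifferentiableOn ℂ F {z : ℂ | 0 < z.im ∧ z.im < s})
    (hd' : DifferentiableOn ℂ F' {z : ℂ | 0 < z.im ∧ z.im < s})
    (h0 : ∀ t : ℝ, F t = F' t) : ∀ z : ℂ, 0 ≤ z.im → z.im ≤ s → F z = F' z := by
  intro z h1 h2
  refine ext_inner_left ℂ fun y => ?_
  have h := eqOn_zero_strip hs (f := fun z => innerSL ℂ y (F z - F' z))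
    ((innerSL ℂ y).continuous.comp_continuousOn (hc.sub hc'))
    ((innerSL ℂ y).differentiable.comp_differentiableOn (hd.sub hd'))
    (fun t => by simp [h0]) z h1 h2
  rw [innerSL_apply_apply, inner_sub_right] at h
  exact sub_eq_zero.1 h

end Strip

/-! ## Analytic extensions of orbits -/

/-- Conjugating both the variable and the value is conjugate linear twice, hence preserves complex
differentiability. -/
theorem Complexified.hasDerivAt_conj_comp {E : Type u} [NormedAddCommGroup E]
    [InnerProductSpace ℝ E] {F : ℂ → Complexified E} {F' : Complexified E} {z : ℂ}
    (h : HasDerivAt F F' (starRingEnd ℂ z)) :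
    HasDerivAt (fun w => (F (starRingEnd ℂ w)).conj) F'.conj z := by
  rw [hasDerivAt_iff_isLittleO] at h ⊢
  have h1 := h.comp_tendsto (Complex.continuous_conj.tendsto z)
  rw [← Asymptotics.isLittleO_norm_norm] at h1 ⊢
  refine h1.congr (fun w => ?_) (fun w => ?_)
  · rw [Function.comp_apply, ← Complexified.norm_conj, Complexified.conj_sub,
      Complexified.conj_sub, Complexified.conj_smul, map_sub, Complex.conj_conj, Complex.conj_conj]
  · rw [Function.comp_apply, ← map_sub, RCLike.norm_conj]

namespace OrthogonalRep

open Complex Set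

variable {E : Type u} [NormedAddCommGroup E] [InnerProductSpace ℝ E] [CompleteSpace E]
variable (V : OrthogonalRep E)

/-- `F` extends the orbit of `x` to the strip `0 ≤ Im z ≤ s`; thus `F z = A^{iz} x`. -/
structure IsOrbitExtension (s : ℝ) (x : Complexified E) (F : ℂ → Complexified E) : Prop where
  continuousOn : ContinuousOn F {z : ℂ | 0 ≤ z.im ∧ z.im ≤ s}
  differentiableOn : DifferentiableOn ℂ F {z : ℂ | 0 < z.im ∧ z.im < s}
  apply_real : ∀ t : ℝ, F t = V.complexU t x

theorem pow_neg_iff {s : ℝ} (hs : 0 < s) {x y : Complexified E} :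
    V.Pow (-s) x y ↔ ∃ F, V.IsOrbitExtension s x F ∧ F (I * s) = y := by
  have h1 : {z : ℂ | z.im ∈ Set.uIcc 0 (-(-s))} = {z : ℂ | 0 ≤ z.im ∧ z.im ≤ s} := by
    rw [neg_neg, Set.uIcc_of_le hs.le]; rfl
  have h2 : {z : ℂ | z.im ∈ Set.uIoo 0 (-(-s))} = {z : ℂ | 0 < z.im ∧ z.im < s} := by
    rw [neg_neg, Set.uIoo_of_le hs.le]; rfl
  have h3 : -I * ((-s : ℝ) : ℂ) = I * s := by push_cast; ring
  unfold OrthogonalRep.Pow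
  rw [h1, h2, h3]
  constructor
  · rintro ⟨F, a, b, c, d⟩
    exact ⟨F, ⟨a, b, c⟩, d⟩
  · rintro ⟨F, ⟨a, b, c⟩, d⟩
    exact ⟨F, a, b, c, d⟩

namespace IsOrbitExtension

variable {V} {s : ℝ} {x y : Complexified E} {F G : ℂ → Complexified E}

theorem apply_zero (h : V.IsOrbitExtension s x F) : F 0 = x := by
  simpa using h.apply_real 0

theorem eqOn (hs : 0 < s) (h : V.IsOrbitExtension s x F) (h' : V.IsOrbitExtension s x G) {z : ℂ}
    (h0 : 0 ≤ z.im) (h1 : z.im ≤ s) : F z = G z :=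
  eqOn_strip hs h.continuousOn h'.continuousOn h.differentiableOn h'.differentiableOn
    (fun t => by rw [h.apply_real, h'.apply_real]) z h0 h1

theorem add (h : V.IsOrbitExtension s x F) (h' : V.IsOrbitExtension s y G) :
    V.IsOrbitExtension s (x + y) (fun z => F z + G z) where
  continuousOn := h.continuousOn.add h'.continuousOn
  differentiableOn := h.differentiableOn.add h'.differentiableOn
  apply_real t := by
    rw [h.apply_real, h'.apply_real]
    exact ((V.unitary t).map_add x y).symm

theorem smul (c : ℂ) (h : V.IsOrbitExtension s x F) :
    V.IsOrbitExtension s (c • x) (fun z => c • F z) where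
  continuousOn := h.continuousOn.const_smul c
  differentiableOn := h.differentiableOn.const_smul c
  apply_real t := by
    rw [h.apply_real]
    exact ((V.unitary t).map_smul c x).symm

theorem sub (h : V.IsOrbitExtension s x F) (h' : V.IsOrbitExtension s y G) :
    V.IsOrbitExtension s (x - y) (fun z => F z - G z) := by
  have := h.add (h'.smul (-1))
  simpa [sub_eq_add_neg] using this

theorem mono {r : ℝ} (h : V.IsOrbitExtension s x F) (hr : r ≤ s) : V.IsOrbitExtension r x F where
  continuousOn := h.continuousOn.mono fun _ hz => ⟨hz.1, hz.2.trans hr⟩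
  differentiableOn := h.differentiableOn.mono fun _ hz => ⟨hz.1, hz.2.trans_le hr⟩
  apply_real := h.apply_real

theorem unitary_comp (h : V.IsOrbitExtension s x F) (t : ℝ) :
    V.IsOrbitExtension s (V.complexU t x) (fun z => V.complexU t (F z)) where
  continuousOn := (V.unitary t).continuous.comp_continuousOn h.continuousOn
  differentiableOn :=
    ((V.unitary t).toContinuousLinearMap.differentiable).comp_differentiableOn h.differentiableOn
  apply_real r := by
    rw [h.apply_real, ← complexU_add, ← complexU_add, add_comm]

/-- Both sides extend the orbit of U_t x, and extensions are unique. In particular ‖F z‖ depends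
only on Im z. -/
theorem add_real (hs : 0 < s) (h : V.IsOrbitExtension s x F) (t : ℝ) {z : ℂ}
    (h0 : 0 ≤ z.im) (h1 : z.im ≤ s) : F (z + t) = V.complexU t (F z) := by
  have hG : V.IsOrbitExtension s (V.complexU t x) (fun z => F (z + t)) :=
    { continuousOn := h.continuousOn.comp (by fun_prop) fun z hz => by simpa using hz
      differentiableOn := h.differentiableOn.comp (by fun_prop) fun z hz => by simpa using hz
      apply_real := fun r => by
        have : (r : ℂ) + t = ((r + t : ℝ) : ℂ) := by push_cast; ring
        rw [this, h.apply_real, complexU_add] }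
  exact hG.eqOn hs (h.unitary_comp t) h0 h1

theorem norm_apply (hs : 0 < s) (h : V.IsOrbitExtension s x F) {z : ℂ}
    (h0 : 0 ≤ z.im) (h1 : z.im ≤ s) : ‖F z‖ = ‖F (I * z.im)‖ := by
  have hz : z = I * z.im + z.re := by
    rw [mul_comm, add_comm]; exact (re_add_im z).symm
  conv_lhs => rw [hz]
  rw [h.add_real hs _ (by simpa using h0) (by simpa using h1), norm_complexU]

theorem exists_bound (hs : 0 < s) (h : V.IsOrbitExtension s x F) :
    ∃ C, ∀ z : ℂ, 0 ≤ z.im → z.im ≤ s → ‖F z‖ ≤ C := by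
  have hc : ContinuousOn (fun r : ℝ => F (I * r)) (Icc 0 s) :=
    h.continuousOn.comp (by fun_prop) fun r hr => by simpa using hr
  obtain ⟨C, hC⟩ := isCompact_Icc.exists_bound_of_continuousOn hc
  refine ⟨C, fun z h0 h1 => ?_⟩
  rw [h.norm_apply hs h0 h1]
  exact hC _ ⟨h0, h1⟩

theorem norm_le (hs : 0 < s) (h : V.IsOrbitExtension s x F) {z : ℂ}
    (h0 : 0 ≤ z.im) (h1 : z.im ≤ s) : ‖F z‖ ≤ max ‖x‖ ‖F (I * s)‖ := by
  obtain ⟨C, hC⟩ := h.exists_bound hs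
  have hset : im ⁻¹' Ioo 0 s = {z : ℂ | 0 < z.im ∧ z.im < s} := rfl
  refine PhragmenLindelof.horizontal_strip (a := 0) (b := s) (f := F) ?_ ?_ ?_ ?_ h0 h1
  · refine ⟨h.differentiableOn, ?_⟩
    rw [hset, closure_strip hs]
    exact h.continuousOn
  -- The growth condition is trivial, with both constants 0, since `F` is bounded on the strip.
  · refine ⟨0, by have := Real.pi_pos; positivity, 0, ?_⟩
    simp only [zero_mul, Real.exp_zero]
    refine Asymptotics.IsBigO.of_bound C ?_
    refine Filter.eventually_inf_principal.2 (Filter.Eventually.of_forall fun z hz => ?_)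
    simpa using hC z hz.1.le hz.2.le
  · intro z hz
    rw [h.norm_apply hs hz.ge (by rw [hz]; exact hs.le), hz]
    simp [h.apply_zero]
  · intro z hz
    rw [h.norm_apply hs (by rw [hz]; exact hs.le) hz.le, hz]
    exact le_max_right _ _

/-- Symmetry of A^{-s}. The functions ⟨y, F(z)⟩ and conj ⟨x, G(-z̄)⟩ are holomorphic and agree on
the real line by unitarity; z ↦ -z̄ fixes is. -/
theorem inner_symm (hs : 0 < s) (hF : V.IsOrbitExtension s x F) (hG : V.IsOrbitExtension s y G) :
    ⟪y, F (I * s)⟫_ℂ = ⟪G (I * s), x⟫_ℂ := by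
  have hm : ∀ z : ℂ, (-(starRingEnd ℂ z)).im = z.im := fun z => by simp
  have key := eqOn_strip hs (F := fun z => ⟪y, F z⟫_ℂ)
    (F' := fun z => starRingEnd ℂ ⟪x, G (-(starRingEnd ℂ z))⟫_ℂ)
    ((innerSL ℂ y).continuous.comp_continuousOn hF.continuousOn)
    (by
      refine Complex.continuous_conj.comp_continuousOn
        ((innerSL ℂ x).continuous.comp_continuousOn (hG.continuousOn.comp ?_ ?_))
      · exact Complex.continuous_conj.neg.continuousOn
      · intro z hz
        simpa using hz)
    ((innerSL ℂ y).differentiable.comp_differentiableOn hF.differentiableOn)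
    (by
      intro z hz
      have hd : DifferentiableAt ℂ (fun w => ⟪x, G (-w)⟫_ℂ) (starRingEnd ℂ z) := by
        have h1 : DifferentiableAt ℂ G (-(starRingEnd ℂ z)) :=
          hG.differentiableOn.differentiableAt ((isOpen_strip s).mem_nhds (by simpa using hz))
        have h2 : DifferentiableAt ℂ (fun w => G (-w)) (starRingEnd ℂ z) :=
          DifferentiableAt.comp (𝕜 := ℂ) (g := G) (f := fun w => -w) _ h1 (by fun_prop)
        exact (innerSL ℂ x).differentiable.differentiableAt.comp _ h2
      have hd' := hd.conj_conj
      rw [Complex.conj_conj] at hd'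
      exact hd'.differentiableWithinAt)
    (fun t => by
      have : -(starRingEnd ℂ (t : ℂ)) = ((-t : ℝ) : ℂ) := by simp
      rw [this, hF.apply_real, hG.apply_real, inner_conj_symm, inner_complexU_left, neg_neg])
    (I * s) (by simpa using hs.le) (by simp)
  have h2 : -(starRingEnd ℂ (I * s)) = I * s := by simp
  simp only [h2, inner_conj_symm] at key
  exact key

theorem shift (hs : 0 < s) (h : V.IsOrbitExtension s x F) {r : ℝ} (hr : 0 ≤ r) (hrs : r ≤ s) :
    V.IsOrbitExtension (s - r) (F (I * r)) (fun z => F (z + I * r)) where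
  continuousOn := h.continuousOn.comp (by fun_prop) fun z hz => by
    simp only [mem_ofPred_eq, add_im, mul_im, I_re, I_im, ofReal_re, ofReal_im] at hz ⊢
    constructor <;> linarith
  differentiableOn := h.differentiableOn.comp (by fun_prop) fun z hz => by
    simp only [mem_ofPred_eq, add_im, mul_im, I_re, I_im, ofReal_re, ofReal_im] at hz ⊢
    constructor <;> linarith
  apply_real t := by
    rw [add_comm, h.add_real hs t (by simpa using hr) (by simpa using hrs)]

/-- This is ⟨x, A^{-s}x⟩ = ‖A^{-s/2}x‖², from symmetry of A^{-s/2} applied to x and A^{-s/2}x. It is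
the source of positivity. -/
theorem inner_apply_self (hs : 0 < s) (h : V.IsOrbitExtension s x F) :
    ⟪x, F (I * s)⟫_ℂ = ⟪F (I * (s / 2 : ℝ)), F (I * (s / 2 : ℝ))⟫_ℂ := by
  have h1 := h.mono (r := s / 2) (by linarith)
  have h2 := (h.shift hs (r := s / 2) (by linarith) (by linarith)).mono (r := s / 2) (by linarith)
  have h3 := inner_symm (by linarith) h1 h2
  have h4 : I * ((s / 2 : ℝ) : ℂ) + I * (s / 2 : ℝ) = I * s := by push_cast; ring
  rw [h4] at h3
  rw [h3, ← inner_conj_symm, ← h3, inner_conj_symm, h3]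

/-- Since J is antilinear and commutes with U_t, reflecting the strip in its middle line exchanges
its two edges: JA^{-s} = A^sJ. -/
theorem conj (hs : 0 < s) (h : V.IsOrbitExtension s x F) :
    V.IsOrbitExtension s (F (I * s)).conj (fun z => (F (starRingEnd ℂ z + I * s)).conj) where
  continuousOn := by
    refine Complexified.continuous_conj.comp_continuousOn (h.continuousOn.comp ?_ ?_)
    · exact (Complex.continuous_conj.add continuous_const).continuousOn
    · intro z hz
      simp only [mem_ofPred_eq, add_im, mul_im, I_re, I_im, ofReal_re, ofReal_im, conj_im] at hz ⊢
      constructor <;> linarith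
  differentiableOn := by
    intro z hz
    have h1 : DifferentiableAt ℂ F (starRingEnd ℂ z + I * s) :=
      h.differentiableOn.differentiableAt ((isOpen_strip s).mem_nhds (by
        simp only [mem_ofPred_eq, add_im, mul_im, I_re, I_im, ofReal_re, ofReal_im, conj_im] at hz ⊢
        constructor <;> linarith))
    have h2 : DifferentiableAt ℂ (fun w => F (w + I * s)) (starRingEnd ℂ z) :=
      DifferentiableAt.comp (𝕜 := ℂ) (g := F) (f := fun w => w + I * s) _ h1 (by fun_prop)
    exact (Complexified.hasDerivAt_conj_comp h2.hasDerivAt).differentiableAt.differentiableWithinAt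
  apply_real t := by
    rw [conj_ofReal, add_comm, h.add_real hs t (by simpa using hs.le) (by simp), conj_complexU]

end IsOrbitExtension

variable {V}

theorem Pow.unique {s : ℝ} (hs : 0 < s) {x y z : Complexified E} (h : V.Pow (-s) x y)
    (h' : V.Pow (-s) x z) : y = z := by
  obtain ⟨F, hF, rfl⟩ := (V.pow_neg_iff hs).1 h
  obtain ⟨G, hG, rfl⟩ := (V.pow_neg_iff hs).1 h'
  exact hF.eqOn hs hG (by simpa using hs.le) (by simp)

theorem Pow.add {s : ℝ} (hs : 0 < s) {x y x' y' : Complexified E} (h : V.Pow (-s) x y)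
    (h' : V.Pow (-s) x' y') : V.Pow (-s) (x + x') (y + y') := by
  obtain ⟨F, hF, rfl⟩ := (V.pow_neg_iff hs).1 h
  obtain ⟨G, hG, rfl⟩ := (V.pow_neg_iff hs).1 h'
  exact (V.pow_neg_iff hs).2 ⟨_, hF.add hG, rfl⟩

theorem Pow.sub {s : ℝ} (hs : 0 < s) {x y x' y' : Complexified E} (h : V.Pow (-s) x y)
    (h' : V.Pow (-s) x' y') : V.Pow (-s) (x - x') (y - y') := by
  obtain ⟨F, hF, rfl⟩ := (V.pow_neg_iff hs).1 h
  obtain ⟨G, hG, rfl⟩ := (V.pow_neg_iff hs).1 h'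
  exact (V.pow_neg_iff hs).2 ⟨_, hF.sub hG, rfl⟩

theorem Pow.smul {s : ℝ} (hs : 0 < s) {x y : Complexified E} (c : ℂ) (h : V.Pow (-s) x y) :
    V.Pow (-s) (c • x) (c • y) := by
  obtain ⟨F, hF, rfl⟩ := (V.pow_neg_iff hs).1 h
  exact (V.pow_neg_iff hs).2 ⟨_, hF.smul c, rfl⟩

theorem Pow.inner_symm {s : ℝ} (hs : 0 < s) {x y x' y' : Complexified E} (h : V.Pow (-s) x y)
    (h' : V.Pow (-s) x' y') : ⟪x', y⟫_ℂ = ⟪y', x⟫_ℂ := by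
  obtain ⟨F, hF, rfl⟩ := (V.pow_neg_iff hs).1 h
  obtain ⟨G, hG, rfl⟩ := (V.pow_neg_iff hs).1 h'
  exact hF.inner_symm hs hG

/-- If `x` is in the domain of `A^{-s}`, then it is in the domain of `A^{-s/2}`, and
`A^{-s} x = A^{-s/2} A^{-s/2} x`. -/
theorem Pow.exists_half {s : ℝ} (hs : 0 < s) {x y : Complexified E} (h : V.Pow (-s) x y) :
    ∃ w, V.Pow (-(s / 2)) x w ∧ V.Pow (-(s / 2)) w y ∧ ⟪x, y⟫_ℂ = ⟪w, w⟫_ℂ := by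
  obtain ⟨F, hF, rfl⟩ := (V.pow_neg_iff hs).1 h
  refine ⟨F (I * (s / 2 : ℝ)), ?_, ?_, hF.inner_apply_self hs⟩
  · exact (V.pow_neg_iff (half_pos hs)).2 ⟨F, hF.mono (by linarith), rfl⟩
  · refine (V.pow_neg_iff (half_pos hs)).2
      ⟨_, (hF.shift hs (half_pos hs).le (by linarith)).mono (by linarith), ?_⟩
    congr 1
    push_cast
    ring

theorem Pow.inner_nonneg {s : ℝ} (hs : 0 < s) {x y : Complexified E} (h : V.Pow (-s) x y) :
    0 ≤ ⟪x, y⟫_ℂ := by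
  obtain ⟨w, -, -, h⟩ := h.exists_half hs
  rw [h, Complex.nonneg_iff]
  exact ⟨@inner_self_nonneg ℂ _ _ _ _ w, (@inner_self_im ℂ _ _ _ _ w).symm⟩

theorem Pow.conj {s : ℝ} (hs : 0 < s) {x y : Complexified E} (h : V.Pow (-s) x y) :
    V.Pow (-s) y.conj x.conj := by
  obtain ⟨F, hF, rfl⟩ := (V.pow_neg_iff hs).1 h
  refine (V.pow_neg_iff hs).2 ⟨_, hF.conj hs, ?_⟩
  simp [hF.apply_zero]

/-- Closedness of A^{-s}. An extension is bounded by its values on the two edges, so the extensions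
are uniformly Cauchy and their uniform limit is again an extension. -/
theorem pow_of_tendsto {s : ℝ} (hs : 0 < s) {x y : ℕ → Complexified E} {a b : Complexified E}
    (h : ∀ n, V.Pow (-s) (x n) (y n)) (hx : Filter.Tendsto x Filter.atTop (nhds a))
    (hy : Filter.Tendsto y Filter.atTop (nhds b)) : V.Pow (-s) a b := by
  choose F hF hFy using fun n => (V.pow_neg_iff hs).1 (h n)
  set S : Set ℂ := {z : ℂ | 0 ≤ z.im ∧ z.im ≤ s} with hS
  have hcau : UniformCauchySeqOn F Filter.atTop S := by
    rw [Metric.uniformCauchySeqOn_iff]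
    intro ε hε
    obtain ⟨N, hN⟩ := Metric.cauchySeq_iff.1 hx.cauchySeq ε hε
    obtain ⟨N', hN'⟩ := Metric.cauchySeq_iff.1 hy.cauchySeq ε hε
    refine ⟨max N N', fun m hm n hn z hz => ?_⟩
    have hb := ((hF m).sub (hF n)).norm_le hs hz.1 hz.2
    rw [dist_eq_norm]
    refine hb.trans_lt (max_lt ?_ ?_)
    · rw [← dist_eq_norm]
      exact hN _ ((le_max_left _ _).trans hm) _ ((le_max_left _ _).trans hn)
    · rw [hFy, hFy, ← dist_eq_norm]
      exact hN' _ ((le_max_right _ _).trans hm) _ ((le_max_right _ _).trans hn)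
  have hpt : ∀ z ∈ S, ∃ w, Filter.Tendsto (fun n => F n z) Filter.atTop (nhds w) := fun z hz =>
    cauchySeq_tendsto_of_complete (hcau.cauchySeq hz)
  classical
  set G : ℂ → Complexified E := fun z => if hz : z ∈ S then (hpt z hz).choose else 0 with hG
  have hGt : ∀ z ∈ S, Filter.Tendsto (fun n => F n z) Filter.atTop (nhds (G z)) := fun z hz => by
    simp only [hG, dif_pos hz]
    exact (hpt z hz).choose_spec
  have hun : TendstoUniformlyOn F G Filter.atTop S :=
    hcau.tendstoUniformlyOn_of_tendsto fun z hz => hGt z hz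
  refine (V.pow_neg_iff hs).2 ⟨G, ⟨?_, ?_, fun t => ?_⟩, ?_⟩
  · exact hun.continuousOn (Filter.Frequently.of_forall fun n => (hF n).continuousOn)
  · exact (hun.mono fun z hz => ⟨hz.1.le, hz.2.le⟩).tendstoLocallyUniformlyOn.differentiableOn
      (Filter.Eventually.of_forall fun n => (hF n).differentiableOn) (isOpen_strip s)
  · refine tendsto_nhds_unique (hGt t (by simp [hS, hs.le])) ?_
    simp only [fun n => (hF n).apply_real t]
    exact ((V.unitary t).continuous.tendsto a).comp hx
  · refine tendsto_nhds_unique (hGt (I * s) (by simp [hS, hs.le])) ?_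
    simpa only [hFy] using hy

end OrthogonalRep

/-! ## Entire vectors -/

namespace OrthogonalRep

open Complex Set MeasureTheory Filter

theorem integrable_gaussian_exp_abs (c : ℝ) :
    Integrable fun t : ℝ => Real.exp (-t ^ 2 + c * |t|) := by
  have h : ∀ d : ℝ, Integrable fun t : ℝ => Real.exp (-t ^ 2 + d * t) := by
    intro d
    have h1 := (integrable_exp_neg_mul_sq one_pos).comp_sub_right (d / 2)
    refine (h1.const_mul (Real.exp (d ^ 2 / 4))).congr (Eventually.of_forall fun t => ?_)
    simp only [← Real.exp_add]
    congr 1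
    ring
  refine ((h c).add (h (-c))).mono' (by fun_prop) (Eventually.of_forall fun t => ?_)
  rw [Real.norm_eq_abs, Real.abs_exp, Pi.add_apply]
  rcases le_total 0 t with ht | ht
  · rw [abs_of_nonneg ht]
    linarith [Real.exp_pos (-t ^ 2 + -c * t)]
  · rw [abs_of_nonpos ht, mul_neg, ← neg_mul]
    linarith [Real.exp_pos (-t ^ 2 + c * t)]

theorem norm_cexp_neg_sub_sq_le (t : ℝ) (z : ℂ) {R : ℝ} (hz : ‖z‖ ≤ R) :
    ‖cexp (-(t - z) ^ 2)‖ ≤ Real.exp (R ^ 2) * Real.exp (-t ^ 2 + 2 * R * |t|) := by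
  rw [norm_exp, ← Real.exp_add]
  refine Real.exp_le_exp.2 ?_
  have h1 : (-(t - z : ℂ) ^ 2).re = -t ^ 2 + 2 * t * z.re + (-(z ^ 2)).re := by
    simp [pow_two]
    ring
  have h2 : (-(z ^ 2)).re ≤ R ^ 2 := by
    refine (re_le_norm _).trans ?_
    rw [norm_neg, norm_pow]
    gcongr
  have h3 : t * z.re ≤ |t| * R := by
    refine (le_abs_self _).trans ?_
    rw [abs_mul]
    gcongr
    exact (abs_re_le_norm z).trans hz
  rw [h1]
  nlinarith

variable {E : Type u} [NormedAddCommGroup E] [InnerProductSpace ℝ E] [CompleteSpace E]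
variable (V : OrthogonalRep E)

/-- The Gaussian mean `∫ exp (-(t - z)²) U_{δ t} x dt`. -/
noncomputable def gaussianMean (δ : ℝ) (x : Complexified E) (z : ℂ) : Complexified E :=
  ∫ t : ℝ, cexp (-(t - z) ^ 2) • V.complexU (δ * t) x

theorem continuous_complexU_mul (δ : ℝ) (x : Complexified E) :
    Continuous fun t : ℝ => V.complexU (δ * t) x :=
  (V.continuous_complexU_apply x).comp (by fun_prop)

theorem differentiable_gaussianMean (δ : ℝ) (x : Complexified E) :
    Differentiable ℂ (V.gaussianMean δ x) := by
  intro z₀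
  have hU := V.continuous_complexU_mul δ x
  set R : ℝ := ‖z₀‖ + 1 with hR
  have hR0 : 0 < R := by positivity
  have hball : ∀ z ∈ Metric.ball z₀ 1, ‖z‖ ≤ R := by
    intro z hz
    have := norm_le_norm_add_norm_sub' z z₀
    rw [Metric.mem_ball, dist_eq_norm] at hz
    linarith
  have hcont : ∀ z : ℂ, Continuous fun t : ℝ => cexp (-(t - z) ^ 2) • V.complexU (δ * t) x :=
    fun z => (by fun_prop : Continuous fun t : ℝ => cexp (-(t - z) ^ 2)).smul hU
  have key := hasDerivAt_integral_of_dominated_loc_of_deriv_le (𝕜 := ℂ) (μ := volume)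
    (F := fun z (t : ℝ) => cexp (-(t - z) ^ 2) • V.complexU (δ * t) x)
    (F' := fun z (t : ℝ) => (cexp (-(t - z) ^ 2) * (2 * (t - z))) • V.complexU (δ * t) x)
    -- The factor 2(t - z) of the derivative is absorbed by ‖t - z‖ ≤ R + |t| ≤ exp(R) exp(|t|),
    -- hence the extra `Real.exp R` and the `+ 1`.
    (bound := fun t : ℝ => 2 * Real.exp (R ^ 2) * Real.exp R * ‖x‖ *
      Real.exp (-t ^ 2 + (2 * R + 1) * |t|))
    (s := Metric.ball z₀ 1) (x₀ := z₀) (Metric.ball_mem_nhds z₀ one_pos)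
    (Eventually.of_forall fun z => (hcont z).aestronglyMeasurable) ?_ ?_ ?_ ?_ ?_
  · exact key.2.differentiableAt
  · refine ((integrable_gaussian_exp_abs (2 * R)).const_mul (Real.exp (R ^ 2) * ‖x‖)).mono'
      (hcont z₀).aestronglyMeasurable (Eventually.of_forall fun t => ?_)
    rw [norm_smul, norm_complexU]
    have := norm_cexp_neg_sub_sq_le t z₀ (R := R) (by simp [hR])
    calc _ ≤ (Real.exp (R ^ 2) * Real.exp (-t ^ 2 + 2 * R * |t|)) * ‖x‖ := by gcongr
      _ = _ := by ring
  · exact ((by fun_prop : Continuous fun t : ℝ =>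
      cexp (-(t - z₀) ^ 2) * (2 * (t - z₀))).smul hU).aestronglyMeasurable
  · refine Eventually.of_forall fun t z hz => ?_
    rw [norm_smul, norm_complexU, norm_mul]
    have h1 := norm_cexp_neg_sub_sq_le t z (hball z hz)
    have h2 : ‖(2 * (t - z) : ℂ)‖ ≤ 2 * (Real.exp R * Real.exp |t|) := by
      rw [norm_mul, ← Real.exp_add]
      have h3 : ‖(t - z : ℂ)‖ ≤ R + |t| := by
        refine (norm_sub_le _ _).trans ?_
        have := hball z hz
        simp only [norm_real, Real.norm_eq_abs]
        linarith
      have h4 := Real.add_one_le_exp (R + |t|)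
      simp only [Complex.norm_ofNat]
      linarith
    calc _ ≤ (Real.exp (R ^ 2) * Real.exp (-t ^ 2 + 2 * R * |t|)) *
          (2 * (Real.exp R * Real.exp |t|)) * ‖x‖ := by gcongr
      _ = 2 * Real.exp (R ^ 2) * Real.exp R * ‖x‖ *
          (Real.exp (-t ^ 2 + 2 * R * |t|) * Real.exp |t|) := by ring
      _ = _ := by
          rw [← Real.exp_add]
          congr 2
          ring
  · exact (integrable_gaussian_exp_abs _).const_mul _
  · refine Eventually.of_forall fun t z _ => ?_
    have h1 : HasDerivAt (fun z : ℂ => -(t - z) ^ 2) (2 * (t - z)) z := by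
      have h2 := (((hasDerivAt_id z).const_sub (t : ℂ)).pow 2).neg
      refine h2.congr_deriv ?_
      simp
    exact h1.cexp.smul_const _

/-- Translating the integration variable by `r` moves the shift of the Gaussian onto the orbit. -/
theorem gaussianMean_ofReal (δ : ℝ) (x : Complexified E) (r : ℝ) :
    V.gaussianMean δ x r = V.complexU (δ * r) (V.gaussianMean δ x 0) := by
  unfold gaussianMean
  rw [← unitary_apply, ← LinearIsometry.coe_toContinuousLinearMap]
  have h0 : Integrable fun t : ℝ => cexp (-(t - 0) ^ 2) • V.complexU (δ * t) x := by
    refine ((integrable_gaussian_exp_abs 0).const_mul ‖x‖).mono'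
      ((by fun_prop : Continuous fun t : ℝ => cexp (-(t - 0) ^ 2)).smul
        (V.continuous_complexU_mul δ x)).aestronglyMeasurable (Eventually.of_forall fun t => ?_)
    rw [norm_smul, norm_complexU]
    have := norm_cexp_neg_sub_sq_le t 0 (R := 0) (by simp)
    simp only [zero_pow two_ne_zero, Real.exp_zero, one_mul, mul_zero] at this
    rw [mul_comm]
    gcongr
  rw [← ContinuousLinearMap.integral_comp_comm _ h0,
    ← integral_add_right_eq_self (fun t : ℝ => cexp (-(t - r) ^ 2) • V.complexU (δ * t) x) r]
  refine integral_congr_ae (Eventually.of_forall fun t => ?_)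
  simp only [LinearIsometry.coe_toContinuousLinearMap, map_smul, unitary_apply, ← complexU_add]
  congr 2
  · push_cast
    ring
  · ring

theorem tendsto_gaussianMean (x : Complexified E) :
    Tendsto (fun n : ℕ => V.gaussianMean (1 / ((n : ℝ) + 1)) x 0) atTop
      (nhds ((Real.sqrt Real.pi : ℂ) • x)) := by
  have hlim : (Real.sqrt Real.pi : ℂ) • x = ∫ t : ℝ, cexp (-(t - 0) ^ 2) • x := by
    rw [integral_smul_const]
    congr 1
    have := integral_gaussian 1
    rw [div_one] at this
    rw [← this, ← integral_complex_ofReal]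
    refine integral_congr_ae (Eventually.of_forall fun t => ?_)
    simp
  rw [hlim]
  refine tendsto_integral_of_dominated_convergence
    (fun t => Real.exp (-t ^ 2 + 0 * |t|) * ‖x‖) (fun n => ?_) ?_ (fun n => ?_) ?_
  · exact ((by fun_prop : Continuous fun t : ℝ => cexp (-(t - 0) ^ 2)).smul
      (V.continuous_complexU_mul _ x)).aestronglyMeasurable
  · exact (integrable_gaussian_exp_abs 0).mul_const _
  · refine Eventually.of_forall fun t => ?_
    rw [norm_smul, norm_complexU]
    have := norm_cexp_neg_sub_sq_le t 0 (R := 0) (by simp)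
    simp only [zero_pow two_ne_zero, Real.exp_zero, one_mul, mul_zero] at this
    gcongr
  · refine Eventually.of_forall fun t => Tendsto.const_smul ?_ _
    have h1 : Tendsto (fun n : ℕ => 1 / ((n : ℝ) + 1) * t) atTop (nhds 0) := by
      simpa using tendsto_one_div_add_atTop_nhds_zero_nat.mul_const t
    have h2 := ((V.continuous_complexU_apply x).tendsto 0).comp h1
    rwa [complexU_zero] at h2

/-- Entire vectors are dense. -/
theorem exists_entire_near (x : Complexified E) {ε : ℝ} (hε : 0 < ε) :
    ∃ F : ℂ → Complexified E, Differentiable ℂ F ∧ (∀ t : ℝ, F t = V.complexU t (F 0)) ∧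
      ‖F 0 - x‖ < ε := by
  have hπ : (Real.sqrt Real.pi : ℂ) ≠ 0 := by
    simpa using (Real.sqrt_pos.2 Real.pi_pos).ne'
  have h := (V.tendsto_gaussianMean x).const_smul (Real.sqrt Real.pi : ℂ)⁻¹
  rw [smul_smul, inv_mul_cancel₀ hπ, one_smul] at h
  obtain ⟨n, hn⟩ := (Metric.tendsto_atTop.1 h ε hε)
  have hδ : (1 / ((n : ℝ) + 1)) ≠ 0 := by positivity
  set δ : ℝ := 1 / ((n : ℝ) + 1)
  -- The factor 1/√π normalizes the Gaussian; rescaling z by 1/δ undoes the time scale δ, so that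
  -- the orbit has unit speed.
  refine ⟨fun z => (Real.sqrt Real.pi : ℂ)⁻¹ • V.gaussianMean δ x (z * (δ⁻¹ : ℝ)), ?_, ?_, ?_⟩
  · have hd : Differentiable ℂ fun z : ℂ => V.gaussianMean δ x (z * (δ⁻¹ : ℝ)) :=
      (V.differentiable_gaussianMean δ x).comp
        (by fun_prop : Differentiable ℂ fun z : ℂ => z * (δ⁻¹ : ℝ))
    exact hd.const_smul (Real.sqrt Real.pi : ℂ)⁻¹
  · intro t
    simp only [zero_mul]
    have h1 : (t : ℂ) * (δ⁻¹ : ℝ) = ((t * δ⁻¹ : ℝ) : ℂ) := by push_cast; ring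
    rw [h1, gaussianMean_ofReal, ← unitary_apply, ← unitary_apply, map_smul]
    congr 3
    field_simp
  · have := hn n le_rfl
    rw [dist_eq_norm] at this
    simpa only [zero_mul] using this

end OrthogonalRep

/-! ## The resolvent of the analytic generator and the deformation operator -/

theorem ContinuousLinearMap.IsPositive.exists_isPositive_sq_eq_two_smul {H : Type u}
    [NormedAddCommGroup H] [InnerProductSpace ℂ H] [CompleteSpace H] {R : H →L[ℂ] H}
    (hR : R.IsPositive) : ∃ B : H →L[ℂ] H, B.IsPositive ∧ ∀ ζ, B (B ζ) = (2 : ℂ) • R ζ := by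
  have h0 : 0 ≤ R + R := by
    rw [ContinuousLinearMap.nonneg_iff_isPositive]
    exact hR.add hR
  refine ⟨CFC.sqrt (R + R), (ContinuousLinearMap.nonneg_iff_isPositive _).1 (CFC.sqrt_nonneg _),
    fun ζ => ?_⟩
  rw [← mul_apply_eq_comp, CFC.sqrt_mul_sqrt_self (R + R) h0, add_apply, two_smul]

namespace OrthogonalRep

open Complex Set Filter

variable {E : Type u} [NormedAddCommGroup E] [InnerProductSpace ℝ E] [CompleteSpace E]
variable (V : OrthogonalRep E)

/-- The range of `1 + A⁻¹`. -/
def rangeOneAddInv : Submodule ℂ (Complexified E) where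
  carrier := {ζ | ∃ x y, V.Pow (-1) x y ∧ y + x = ζ}
  add_mem' := by
    rintro _ _ ⟨x, y, h, rfl⟩ ⟨x', y', h', rfl⟩
    exact ⟨x + x', y + y', h.add one_pos h', by abel⟩
  zero_mem' := by
    refine ⟨0, 0, (V.pow_neg_iff one_pos).2 ⟨fun _ => 0, ⟨continuousOn_const,
      differentiableOn_const _, fun t => ?_⟩, rfl⟩, by simp⟩
    exact ((V.unitary t).map_zero).symm
  smul_mem' := by
    rintro c _ ⟨x, y, h, rfl⟩
    exact ⟨c • x, c • y, h.smul one_pos c, by rw [smul_add]⟩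

variable {V}

/-- By positivity of A^{-s}, Re ⟨x, (A^{-s} + 1)x⟩ ≥ ‖x‖². Thus 1 + A⁻¹ is bounded below, which
yields its closed range and injectivity. -/
theorem Pow.norm_le_norm_add {s : ℝ} (hs : 0 < s) {x y : Complexified E} (h : V.Pow (-s) x y) :
    ‖x‖ ≤ ‖y + x‖ := by
  have h1 := (Complex.nonneg_iff.1 (h.inner_nonneg hs)).1
  have h2 : ‖x‖ ^ 2 ≤ ‖x‖ * ‖y + x‖ := by
    have h3 : (⟪x, y + x⟫_ℂ).re = (⟪x, y⟫_ℂ).re + ‖x‖ ^ 2 := by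
      rw [inner_add_right, add_re]
      congr 1
      exact inner_self_eq_norm_sq (𝕜 := ℂ) x
    have h4 := (re_le_norm _).trans (norm_inner_le_norm (𝕜 := ℂ) x (y + x))
    linarith
  rcases (norm_nonneg x).eq_or_lt with h0 | h0
  · rw [← h0]
    exact norm_nonneg _
  · rw [pow_two] at h2
    exact le_of_mul_le_mul_left h2 h0

variable (V)

theorem isClosed_rangeOneAddInv : IsClosed (V.rangeOneAddInv : Set (Complexified E)) := by
  refine IsSeqClosed.isClosed fun ζ a hζ ha => ?_
  choose x y h hxy using hζ
  have hx : CauchySeq x := by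
    rw [Metric.cauchySeq_iff]
    intro ε hε
    obtain ⟨N, hN⟩ := Metric.cauchySeq_iff.1 ha.cauchySeq ε hε
    refine ⟨N, fun m hm n hn => ?_⟩
    have h1 := ((h m).sub one_pos (h n)).norm_le_norm_add one_pos
    have h2 := hN m hm n hn
    rw [dist_eq_norm] at h2 ⊢
    refine h1.trans_lt ?_
    rwa [← hxy, ← hxy, add_sub_add_comm] at h2
  obtain ⟨x', hx'⟩ := cauchySeq_tendsto_of_complete hx
  have hy : Tendsto y atTop (nhds (a - x')) := by
    refine (ha.sub hx').congr fun n => ?_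
    rw [← hxy]
    abel
  exact ⟨x', a - x', pow_of_tendsto one_pos h hx' hy, by abel⟩

/-- For an entire orbit, orthogonality to (1 + A⁻¹)F(t) means f(z + i) = -f(z) with f = ⟨u, F⟩. So
|f| is periodic, f is bounded, and Liouville makes it a constant equal to its own negative. -/
theorem inner_entire_eq_zero {u : Complexified E} (hu : ∀ ζ ∈ V.rangeOneAddInv, ⟪u, ζ⟫_ℂ = 0)
    {F : ℂ → Complexified E} (hF : Differentiable ℂ F) (hFU : ∀ t : ℝ, F t = V.complexU t (F 0)) :
    ⟪u, F 0⟫_ℂ = 0 := by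
  set f : ℂ → ℂ := fun z => ⟪u, F z⟫_ℂ with hf
  have hfd : Differentiable ℂ f := (innerSL ℂ u).differentiable.comp hF
  have hreal : ∀ t : ℝ, f (t + I) + f t = 0 := by
    intro t
    have hp : V.Pow (-1) (F t) (F (t + I)) := by
      refine (V.pow_neg_iff one_pos).2 ⟨fun w => F (w + t), ⟨?_, ?_, fun r => ?_⟩, ?_⟩
      · exact (hF.continuous.comp (by fun_prop)).continuousOn
      · exact (hF.comp (by fun_prop : Differentiable ℂ fun w : ℂ => w + t)).differentiableOn
      · have : (r : ℂ) + t = ((r + t : ℝ) : ℂ) := by push_cast; ring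
        rw [this, hFU, hFU t, complexU_add]
      · simp [add_comm]
    rw [hf, ← inner_add_right]
    exact hu _ ⟨_, _, hp, rfl⟩
  have hgd : Differentiable ℂ fun z => f (z + I) + f z :=
    (hfd.comp (by fun_prop : Differentiable ℂ fun w : ℂ => w + I)).add hfd
  have hanti : ∀ z, f (z + I) + f z = 0 := by
    have h1 := eqOn_zero_strip one_pos hgd.continuous.continuousOn hgd.differentiableOn hreal
    have hev : (fun z => f (z + I) + f z) =ᶠ[nhds (I * (1 / 2 : ℝ))] 0 := by
      refine eventually_of_mem ((isOpen_strip 1).mem_nhds ?_) fun z hz => h1 z hz.1.le hz.2.le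
      simp only [mem_ofPred_eq, mul_im, I_re, I_im, ofReal_re, ofReal_im]
      norm_num
    have han : AnalyticOnNhd ℂ (fun z => f (z + I) + f z) univ :=
      hgd.differentiableOn.analyticOnNhd isOpen_univ
    intro z
    exact han.eqOn_zero_of_preconnected_of_eventuallyEq_zero isPreconnected_univ (mem_univ _) hev
      (mem_univ z)
  have hper : Function.Periodic (fun z => ‖f z‖) I := fun z => by
    simp only [eq_neg_of_add_eq_zero_left (hanti z), norm_neg]
  have hext : V.IsOrbitExtension 1 (F 0) F :=
    ⟨hF.continuous.continuousOn, hF.differentiableOn, hFU⟩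
  obtain ⟨C, hC⟩ := hext.exists_bound one_pos
  have hbd : Bornology.IsBounded (range f) := by
    rw [isBounded_iff_forall_norm_le]
    -- Subtracting ⌊Im z⌋ i brings z into the unit strip, where `F` is bounded by `C`, without
    -- changing ‖f z‖.
    refine ⟨‖u‖ * C, ?_⟩
    rintro _ ⟨z, rfl⟩
    have h1 : ‖f (z - ⌊z.im⌋ • I)‖ = ‖f z‖ := hper.sub_zsmul_eq (x := z) ⌊z.im⌋
    rw [← h1]
    refine (norm_inner_le_norm _ _).trans ?_
    have him : (z - ⌊z.im⌋ • I).im = Int.fract z.im := by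
      simp
    gcongr
    exact hC _ (by rw [him]; exact Int.fract_nonneg _) (by rw [him]; exact (Int.fract_lt_one _).le)
  have hconst := hfd.apply_eq_apply_of_bounded hbd (0 + I) 0
  have h0 := hanti 0
  rw [hconst, ← two_mul] at h0
  exact (mul_eq_zero.1 h0).resolve_left two_ne_zero

/-- The range is closed. A vector orthogonal to it is orthogonal to the initial vectors of entire
orbits, and these are dense. -/
theorem rangeOneAddInv_eq_top : V.rangeOneAddInv = ⊤ := by
  have hcl : V.rangeOneAddInv.topologicalClosure = V.rangeOneAddInv :=
    V.isClosed_rangeOneAddInv.submodule_topologicalClosure_eq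
  rw [← hcl, Submodule.topologicalClosure_eq_top_iff, Submodule.eq_bot_iff]
  intro u hu
  have hu' : ∀ ζ ∈ V.rangeOneAddInv, ⟪u, ζ⟫_ℂ = 0 :=
    fun ζ hζ => (Submodule.mem_orthogonal' _ _).1 hu ζ hζ
  by_contra hne
  obtain ⟨F, hF, hFU, hlt⟩ := V.exists_entire_near u (norm_pos_iff.2 hne)
  have h0 := V.inner_entire_eq_zero hu' hF hFU
  have h1 : ⟪u, F 0 - u⟫_ℂ = -⟪u, u⟫_ℂ := by rw [inner_sub_right, h0, zero_sub]
  have h2 := norm_inner_le_norm (𝕜 := ℂ) u (F 0 - u)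
  rw [h1, norm_neg, inner_self_eq_norm_sq_to_K, norm_pow, RCLike.norm_ofReal,
    abs_of_nonneg (norm_nonneg u), pow_two] at h2
  have h3 := le_of_mul_le_mul_left h2 (norm_pos_iff.2 hne)
  linarith

theorem exists_pow_add_eq (ζ : Complexified E) : ∃ x, V.Pow (-1) x (ζ - x) := by
  have : ζ ∈ V.rangeOneAddInv := V.rangeOneAddInv_eq_top ▸ Submodule.mem_top
  obtain ⟨x, y, h, rfl⟩ := this
  exact ⟨x, by simpa using h⟩

theorem pow_add_unique {ζ x x' : Complexified E} (h : V.Pow (-1) x (ζ - x))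
    (h' : V.Pow (-1) x' (ζ - x')) : x = x' := by
  have h1 := (h.sub one_pos h').norm_le_norm_add one_pos
  have h2 : ζ - x - (ζ - x') + (x - x') = 0 := by abel
  rw [h2, norm_zero] at h1
  exact sub_eq_zero.1 (norm_le_zero_iff.1 h1)

/-- The resolvent `(1 + A⁻¹)⁻¹`. -/
noncomputable def resolventInv : Complexified E →L[ℂ] Complexified E :=
  LinearMap.mkContinuous
    { toFun := fun ζ => (V.exists_pow_add_eq ζ).choose
      map_add' := fun ζ ζ' => by
        refine V.pow_add_unique (V.exists_pow_add_eq (ζ + ζ')).choose_spec ?_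
        rw [add_sub_add_comm]
        exact (V.exists_pow_add_eq ζ).choose_spec.add one_pos (V.exists_pow_add_eq ζ').choose_spec
      map_smul' := fun c ζ => by
        refine V.pow_add_unique (V.exists_pow_add_eq (c • ζ)).choose_spec ?_
        rw [RingHom.id_apply, ← smul_sub]
        exact (V.exists_pow_add_eq ζ).choose_spec.smul one_pos c }
    1 fun ζ => by
      have h := (V.exists_pow_add_eq ζ).choose_spec.norm_le_norm_add one_pos
      rw [sub_add_cancel] at h
      rw [one_mul]
      exact h

theorem pow_resolventInv (ζ : Complexified E) :
    V.Pow (-1) (V.resolventInv ζ) (ζ - V.resolventInv ζ) :=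
  (V.exists_pow_add_eq ζ).choose_spec

/-- With R the resolvent and x = Rζ, one has ζ - x = A⁻¹x, so positivity of A⁻¹ gives ⟨Rζ, ζ⟩ ≥
‖Rζ‖²; symmetry is inherited in the same way. -/
theorem isPositive_resolventInv : V.resolventInv.IsPositive := by
  rw [ContinuousLinearMap.isPositive_def']
  constructor
  · rw [ContinuousLinearMap.isSelfAdjoint_iff_isSymmetric]
    intro ζ ζ'
    have h := (V.pow_resolventInv ζ).inner_symm one_pos (V.pow_resolventInv ζ')
    rw [inner_sub_left, inner_sub_right, sub_left_inj] at h
    have h' := congrArg (starRingEnd ℂ) h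
    rw [inner_conj_symm, inner_conj_symm] at h'
    exact h'.symm
  · intro ζ
    have h := (Complex.nonneg_iff.1 ((V.pow_resolventInv ζ).inner_nonneg one_pos)).1
    rw [inner_sub_right, sub_re] at h
    exact (@inner_self_nonneg ℂ _ _ _ _ (V.resolventInv ζ)).trans (sub_nonneg.1 h)

theorem exists_isDeformation : ∃ B, V.IsDeformation B := by
  obtain ⟨B, hB, hBB⟩ := V.isPositive_resolventInv.exists_isPositive_sq_eq_two_smul
  refine ⟨B, hB, fun ζ => ⟨(2 : ℂ) • (ζ - V.resolventInv ζ), ?_, ?_⟩⟩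
  · rw [hBB]
    exact (V.pow_resolventInv ζ).smul one_pos 2
  · rw [hBB, ← smul_add, sub_add_cancel]

theorem isDeformation_deformation : V.IsDeformation V.deformation := by
  unfold deformation
  rw [dif_pos V.exists_isDeformation]
  exact V.exists_isDeformation.choose_spec

end OrthogonalRep

/-! ## Almost commuting finite rank contractions -/

section Krylov

variable {H : Type u} [NormedAddCommGroup H] [InnerProductSpace ℂ H]

/-- The increasing sequence of subspaces generated from `L` by repeated application of `B`
and `B'`. -/
def krylov (B B' : H →L[ℂ] H) (L : Submodule ℂ H) : ℕ → Submodule ℂ H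
  | 0 => L
  | n + 1 => krylov B B' L n ⊔ (krylov B B' L n).map (B : H →ₗ[ℂ] H) ⊔
      (krylov B B' L n).map (B' : H →ₗ[ℂ] H)

variable {B B' : H →L[ℂ] H} {L : Submodule ℂ H}

instance finiteDimensional_krylov [FiniteDimensional ℂ L] (n : ℕ) :
    FiniteDimensional ℂ (krylov B B' L n) := by
  induction n with
  | zero => assumption
  | succ n ih => rw [krylov]; infer_instance

theorem krylov_le_succ (n : ℕ) : krylov B B' L n ≤ krylov B B' L (n + 1) :=
  le_sup_left.trans le_sup_left

theorem krylov_mono : Monotone (krylov B B' L) := monotone_nat_of_le_succ krylov_le_succ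

theorem apply_mem_krylov {n : ℕ} {x : H} (hx : x ∈ krylov B B' L n) :
    B x ∈ krylov B B' L (n + 1) :=
  (le_sup_right.trans le_sup_left : _ ≤ krylov B B' L (n + 1)) (Submodule.mem_map_of_mem hx)

/-- J exchanges B and B'. This is why the Krylov spaces are built with both operators although only
the commutator with B is estimated. -/
theorem conj_mem_krylov {J : H →ₗᵢ⋆[ℂ] H} (hJ : ∀ x, J (J x) = x)
    (hB : ∀ x, B' x = J (B (J x))) (hL : ∀ x ∈ L, J x ∈ L) (n : ℕ) :
    ∀ x ∈ krylov B B' L n, J x ∈ krylov B B' L n := by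
  induction n with
  | zero => exact hL
  | succ n ih =>
    intro x hx
    obtain ⟨y, hy, z, hz, rfl⟩ := Submodule.mem_sup.1 hx
    obtain ⟨y', hy', w, hw, rfl⟩ := Submodule.mem_sup.1 hy
    obtain ⟨a, ha, rfl⟩ := Submodule.mem_map.1 hw
    obtain ⟨b, hb, rfl⟩ := Submodule.mem_map.1 hz
    rw [map_add, map_add]
    refine add_mem (add_mem (krylov_le_succ n (ih _ hy')) ?_) ?_
    · refine (le_sup_right : _ ≤ krylov B B' L (n + 1)) ⟨J a, ih _ ha, ?_⟩
      simp [hB, hJ]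
    · refine (le_sup_right.trans le_sup_left : _ ≤ krylov B B' L (n + 1)) ⟨J b, ih _ hb, ?_⟩
      simp [hB, hJ]

theorem norm_sum_le_of_orthogonal {v : ℕ → H} {S : ℕ → Submodule ℂ H} (hS : Monotone S)
    (hv : ∀ n, v n ∈ S (n + 1)) (ho : ∀ n, ∀ w ∈ S n, ⟪v n, w⟫_ℂ = 0) {M : ℝ}
    (hM : ∀ n, ‖v n‖ ≤ M) (n : ℕ) : ‖∑ k ∈ Finset.range n, v k‖ ^ 2 ≤ n * M ^ 2 := by
  induction n with
  | zero => simp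
  | succ n ih =>
    have hmem : ∑ k ∈ Finset.range n, v k ∈ S n :=
      sum_mem fun k hk => hS (Finset.mem_range.1 hk) (hv k)
    rw [Finset.sum_range_succ, add_comm]
    have h1 := norm_add_sq_eq_norm_sq_add_norm_sq_of_inner_eq_zero _ _ (ho n _ hmem)
    have h2 : ‖v n‖ ^ 2 ≤ M ^ 2 := by
      have := hM n
      gcongr
    push_cast
    nlinarith

variable [CompleteSpace H]

theorem conj_starProjection {J : H →ₗᵢ⋆[ℂ] H} (hJ : ∀ x, J (J x) = x)
    (hJi : ∀ x y, ⟪J x, J y⟫_ℂ = ⟪y, x⟫_ℂ) {S : Submodule ℂ H} [S.HasOrthogonalProjection]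
    (hS : ∀ x ∈ S, J x ∈ S) (x : H) : J (S.starProjection x) = S.starProjection (J x) := by
  refine (Submodule.eq_starProjection_of_mem_of_inner_eq_zero (hS _ (Submodule.starProjection_apply_mem S x)) fun w hw => ?_).symm
  rw [← map_sub, ← hJ w, hJi]
  have := Submodule.starProjection_inner_eq_zero (K := S) x (J w) (hS w hw)
  rw [← inner_conj_symm, this, map_zero]

theorem norm_starProjection_le_one (S : Submodule ℂ H) [S.HasOrthogonalProjection] (x : H) :
    ‖S.starProjection x‖ ≤ ‖x‖ := S.norm_starProjection_apply_le x

/-- The mean of the first orthogonal projections on the subspaces of the sequence `krylov`. -/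
noncomputable def krylovMean (B B' : H →L[ℂ] H) (L : Submodule ℂ H) [FiniteDimensional ℂ L]
    (N : ℕ) : H →L[ℂ] H :=
  ((N : ℂ)⁻¹) • ∑ k ∈ Finset.range N, (krylov B B' L k).starProjection

theorem krylovMean_apply [FiniteDimensional ℂ L] (N : ℕ) (x : H) :
    krylovMean B B' L N x =
      ((N : ℂ)⁻¹) • ∑ k ∈ Finset.range N, (krylov B B' L k).starProjection x := by
  simp [krylovMean, sum_apply]

theorem norm_krylovMean_le [FiniteDimensional ℂ L] (N : ℕ) (x : H) :
    ‖krylovMean B B' L N x‖ ≤ ‖x‖ := by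
  rw [krylovMean_apply, norm_smul, norm_inv, Complex.norm_natCast]
  have h1 : ‖∑ k ∈ Finset.range N, (krylov B B' L k).starProjection x‖ ≤ N * ‖x‖ := by
    refine (norm_sum_le _ _).trans ?_
    refine (Finset.sum_le_sum fun k _ => norm_starProjection_le_one _ x).trans ?_
    simp
  rcases Nat.eq_zero_or_pos N with rfl | hN
  · simp
  · have : (0 : ℝ) < N := Nat.cast_pos.2 hN
    rw [inv_mul_le_iff₀ this]
    exact h1

theorem krylovMean_apply_of_mem [FiniteDimensional ℂ L] {N : ℕ} (hN : 0 < N) {x : H}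
    (hx : x ∈ L) : krylovMean B B' L N x = x := by
  have h1 : ∀ k, (krylov B B' L k).starProjection x = x := fun k =>
    Submodule.starProjection_eq_self_iff.2 (krylov_mono (Nat.zero_le k) hx)
  have hN' : (N : ℂ) ≠ 0 := by simpa using hN.ne'
  rw [krylovMean_apply]
  simp only [h1, Finset.sum_const, Finset.card_range]
  rw [← Nat.cast_smul_eq_nsmul ℂ, smul_smul, inv_mul_cancel₀ hN', one_smul]

theorem krylovMean_mem [FiniteDimensional ℂ L] (N : ℕ) (x : H) :
    krylovMean B B' L N x ∈ krylov B B' L N := by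
  rw [krylovMean_apply]
  exact Submodule.smul_mem _ _ (sum_mem fun k hk =>
    krylov_mono (Finset.mem_range.1 hk).le (Submodule.starProjection_apply_mem _ x))

theorem conj_krylovMean [FiniteDimensional ℂ L] {J : H →ₗᵢ⋆[ℂ] H} (hJ : ∀ x, J (J x) = x)
    (hJi : ∀ x y, ⟪J x, J y⟫_ℂ = ⟪y, x⟫_ℂ) (hB : ∀ x, B' x = J (B (J x)))
    (hL : ∀ x ∈ L, J x ∈ L) (N : ℕ) (x : H) :
    J (krylovMean B B' L N x) = krylovMean B B' L N (J x) := by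
  rw [krylovMean_apply, krylovMean_apply, map_smulₛₗ, map_sum]
  simp only [conj_starProjection hJ hJi (conj_mem_krylov hJ hB hL _)]
  simp

/-- As B maps each space into the next, [B, p_k] = (p_{k+1} - p_k)Bp_k minus its adjoint. The
increments p_{k+1} - p_k have orthogonal ranges, so N such terms add up to norm at most √N ‖B‖, and
averaging divides by N. -/
theorem norm_commutator_krylovMean [FiniteDimensional ℂ L] (hB : IsSelfAdjoint B) {N : ℕ}
    (hN : 0 < N) : ‖B * krylovMean B B' L N - krylovMean B B' L N * B‖ ≤ 2 * ‖B‖ / √N := by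
  set p : ℕ → H →L[ℂ] H := fun k => (krylov B B' L k).starProjection with hp
  have hps : ∀ k, star (p k) = p k := fun k => isSelfAdjoint_starProjection _
  have hBp : ∀ k, p (k + 1) * B * p k = B * p k := fun k => by
    ext x
    exact Submodule.starProjection_eq_self_iff.2
      (apply_mem_krylov (Submodule.starProjection_apply_mem _ x))
  have hpB : ∀ k, p k * B * p (k + 1) = p k * B := fun k => by
    have := congrArg star (hBp k)
    simpa [hps, hB.star_eq, mul_assoc] using this
  set Z : H →L[ℂ] H := ∑ k ∈ Finset.range N, (p (k + 1) - p k) * B * p k with hZ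
  have hZn : ‖Z‖ ≤ √N * ‖B‖ := by
    refine ContinuousLinearMap.opNorm_le_bound _ (by positivity) fun x => ?_
    refine (sq_le_sq₀ (norm_nonneg _) (by positivity)).1 ?_
    rw [hZ, sum_apply, mul_pow, mul_pow, Real.sq_sqrt (Nat.cast_nonneg _), mul_assoc, ← mul_pow]
    refine norm_sum_le_of_orthogonal (S := krylov B B' L) krylov_mono (fun k => ?_)
      (fun k w hw => ?_) (fun k => ?_) N
    · exact sub_mem (Submodule.starProjection_apply_mem _ _)
        (krylov_le_succ k (Submodule.starProjection_apply_mem _ _))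
    · have h1 : (p (k + 1) - p k) w = 0 := by
        rw [sub_apply, hp]
        simp only
        rw [Submodule.starProjection_eq_self_iff.2 hw,
          Submodule.starProjection_eq_self_iff.2 (krylov_le_succ k hw), sub_self]
      have h2 : star (p (k + 1) - p k) = p (k + 1) - p k := by rw [star_sub, hps, hps]
      rw [mul_assoc, mul_apply_eq_comp, ← h2, ContinuousLinearMap.star_eq_adjoint,
        ContinuousLinearMap.adjoint_inner_left, h1, inner_zero_right]
    · have h1 : ((p (k + 1) - p k) * B * p k) x =
          (B * p k) x - (krylov B B' L k).starProjection ((B * p k) x) := by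
        rw [sub_mul, sub_mul, hBp, mul_assoc]
        rfl
      rw [h1]
      have h2 : ‖(B * p k) x - (krylov B B' L k).starProjection ((B * p k) x)‖ ≤ ‖(B * p k) x‖ := by
        have := norm_starProjection_le_one (krylov B B' L k)ᗮ ((B * p k) x)
        rwa [Submodule.starProjection_orthogonal_val] at this
      exact h2.trans ((B.le_opNorm _).trans (by
        gcongr
        exact norm_starProjection_le_one _ x))
  have hcomm : B * krylovMean B B' L N - krylovMean B B' L N * B = (N : ℂ)⁻¹ • (Z - star Z) := by
    have h1 : Z - star Z = ∑ k ∈ Finset.range N, (B * p k - p k * B) := by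
      rw [hZ, star_sum, ← Finset.sum_sub_distrib]
      refine Finset.sum_congr rfl fun k _ => ?_
      rw [star_mul, star_mul, star_sub, hps, hps, hB.star_eq, sub_mul, sub_mul, hBp, mul_sub,
        mul_sub, ← mul_assoc, hpB, ← mul_assoc]
      abel
    rw [h1, Finset.sum_sub_distrib, ← Finset.mul_sum, ← Finset.sum_mul, krylovMean, smul_sub,
      mul_smul_comm, smul_mul_assoc]
  have hN' : (0 : ℝ) < N := Nat.cast_pos.2 hN
  rw [hcomm, norm_smul, norm_inv, Complex.norm_natCast, inv_mul_le_iff₀ hN']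
  refine (norm_sub_le _ _).trans ?_
  rw [norm_star]
  have h3 : (N : ℝ) * (2 * ‖B‖ / √N) = 2 * (√N * ‖B‖) := by
    have h4 : (N : ℝ) = √N * √N := (Real.mul_self_sqrt hN'.le).symm
    have h5 : √(N : ℝ) ≠ 0 := (Real.sqrt_pos.2 hN').ne'
    field_simp
    rw [Real.sq_sqrt hN'.le, mul_comm]
  rw [h3]
  linarith

end Krylov

/-! ## Finite rank approximations compatible with a conjugation -/

section Approximation

variable {H : Type u} [NormedAddCommGroup H] [InnerProductSpace ℂ H] [CompleteSpace H]

theorem denseRange_of_isSelfAdjoint {C : H →L[ℂ] H} (hC : IsSelfAdjoint C)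
    (hinj : ∀ x, C x = 0 → x = 0) : DenseRange C := by
  have h : (C.range).topologicalClosure = ⊤ := by
    rw [Submodule.topologicalClosure_eq_top_iff, Submodule.eq_bot_iff]
    intro x hx
    refine hinj x (ext_inner_right ℂ fun y => ?_)
    rw [inner_zero_left, ← hC.adjoint_eq, ContinuousLinearMap.adjoint_inner_left]
    exact (Submodule.mem_orthogonal' _ _).1 hx _ ⟨y, rfl⟩
  exact (Submodule.dense_iff_topologicalClosure_eq_top (s := C.range)).2 h

/-- The regularized inverse `(C² + ε)⁻¹`. -/
theorem exists_regularized_inverse {C : H →L[ℂ] H} (hC : IsSelfAdjoint C) {ε : ℝ} (hε : 0 < ε) :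
    ∃ G : H →L[ℂ] H, (C * C + (ε : ℂ) • 1) * G = 1 ∧ G * (C * C + (ε : ℂ) • 1) = 1 := by
  have hu : IsUnit (C * C + (ε : ℂ) • (1 : H →L[ℂ] H)) := by
    refine CStarAlgebra.isUnit_of_le ((ε : ℂ) • (1 : H →L[ℂ] H)) ?_ ⟨?_, ?_⟩
    · refine le_add_of_nonneg_left ?_
      nth_rewrite 1 [← hC.star_eq]
      exact star_mul_self_nonneg C
    · rw [ContinuousLinearMap.nonneg_iff_isPositive]
      exact ContinuousLinearMap.isPositive_one.smul_of_nonneg (by exact_mod_cast hε.le)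
    · rw [← Algebra.algebraMap_eq_smul_one]
      exact (IsUnit.mk0 (ε : ℂ) (by exact_mod_cast hε.ne')).map (algebraMap ℂ (H →L[ℂ] H))
  obtain ⟨v, hv⟩ := hu
  exact ⟨↑v⁻¹, by rw [← hv]; simp, by rw [← hv]; simp⟩

variable {C G : H →L[ℂ] H} {ε : ℝ}

/-- The vector x is the sum of C²Gx and εGx, whose inner product ε‖CGx‖² is nonnegative, so neither
summand is longer than x. -/
theorem norm_sq_regularized (hC : IsSelfAdjoint C) (hε : 0 < ε)
    (hG : (C * C + (ε : ℂ) • 1) * G = 1) (x : H) :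
    ‖C (C (G x))‖ ≤ ‖x‖ ∧ ‖(ε : ℂ) • G x‖ ≤ ‖x‖ := by
  have h1 : C (C (G x)) + (ε : ℂ) • G x = x := by
    have := congrArg (fun T : H →L[ℂ] H => T x) hG
    simpa [mul_apply_eq_comp] using this
  have h2 : 0 ≤ RCLike.re ⟪C (C (G x)), (ε : ℂ) • G x⟫_ℂ := by
    rw [inner_smul_right, ← hC.adjoint_eq, ContinuousLinearMap.adjoint_inner_left, hC.adjoint_eq]
    have h3 : RCLike.re ((ε : ℂ) * ⟪C (G x), C (G x)⟫_ℂ) =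
        ε * RCLike.re ⟪C (G x), C (G x)⟫_ℂ := by simp
    rw [h3]
    exact mul_nonneg hε.le inner_self_nonneg
  have h4 := norm_add_sq (𝕜 := ℂ) (C (C (G x))) ((ε : ℂ) • G x)
  rw [h1] at h4
  constructor
  · refine (sq_le_sq₀ (norm_nonneg _) (norm_nonneg _)).1 ?_
    nlinarith [sq_nonneg ‖(ε : ℂ) • G x‖]
  · refine (sq_le_sq₀ (norm_nonneg _) (norm_nonneg _)).1 ?_
    nlinarith [sq_nonneg ‖C (C (G x))‖]

/-- `C² (C² + ε)⁻¹ x → x` as `ε → 0`, when `C` is injective. -/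
theorem eventually_regularized_near (hC : IsSelfAdjoint C) (hinj : ∀ x, C x = 0 → x = 0) (x : H)
    {δ : ℝ} (hδ : 0 < δ) : ∀ᶠ ε : ℝ in nhdsWithin (0 : ℝ) (Set.Ioi 0), ∀ G : H →L[ℂ] H,
      (C * C + (ε : ℂ) • 1) * G = 1 → G * (C * C + (ε : ℂ) • 1) = 1 →
      ‖C (C (G x)) - x‖ < δ := by
  have hCC : IsSelfAdjoint (C * C) := by
    rw [IsSelfAdjoint, star_mul, hC.star_eq]
  have hd : DenseRange (C * C) :=
    denseRange_of_isSelfAdjoint hCC fun x hx => hinj x (hinj _ hx)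
  -- The error on x is -εGx. On vectors C²z it is at most ε‖z‖ because G commutes with C², and such
  -- vectors are dense.
  obtain ⟨z, hz⟩ := hd.exists_dist_lt x (half_pos hδ)
  have hev : ∀ᶠ ε : ℝ in nhdsWithin (0 : ℝ) (Set.Ioi 0), ε * ‖z‖ < δ / 2 := by
    have h1 : Filter.Tendsto (fun ε : ℝ => ε * ‖z‖) (nhds 0) (nhds (0 * ‖z‖)) :=
      (continuous_id.mul continuous_const).tendsto 0
    rw [zero_mul] at h1
    exact ((tendsto_order.1 h1).2 _ (half_pos hδ)).filter_mono nhdsWithin_le_nhds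
  filter_upwards [hev, self_mem_nhdsWithin] with ε h1 hε G hG hG'
  have hε : 0 < ε := hε
  have h2 : ∀ y, C (C (G y)) - y = -((ε : ℂ) • G y) := fun y => by
    have := congrArg (fun T : H →L[ℂ] H => T y) hG
    simp only [mul_apply_eq_comp, add_apply, smul_apply, one_apply_eq_self] at this
    rw [eq_neg_iff_add_eq_zero]
    nth_rewrite 2 [← this]
    abel
  have h3 : G (C (C z)) = C (C (G z)) := by
    have h4 : Commute (C * C + (ε : ℂ) • 1) G := hG.trans hG'.symm
    have h5 : Commute (C * C) G := by
      have h6 := h4.sub_left ((Commute.one_left G).smul_left (ε : ℂ))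
      simpa using h6
    exact congrArg (fun T : H →L[ℂ] H => T z) h5.eq.symm
  rw [h2, norm_neg]
  have h7 : (ε : ℂ) • G x = (ε : ℂ) • G (x - (C * C) z) + (ε : ℂ) • C (C (G z)) := by
    rw [map_sub, mul_apply_eq_comp, h3, ← smul_add, sub_add_cancel]
  rw [h7]
  refine (norm_add_le _ _).trans_lt ?_
  have h8 := (norm_sq_regularized hC hε hG (x - (C * C) z)).2
  have h9 := (norm_sq_regularized hC hε hG z).1
  rw [dist_eq_norm] at hz
  have h10 : ‖(ε : ℂ) • C (C (G z))‖ ≤ ε * ‖z‖ := by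
    rw [norm_smul, Complex.norm_real, Real.norm_of_nonneg hε.le]
    gcongr
  linarith

/-- With C = BB', the choice D = C(C² + ε)⁻¹ makes BDB' = C²(C² + ε)⁻¹ a contraction close to 1. A
Krylov mean P cuts D down to finite rank; moving P past B costs only a small commutator, which is
absorbed by rescaling. -/
theorem exists_finiteRank_sandwich {J : H →ₗᵢ⋆[ℂ] H} (hJ : ∀ x, J (J x) = x)
    (hJi : ∀ x y, ⟪J x, J y⟫_ℂ = ⟪y, x⟫_ℂ) {B B' : H →L[ℂ] H} (hB : IsSelfAdjoint B)
    (hB' : ∀ x, B' x = J (B (J x))) (hcomm : Commute B B') (hinj : ∀ x, B x = 0 → x = 0)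
    (s : Finset H) {δ : ℝ} (hδ : 0 < δ) :
    ∃ Q : H →L[ℂ] H, FiniteDimensional ℂ Q.range ∧ (∀ x, J (Q x) = Q (J x)) ∧
      ‖B * Q * B'‖ ≤ 1 ∧ ∀ x ∈ s, ‖(B * Q * B') x - x‖ < δ := by
  have hB's : IsSelfAdjoint B' := by
    rw [ContinuousLinearMap.isSelfAdjoint_iff_isSymmetric]
    intro x y
    simp only [ContinuousLinearMap.coe_coe, hB']
    have h1 : ∀ x y : H, ⟪J x, y⟫_ℂ = ⟪J y, x⟫_ℂ := fun x y => by rw [← hJi, hJ]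
    rw [h1, ← hB.adjoint_eq, ContinuousLinearMap.adjoint_inner_right, hB.adjoint_eq, ← hJi, hJ]
  set C := B * B' with hCdef
  have hC : IsSelfAdjoint C := by
    rw [IsSelfAdjoint, hCdef, star_mul, hB.star_eq, hB's.star_eq, hcomm.eq]
  have hCinj : ∀ x, C x = 0 → x = 0 := fun x hx => by
    have h1 : B' x = 0 := hinj _ hx
    rw [hB'] at h1
    have h2 := hinj _ ((map_eq_zero_iff J J.injective).1 h1)
    exact (map_eq_zero_iff J J.injective).1 h2
  have hCJ : ∀ x, J (C x) = C (J x) := fun x => by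
    nth_rewrite 1 [hCdef, hcomm.eq]
    simp [hCdef, mul_apply_eq_comp, hB', hJ]
  have hCB' : Commute C B' := hcomm.mul_left (Commute.refl B')
  have hev : ∀ᶠ ε : ℝ in nhdsWithin (0 : ℝ) (Set.Ioi 0), ∀ x ∈ s, ∀ G : H →L[ℂ] H,
      (C * C + (ε : ℂ) • 1) * G = 1 → G * (C * C + (ε : ℂ) • 1) = 1 →
      ‖C (C (G x)) - x‖ < δ / 2 :=
    (Filter.eventually_all_finset s).2 fun x _ =>
      eventually_regularized_near hC hCinj x (half_pos hδ)
  obtain ⟨ε, hεs, hε⟩ := (hev.and self_mem_nhdsWithin).exists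
  have hε : 0 < ε := hε
  obtain ⟨G, hG, hG'⟩ := exists_regularized_inverse hC hε
  have hGcomm : ∀ T : H →L[ℂ] H, Commute C T → Commute G T := by
    intro T hT
    have h1 : Commute (C * C + (ε : ℂ) • 1) T :=
      (hT.mul_left hT).add_left ((Commute.one_left T).smul_left _)
    have h2 : G * ((C * C + (ε : ℂ) • 1) * T) * G = G * (T * (C * C + (ε : ℂ) • 1)) * G := by
      rw [h1.eq]
    rw [← mul_assoc, hG', one_mul, mul_assoc, mul_assoc, hG, mul_one] at h2
    exact h2.symm
  have hGJ : ∀ x, J (G x) = G (J x) := by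
    intro x
    have h1 : (C * C + (ε : ℂ) • 1) (J (G x)) = J x := by
      have h2 := congrArg (fun T : H →L[ℂ] H => J (T x)) hG
      simp only [mul_apply_eq_comp, add_apply, smul_apply, one_apply_eq_self, map_add,
        map_smulₛₗ, hCJ, Complex.conj_ofReal] at h2
      simpa [mul_apply_eq_comp] using h2
    rw [← h1, ← mul_apply_eq_comp, hG', one_apply_eq_self]
  set D := C * G with hD
  have hDJ : ∀ x, J (D x) = D (J x) := fun x => by
    change J (C (G x)) = C (G (J x))
    rw [hCJ, hGJ]
  have hBDB : B * (D * B') = C * C * G := by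
    rw [hD, mul_assoc C, (hGcomm B' hCB').eq, ← mul_assoc C, hCB'.eq, mul_assoc B']
    exact (mul_assoc B B' (C * G)).symm.trans (mul_assoc C C G).symm
  have hBDBn : ‖B * (D * B')‖ ≤ 1 := by
    refine ContinuousLinearMap.opNorm_le_bound _ zero_le_one fun x => ?_
    rw [hBDB, one_mul]
    exact (norm_sq_regularized hC hε hG x).1
  -- The Krylov sequence starts from the vectors DB'x with x in `s`, which P then fixes, and from
  -- their J-images, so that P commutes with J.
  set L : Submodule ℂ H := Submodule.span ℂ
    (((fun x => (D * B') x) '' (s : Set H)) ∪ ((fun x => J ((D * B') x)) '' (s : Set H))) with hL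
  have hLfin : FiniteDimensional ℂ L :=
    FiniteDimensional.span_of_finite ℂ ((s.finite_toSet.image _).union (s.finite_toSet.image _))
  have hLJ : ∀ x ∈ L, J x ∈ L := by
    intro x hx
    induction hx using Submodule.span_induction with
    | mem y hy =>
      rcases hy with ⟨z, hz, rfl⟩ | ⟨z, hz, rfl⟩
      · exact Submodule.subset_span (Or.inr ⟨z, hz, rfl⟩)
      · refine Submodule.subset_span (Or.inl ⟨z, hz, ?_⟩)
        simp only [hJ]
    | zero => rw [map_zero]; exact zero_mem _
    | add a b _ _ ha hb => rw [map_add]; exact add_mem ha hb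
    | smul c a _ ha => rw [map_smulₛₗ]; exact Submodule.smul_mem _ _ ha
  -- `R` bounds the norms of all vectors of `s`, so that κR controls the error of the rescaling
  -- uniformly.
  set R : ℝ := 1 + ∑ x ∈ s, ‖x‖ with hR
  have hR0 : 0 < R := by positivity
  have hlim : Filter.Tendsto (fun N : ℕ => 2 * ‖B‖ / √(N : ℝ) * ‖D * B'‖ * R) Filter.atTop
      (nhds 0) := by
    have h1 : Filter.Tendsto (fun N : ℕ => √(N : ℝ)) Filter.atTop Filter.atTop :=
      Real.tendsto_sqrt_atTop.comp tendsto_natCast_atTop_atTop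
    simpa using ((h1.const_div_atTop (2 * ‖B‖)).mul_const ‖D * B'‖).mul_const R
  obtain ⟨N, hN1, hN⟩ := (((tendsto_order.1 hlim).2 _ (half_pos (half_pos hδ))).and
    (Filter.eventually_gt_atTop 0)).exists
  set P := krylovMean B B' L N with hP
  set κ : ℝ := ‖B * P - P * B‖ * ‖D * B'‖ with hκ
  have hκ0 : 0 ≤ κ := by positivity
  have hκR : κ * R < δ / 2 / 2 := by
    refine lt_of_le_of_lt ?_ hN1
    rw [hκ]
    gcongr
    exact norm_commutator_krylovMean hB hN
  have hPn : ‖P‖ ≤ 1 := ContinuousLinearMap.opNorm_le_bound _ zero_le_one fun x => by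
    rw [one_mul]
    exact norm_krylovMean_le N x
  have hTn : ‖B * (P * D) * B'‖ ≤ 1 + κ := by
    have h1 : B * (P * D) * B' = P * (B * (D * B')) + (B * P - P * B) * (D * B') := by
      noncomm_ring
    rw [h1]
    refine (norm_add_le _ _).trans (add_le_add ?_ (norm_mul_le _ _))
    refine (norm_mul_le _ _).trans ?_
    calc _ ≤ (1 : ℝ) * 1 := by gcongr
      _ = 1 := one_mul 1
  have hc : 0 < 1 + κ := by positivity
  -- Dividing by 1 + κ restores the contraction bound exactly.
  refine ⟨(((1 + κ)⁻¹ : ℝ) : ℂ) • (P * D), ?_, ?_, ?_, ?_⟩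
  · have hle : ((((1 + κ)⁻¹ : ℝ) : ℂ) • (P * D)).range ≤ krylov B B' L N := by
      rintro _ ⟨x, rfl⟩
      exact Submodule.smul_mem _ _ (krylovMean_mem N (D x))
    exact Submodule.finiteDimensional_of_le hle
  · intro x
    simp only [smul_apply, mul_apply_eq_comp, map_smulₛₗ, Complex.conj_ofReal]
    rw [hP, conj_krylovMean hJ hJi hB' hLJ, hDJ]
  · rw [mul_smul_comm, smul_mul_assoc, norm_smul, Complex.norm_real,
      Real.norm_of_nonneg (by positivity), inv_mul_le_iff₀ hc, mul_one]
    exact hTn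
  · intro x hx
    have h1 : (B * (P * D) * B') x = C (C (G x)) := by
      have h2 : P ((D * B') x) = (D * B') x :=
        krylovMean_apply_of_mem hN (Submodule.subset_span (Or.inl ⟨x, hx, rfl⟩))
      have h3 := congrArg (fun T : H →L[ℂ] H => T x) hBDB
      simp only [mul_apply_eq_comp] at h2 h3 ⊢
      rw [h2, h3]
    have h4 : (B * (((1 + κ)⁻¹ : ℝ) : ℂ) • (P * D) * B') x =
        (((1 + κ)⁻¹ : ℝ) : ℂ) • C (C (G x)) := by
      rw [mul_smul_comm, smul_mul_assoc, smul_apply, h1]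
    rw [h4]
    have h5 := hεs x hx G hG hG'
    have h6 : (((1 + κ)⁻¹ : ℝ) : ℂ) • C (C (G x)) - x =
        (((1 + κ)⁻¹ - 1 : ℝ) : ℂ) • C (C (G x)) + (C (C (G x)) - x) := by
      push_cast
      module
    rw [h6]
    refine (norm_add_le _ _).trans_lt ?_
    have h7 : ‖(((1 + κ)⁻¹ - 1 : ℝ) : ℂ) • C (C (G x))‖ ≤ κ * R := by
      rw [norm_smul, Complex.norm_real, Real.norm_eq_abs]
      have h8 : |(1 + κ)⁻¹ - 1| ≤ κ := by
        have : (1 + κ)⁻¹ - 1 = -(κ / (1 + κ)) := by field_simp; ring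
        rw [this, abs_neg, abs_of_nonneg (by positivity)]
        exact div_le_self hκ0 (by linarith)
      have h9 : ‖C (C (G x))‖ ≤ R := by
        refine (norm_sq_regularized hC hε hG x).1.trans ?_
        have := Finset.single_le_sum (f := fun x : H => ‖x‖) (fun y _ => norm_nonneg y) hx
        linarith
      gcongr
    linarith

end Approximation

/-! ## Modular relations between the deformation and its conjugate -/

section Sqrt

variable {H : Type u} [NormedAddCommGroup H] [InnerProductSpace ℂ H] [CompleteSpace H]

theorem ContinuousLinearMap.IsPositive.commute_of_commute_mul_self {B T : H →L[ℂ] H}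
    (hB : B.IsPositive) (h : Commute (B * B) T) : Commute B T := by
  have h0 : 0 ≤ B := (ContinuousLinearMap.nonneg_iff_isPositive B).2 hB
  rw [← CFC.sqrt_mul_self B h0]
  exact h.cfcₙ_nnreal _

/-- Equal norms give equal quadratic forms for S² and T², hence S² = T² by polarization, and
positive square roots are unique. -/
theorem ContinuousLinearMap.IsPositive.eq_of_norm_eq {S T : H →L[ℂ] H} (hS : S.IsPositive)
    (hT : T.IsPositive) (h : ∀ x, ‖S x‖ = ‖T x‖) : S = T := by
  have hS0 : 0 ≤ S := (ContinuousLinearMap.nonneg_iff_isPositive S).2 hS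
  have hT0 : 0 ≤ T := (ContinuousLinearMap.nonneg_iff_isPositive T).2 hT
  have key : ∀ {R : H →L[ℂ] H}, R.IsPositive → ∀ x, ⟪(R * R) x, x⟫_ℂ = ((‖R x‖ ^ 2 : ℝ) : ℂ) := by
    intro R hR x
    rw [mul_apply_eq_comp]
    nth_rewrite 1 [← hR.isSelfAdjoint.adjoint_eq]
    rw [ContinuousLinearMap.adjoint_inner_left, inner_self_eq_norm_sq_to_K]
    simp
  have h2 : S * S = T * T := by
    have : ((S * S : H →L[ℂ] H) : H →ₗ[ℂ] H) = ((T * T : H →L[ℂ] H) : H →ₗ[ℂ] H) := by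
      rw [← ext_inner_map]
      intro x
      exact (key hS x).trans (by rw [h x]; exact (key hT x).symm)
    exact ContinuousLinearMap.coe_injective this
  rw [← CFC.sqrt_mul_self S hS0, ← CFC.sqrt_mul_self T hT0, h2]

end Sqrt

namespace OrthogonalRep

open Complexified

variable {E : Type u} [NormedAddCommGroup E] [InnerProductSpace ℝ E] [CompleteSpace E]
variable (V : OrthogonalRep E)

theorem isPositive_deformation : V.deformation.IsPositive := V.isDeformation_deformation.1

/-- The operator `J B J = (2 / (A + 1))^{1/2}`. -/
noncomputable def deformationConj : Complexified E →L[ℂ] Complexified E :=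
  (conjL (E := E)).toContinuousLinearMap.comp
    (V.deformation.comp (conjL (E := E)).toContinuousLinearMap)

theorem deformationConj_apply (x : Complexified E) :
    V.deformationConj x = (V.deformation x.conj).conj := rfl

theorem conj_deformation (x : Complexified E) :
    (V.deformation x).conj = V.deformationConj x.conj := by
  rw [deformationConj_apply, conj_conj]

theorem conj_deformationConj (x : Complexified E) :
    (V.deformationConj x).conj = V.deformation x.conj := by
  rw [deformationConj_apply, conj_conj]

theorem isPositive_deformationConj : V.deformationConj.IsPositive := by
  rw [ContinuousLinearMap.isPositive_iff_complex]
  intro x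
  have h := (ContinuousLinearMap.isPositive_iff_complex _).1 V.isPositive_deformation x.conj
  have h2 : ⟪V.deformationConj x, x⟫_ℂ = ⟪x.conj, V.deformation x.conj⟫_ℂ := by
    rw [deformationConj_apply, inner_conj_left]
  have h3 : ⟪x.conj, V.deformation x.conj⟫_ℂ = ⟪V.deformation x.conj, x.conj⟫_ℂ := by
    rw [← inner_conj_symm]
    exact Complex.conj_eq_iff_real.2 ⟨_, h.1.symm⟩
  rw [h2, h3]
  exact h

theorem inner_deformation_left (x y : Complexified E) :
    ⟪V.deformation x, y⟫_ℂ = ⟪x, V.deformation y⟫_ℂ :=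
  V.isPositive_deformation.inner_left_eq_inner_right x y

theorem inner_deformationConj_left (x y : Complexified E) :
    ⟪V.deformationConj x, y⟫_ℂ = ⟪x, V.deformationConj y⟫_ℂ :=
  V.isPositive_deformationConj.inner_left_eq_inner_right x y

theorem pow_deformation_sq (ζ : Complexified E) :
    V.Pow (-1) (V.deformation (V.deformation ζ))
      ((2 : ℂ) • ζ - V.deformation (V.deformation ζ)) := by
  obtain ⟨η, h, h'⟩ := V.isDeformation_deformation.2 ζ
  rwa [← h', add_sub_cancel_right]

/-- This is 2/(A + 1) = 2 - 2/(A⁻¹ + 1): conjugation exchanges x and A⁻¹x in the resolvent equation,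
whose solution is unique. -/
theorem deformation_sq_conj (ζ : Complexified E) :
    V.deformation (V.deformation ζ.conj) =
      (2 : ℂ) • ζ.conj - (V.deformation (V.deformation ζ)).conj := by
  have h1 := (V.pow_deformation_sq ζ).conj one_pos
  have h2 : ((2 : ℂ) • ζ - V.deformation (V.deformation ζ)).conj =
      (2 : ℂ) • ζ.conj - (V.deformation (V.deformation ζ)).conj := by
    rw [conj_sub, conj_smul, Complex.conj_ofNat]
  rw [h2] at h1
  refine V.pow_add_unique (ζ := (2 : ℂ) • ζ.conj) (V.pow_deformation_sq _) ?_
  rwa [sub_sub_cancel]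

theorem deformationConj_sq (ζ : Complexified E) :
    V.deformationConj (V.deformationConj ζ) =
      (2 : ℂ) • ζ - V.deformation (V.deformation ζ) := by
  rw [deformationConj_apply, deformationConj_apply, conj_conj, deformation_sq_conj, conj_sub,
    conj_smul, conj_conj, conj_conj, Complex.conj_ofNat]

/-- B² = 2 - B'² commutes with B', and B is the positive square root of B². -/
theorem commute_deformation : Commute V.deformation V.deformationConj := by
  have h1 : V.deformation * V.deformation =
      (2 : ℂ) • 1 - V.deformationConj * V.deformationConj := by
    ext1 x
    rw [sub_apply, mul_apply_eq_comp, mul_apply_eq_comp, deformationConj_sq, smul_apply,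
      one_apply_eq_self, sub_sub_cancel]
  refine V.isPositive_deformation.commute_of_commute_mul_self ?_
  rw [h1]
  exact ((Commute.one_left _).smul_left _).sub_left ((Commute.refl _).mul_left (Commute.refl _))

theorem deformation_deformationConj (x : Complexified E) :
    V.deformation (V.deformationConj x) = V.deformationConj (V.deformation x) :=
  congrArg (fun T : Complexified E →L[ℂ] Complexified E => T x) V.commute_deformation.eq

theorem eq_zero_of_deformation_eq_zero {x : Complexified E} (h : V.deformation x = 0) : x = 0 := by
  have h1 := V.pow_deformation_sq x
  rw [h, _root_.map_zero, sub_zero] at h1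
  have h2 := h1.sub one_pos h1
  rw [sub_zero, sub_self] at h2
  have h3 := Pow.unique one_pos h1 h2
  exact (smul_eq_zero.1 h3).resolve_left two_ne_zero

/-- The norm comes from ‖A^{-1/2}B²ζ‖² = ⟨B²ζ, A⁻¹B²ζ⟩ = ⟨B²ζ, B'²ζ⟩ = ‖BB'ζ‖². -/
theorem exists_pow_half_deformation_sq (ζ : Complexified E) :
    ∃ w, V.Pow (-(1 / 2)) (V.deformation (V.deformation ζ)) w ∧
      V.Pow (-(1 / 2)) w ((2 : ℂ) • ζ - V.deformation (V.deformation ζ)) ∧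
      ‖w‖ = ‖V.deformation (V.deformationConj ζ)‖ := by
  obtain ⟨w, h1, h2, h3⟩ := (V.pow_deformation_sq ζ).exists_half one_pos
  refine ⟨w, h1, h2, ?_⟩
  rw [← deformationConj_sq, ← inner_deformationConj_left, ← deformation_deformationConj,
    ← deformation_deformationConj, inner_deformation_left] at h3
  have h4 := congrArg Complex.re h3
  have h5 : ∀ x : Complexified E, (⟪x, x⟫_ℂ).re = ‖x‖ ^ 2 := fun x =>
    inner_self_eq_norm_sq (𝕜 := ℂ) x
  rw [h5, h5] at h4
  exact ((sq_eq_sq₀ (norm_nonneg _) (norm_nonneg _)).1 h4).symm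

/-- The bounded operator `A^{-1/2} B²`. -/
noncomputable def halfPowDeformationSq : Complexified E →L[ℂ] Complexified E :=
  LinearMap.mkContinuous
    { toFun := fun ζ => (V.exists_pow_half_deformation_sq ζ).choose
      map_add' := fun ζ ζ' => by
        refine Pow.unique (half_pos one_pos) (V.exists_pow_half_deformation_sq (ζ + ζ')).choose_spec.1 ?_
        rw [_root_.map_add, _root_.map_add]
        exact (V.exists_pow_half_deformation_sq ζ).choose_spec.1.add (half_pos one_pos)
          (V.exists_pow_half_deformation_sq ζ').choose_spec.1
      map_smul' := fun c ζ => by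
        refine Pow.unique (half_pos one_pos) (V.exists_pow_half_deformation_sq (c • ζ)).choose_spec.1 ?_
        rw [map_smul, map_smul]
        exact (V.exists_pow_half_deformation_sq ζ).choose_spec.1.smul (half_pos one_pos) c }
    ‖V.deformation * V.deformationConj‖ fun ζ => by
      rw [LinearMap.coe_mk, AddHom.coe_mk, (V.exists_pow_half_deformation_sq ζ).choose_spec.2.2]
      exact (V.deformation * V.deformationConj).le_opNorm ζ
theorem pow_halfPowDeformationSq (ζ : Complexified E) :
    V.Pow (-(1 / 2)) (V.deformation (V.deformation ζ)) (V.halfPowDeformationSq ζ) ∧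
      V.Pow (-(1 / 2)) (V.halfPowDeformationSq ζ)
        ((2 : ℂ) • ζ - V.deformation (V.deformation ζ)) ∧
      ‖V.halfPowDeformationSq ζ‖ = ‖V.deformation (V.deformationConj ζ)‖ :=
  (V.exists_pow_half_deformation_sq ζ).choose_spec

/-- With w = A^{-1/2}B²ζ, both ⟨B²ζ, w⟩ and ⟨w, 2ζ - B²ζ⟩ are nonnegative by positivity of A^{-1/2};
their sum is 2⟨w, ζ⟩. -/
theorem isPositive_halfPowDeformationSq : V.halfPowDeformationSq.IsPositive := by
  rw [ContinuousLinearMap.isPositive_iff_complex]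
  intro ζ
  obtain ⟨h1, h2, -⟩ := V.pow_halfPowDeformationSq ζ
  have h3 := Complex.nonneg_iff.1 (h1.inner_nonneg (half_pos one_pos))
  have h4 := Complex.nonneg_iff.1 (h2.inner_nonneg (half_pos one_pos))
  have h5 := inner_conj_symm (𝕜 := ℂ) (V.halfPowDeformationSq ζ) (V.deformation (V.deformation ζ))
  rw [inner_sub_right, inner_smul_right, ← h5] at h4
  simp only [Complex.sub_re, Complex.sub_im, Complex.mul_re, Complex.mul_im, Complex.re_ofNat,
    Complex.im_ofNat, Complex.conj_re, Complex.conj_im, zero_mul, sub_zero, add_zero] at h4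
  refine ⟨Complex.ext (by simp) ?_, ?_⟩
  · simp only [RCLike.re_eq_complex_re, Complex.ofReal_im]
    linarith [h3.2, h4.2]
  · simp only [RCLike.re_eq_complex_re]
    linarith [h3.1, h4.1]

theorem isPositive_deformation_mul : (V.deformation * V.deformationConj).IsPositive :=
  (ContinuousLinearMap.nonneg_iff_isPositive _).1 (V.commute_deformation.mul_nonneg
    ((ContinuousLinearMap.nonneg_iff_isPositive _).2 V.isPositive_deformation)
    ((ContinuousLinearMap.nonneg_iff_isPositive _).2 V.isPositive_deformationConj))

theorem halfPowDeformationSq_eq : V.halfPowDeformationSq = V.deformation * V.deformationConj :=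
  V.isPositive_halfPowDeformationSq.eq_of_norm_eq V.isPositive_deformation_mul
    fun ζ => (V.pow_halfPowDeformationSq ζ).2.2

/-- `A^{-1/2} B = J B J`. -/
theorem pow_half_deformation (ζ : Complexified E) :
    V.Pow (-(1 / 2)) (V.deformation ζ) (V.deformationConj ζ) := by
  -- The identity A^{-1/2}B² = BB' = B'B gives the claim on the range of B; closedness of A^{-1/2}
  -- carries it to the closure.
  have hd : DenseRange V.deformation :=
    denseRange_of_isSelfAdjoint V.isPositive_deformation.isSelfAdjoint
      fun x hx => V.eq_zero_of_deformation_eq_zero hx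
  obtain ⟨x, hx, hlim⟩ := mem_closure_iff_seq_limit.1 (hd ζ)
  choose y hy using hx
  refine pow_of_tendsto (half_pos one_pos) (fun n => ?_)
    ((V.deformation.continuous.tendsto ζ).comp hlim)
    ((V.deformationConj.continuous.tendsto ζ).comp hlim)
  have h1 := (V.pow_halfPowDeformationSq (y n)).1
  rw [halfPowDeformationSq_eq, mul_apply_eq_comp, deformation_deformationConj, hy] at h1
  exact h1

/-- The adjoint form of A^{-1/2}B = B', from the symmetry of A^{-1/2}. -/
theorem deformation_eq_of_pow_half {x y : Complexified E} (h : V.Pow (-(1 / 2)) x y) :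
    V.deformation y = V.deformationConj x := by
  refine ext_inner_left ℂ fun z => ?_
  rw [← inner_deformation_left, ← inner_deformationConj_left]
  exact h.inner_symm (half_pos one_pos) (V.pow_half_deformation z)

/-- With y = A^{-1/2}x one computes JA^{-1/2}(BQB')Jy = JB'QB'Jy = BQBy = BQB'x. -/
theorem commutesWithInv_sandwich {Q : Complexified E →L[ℂ] Complexified E}
    (hQ : ∀ x : Complexified E, (Q x).conj = Q x.conj) :
    V.CommutesWithInv (V.deformation * Q * V.deformationConj) := by
  rintro x _ ⟨y, hy, rfl⟩
  have hy' : V.Pow (-(1 / 2)) x y := by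
    rwa [neg_div] at hy
  refine ⟨V.deformationConj (Q (V.deformationConj y.conj)), ?_, ?_⟩
  · rw [neg_div]
    exact V.pow_half_deformation _
  · simp only [mul_apply_eq_comp]
    rw [← V.deformation_eq_of_pow_half hy', deformationConj_apply, deformationConj_apply,
      conj_conj, conj_conj, hQ, conj_conj]

/-- B'B and Q commute with J, so QB'Ba is a real vector when a is. -/
theorem sandwich_mem_KR {Q : Complexified E →L[ℂ] Complexified E}
    (hQ : ∀ x : Complexified E, (Q x).conj = Q x.conj) {ξ : Complexified E} (hξ : ξ ∈ V.KR) :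
    (V.deformation * Q * V.deformationConj) ξ ∈ V.KR := by
  obtain ⟨a, rfl⟩ := hξ
  have h : (Q (V.deformationConj (V.deformation (ofReal a)))).conj =
      Q (V.deformationConj (V.deformation (ofReal a))) := by
    rw [hQ, conj_deformationConj, conj_deformation, conj_ofReal, deformation_deformationConj]
  refine ⟨(Q (V.deformationConj (V.deformation (ofReal a)))).re, ?_⟩
  change V.deformation _ = V.deformation (Q (V.deformationConj (V.deformation (ofReal a))))
  rw [← eq_ofReal_of_conj_eq h]

/-- The k-th operator moves each of the first k points of a dense sequence by less than 1/(k + 1);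
contractivity extends the convergence to all vectors. -/
theorem exists_finiteRank_commuting [TopologicalSpace.SeparableSpace E] :
    ∃ T : ℕ → (Complexified E →L[ℂ] Complexified E),
      (∀ k, FiniteDimensional ℂ (T k).range ∧ ‖T k‖ ≤ 1 ∧ V.CommutesWithInv (T k) ∧
        ∀ ξ ∈ V.KR, T k ξ ∈ V.KR) ∧
      ∀ ξ, Filter.Tendsto (fun k => T k ξ) Filter.atTop (nhds ξ) := by
  classical
  have hsep : TopologicalSpace.SeparableSpace (Complexified E) :=
    DenseRange.separableSpace (f := fun p : E × E => Complexified.mk p.1 p.2)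
      (Function.Surjective.denseRange fun x => ⟨(x.re, x.im), rfl⟩)
      (WithLp.prod_continuous_toLp 2 E E)
  set x := TopologicalSpace.denseSeq (Complexified E)
  choose Q hQ1 hQ2 hQ3 hQ4 using fun k : ℕ =>
    exists_finiteRank_sandwich (J := conjL (E := E)) (fun x => conj_conj x)
      (fun x y => inner_conj_conj x y) V.isPositive_deformation.isSelfAdjoint
      V.deformationConj_apply V.commute_deformation (fun x hx => V.eq_zero_of_deformation_eq_zero hx)
      ((Finset.range k).image x) (δ := 1 / ((k : ℝ) + 1)) (by positivity)
  refine ⟨fun k => V.deformation * Q k * V.deformationConj, fun k => ⟨?_, hQ3 k,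
    V.commutesWithInv_sandwich (hQ2 k), fun ξ hξ => V.sandwich_mem_KR (hQ2 k) hξ⟩, fun ξ => ?_⟩
  · have := hQ1 k
    have hle : (V.deformation * Q k * V.deformationConj).range ≤
        (Q k).range.map (V.deformation : Complexified E →ₗ[ℂ] Complexified E) := by
      rintro _ ⟨x, rfl⟩
      exact ⟨Q k (V.deformationConj x), ⟨_, rfl⟩, rfl⟩
    exact Submodule.finiteDimensional_of_le hle
  · rw [Metric.tendsto_atTop]
    intro ε hε
    obtain ⟨n, hn⟩ := (TopologicalSpace.denseRange_denseSeq (Complexified E)).exists_dist_lt ξ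
      (show 0 < ε / 3 by positivity)
    obtain ⟨N, hN⟩ := exists_nat_one_div_lt (show 0 < ε / 3 by positivity)
    refine ⟨max N (n + 1), fun k hk => ?_⟩
    have h1 := hQ4 k (x n) (Finset.mem_image.2 ⟨n, by
      simp only [Finset.mem_range]; exact (le_max_right _ _).trans hk, rfl⟩)
    have h2 : 1 / ((k : ℝ) + 1) ≤ 1 / ((N : ℝ) + 1) := by
      have : (N : ℝ) ≤ k := by exact_mod_cast (le_max_left _ _).trans hk
      gcongr
    set T := V.deformation * Q k * V.deformationConj
    have h3 : ‖T (ξ - x n)‖ ≤ ‖ξ - x n‖ := by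
      refine (T.le_opNorm _).trans ?_
      exact mul_le_of_le_one_left (norm_nonneg _) (hQ3 k)
    rw [dist_eq_norm] at hn ⊢
    have h4 : T ξ - ξ = T (ξ - x n) + (T (x n) - x n) - (ξ - x n) := by
      rw [map_sub]; abel
    rw [h4]
    refine (norm_sub_le _ _).trans_lt ?_
    have h5 := norm_add_le (T (ξ - x n)) (T (x n) - x n)
    have hn' : ‖ξ - x n‖ < ε / 3 := hn
    linarith

/-- The inner products of K_ℝ with B'H_ℝ are real because BB' commutes with J. This puts the right
semicircular operators of B'H_ℝ in the commutant of M. -/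
theorem inner_deformation_ofReal (a b : E) :
    ⟪V.deformationConj (ofReal b), V.deformation (ofReal a)⟫_ℂ =
      ⟪V.deformation (ofReal a), V.deformationConj (ofReal b)⟫_ℂ := by
  rw [← inner_conj_conj, conj_deformation, conj_deformationConj, conj_ofReal, conj_ofReal,
    ← inner_deformation_left, deformation_deformationConj, inner_deformationConj_left]

theorem span_KR_closure : (Submodule.span ℂ V.KR).topologicalClosure = ⊤ := by
  rw [← Submodule.dense_iff_topologicalClosure_eq_top]
  refine (denseRange_of_isSelfAdjoint V.isPositive_deformation.isSelfAdjoint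
    fun x hx => V.eq_zero_of_deformation_eq_zero hx).mono ?_
  rintro _ ⟨x, rfl⟩
  rw [eq_ofReal_add x, _root_.map_add, map_smul]
  exact add_mem (Submodule.subset_span ⟨x.re, rfl⟩)
    (Submodule.smul_mem _ _ (Submodule.subset_span ⟨x.im, rfl⟩))

theorem span_deformationConj_closure :
    (Submodule.span ℂ (Set.range fun a : E => V.deformationConj (ofReal a))).topologicalClosure
      = ⊤ := by
  rw [← Submodule.dense_iff_topologicalClosure_eq_top]
  refine (denseRange_of_isSelfAdjoint V.isPositive_deformationConj.isSelfAdjoint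
    fun x hx => ?_).mono ?_
  · rw [← conj_conj x, ← conj_deformation] at hx
    have h1 : V.deformation x.conj = 0 := by rw [← conj_conj (V.deformation _), hx, conj_zero]
    rw [← conj_conj x, V.eq_zero_of_deformation_eq_zero h1, conj_zero]
  rintro _ ⟨x, rfl⟩
  rw [eq_ofReal_add x, _root_.map_add, map_smul]
  exact add_mem (Submodule.subset_span ⟨x.re, rfl⟩)
    (Submodule.smul_mem _ _ (Submodule.subset_span ⟨x.im, rfl⟩))

end OrthogonalRep

/-! ## Second quantization on the Fock space -/

section Quantization

variable {H : Type u} [NormedAddCommGroup H] [InnerProductSpace ℂ H] [CompleteSpace H]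
variable {K : Type u} [NormedAddCommGroup K] [InnerProductSpace ℂ K] [CompleteSpace K]

/-- `Ψ` is a normal unital completely positive map with `Ψ(ℓ(h) x) = ℓ(T h) Ψ(x)` and
`Ψ(x ℓ(h)^*) = Ψ(x) ℓ(T h)^*`. -/
structure IsQuantization (ℓ : H →L[ℂ] (K →L[ℂ] K)) (Ω : K) (T : H →L[ℂ] H)
    (Ψ : (K →L[ℂ] K) →L[ℂ] (K →L[ℂ] K)) : Prop where
  continuous : @Continuous _ _ (sigmaWeak K) (sigmaWeak K) Ψ
  completelyPositive : ∀ A : StarSubalgebra ℂ (K →L[ℂ] K),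
    IsCompletelyPositive A fun x => Ψ (x : K →L[ℂ] K)
  map_one : Ψ 1 = 1
  map_mul : ∀ h x, Ψ (ℓ h * x) = ℓ (T h) * Ψ x
  map_mul_star : ∀ h x, Ψ (x * star (ℓ h)) = Ψ x * star (ℓ (T h))
  norm_le : ∀ x, ‖Ψ x‖ ≤ ‖x‖
  norm_vacuum_le : ∀ x, ‖Ψ x Ω‖ ≤ ‖x Ω‖

/-- The maps `A m` are normal, of finite rank, and map words of degree `m` in the operators `ℓ(h)`
in the same way as the second quantization of `T`, and words of other degrees to `0`. -/
structure IsDegreeFamily (ℓ : H →L[ℂ] (K →L[ℂ] K)) (T : H →L[ℂ] H)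
    (A : ℕ → ((K →L[ℂ] K) →L[ℂ] (K →L[ℂ] K))) : Prop where
  continuous : ∀ m, @Continuous _ _ (sigmaWeak K) (sigmaWeak K) (A m)
  finite : ∀ m, ∃ Q : Submodule ℂ (K →L[ℂ] K), FiniteDimensional ℂ Q ∧ ∀ x, A m x ∈ Q
  zero_one : A 0 1 = 1
  succ_one : ∀ m, A (m + 1) 1 = 0
  zero_mul : ∀ h x, A 0 (ℓ h * x) = 0
  zero_mul_star : ∀ h x, A 0 (x * star (ℓ h)) = 0
  succ_mul : ∀ m h x, A (m + 1) (ℓ h * x) = ℓ (T h) * A m x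
  succ_mul_star : ∀ m h x, A (m + 1) (x * star (ℓ h)) = A m x * star (ℓ (T h))

theorem exists_isQuantization {ℓ : H →L[ℂ] (K →L[ℂ] K)} {Ω : K} (hℓ : IsToeplitzFamily ℓ Ω)
    (T : H →L[ℂ] H) [FiniteDimensional ℂ T.range] (hT : ‖T‖ < 1) :
    ∃ Ψ, IsQuantization ℓ Ω T Ψ := by
  obtain ⟨n, e, he⟩ := exists_isRangeBasis T
  obtain ⟨w, b, -⟩ := exists_hilbertBasis ℂ K
  set W := krausOp ℓ Ω b T e (defect ℓ T e) with hW
  have h1 : dilate W W 1 = 1 := dilate_krausOp_one hℓ he hT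
  have hiso : ∀ ζ, ‖W ζ‖ = ‖ζ‖ := by
    intro ζ
    refine (sq_eq_sq₀ (norm_nonneg _) (norm_nonneg _)).1 (Complex.ofReal_injective ?_)
    rw [← inner_self_eq_ofReal_norm_sq, ← inner_self_eq_ofReal_norm_sq]
    have h2 := inner_dilate W W 1 ζ ζ
    rw [h1, _root_.map_one, one_apply_eq_self, one_apply_eq_self] at h2
    exact h2.symm
  have hWn : ‖W‖ ≤ 1 := ContinuousLinearMap.opNorm_le_bound _ zero_le_one fun ζ => by
    rw [one_mul, hiso]
  have hcomm := fun h => amplification_star_comp_krausOp (b := b) hℓ he hT (defect ℓ T e) h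
  refine ⟨dilate W W, continuous_sigmaWeak_dilate W W, isCompletelyPositive_dilate W, h1,
    fun h x => ?_, fun h x => ?_, fun x => ?_, fun x => ?_⟩
  · have h3 := dilate_amplification_left W W (star (ℓ h)) x
    rw [star_star, hW, hcomm, dilate_comp_left, star_star] at h3
    exact h3.symm
  · have h3 := dilate_amplification_right W W (star (ℓ h)) x
    rw [hW, hcomm, dilate_comp_right] at h3
    exact h3.symm
  · refine ((dilate W W).le_of_opNorm_le (norm_dilate_le W W) x).trans ?_
    refine mul_le_of_le_one_left (norm_nonneg _) ?_
    exact mul_le_one₀ hWn (ContinuousLinearMap.opNorm_nonneg W) hWn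
  · have h3 : dilate W W x Ω = ContinuousLinearMap.adjoint W (amplification K _ x (W Ω)) := rfl
    rw [h3]
    refine (ContinuousLinearMap.le_opNorm _ _).trans ?_
    rw [LinearIsometryEquiv.norm_map, hW, krausOp_vacuum hℓ he hT,
      norm_amplification_vacuumTensor hℓ]
    exact mul_le_of_le_one_left (norm_nonneg _) hWn

theorem exists_isDegreeFamily {ℓ : H →L[ℂ] (K →L[ℂ] K)} {Ω : K} (hℓ : IsToeplitzFamily ℓ Ω)
    (T : H →L[ℂ] H) [FiniteDimensional ℂ T.range] (hT : ‖T‖ < 1) :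
    ∃ A Ψ, IsDegreeFamily ℓ T A ∧ HasSum A Ψ ∧
      @Continuous _ _ (sigmaWeak K) (sigmaWeak K) Ψ := by
  obtain ⟨n, e, he⟩ := exists_isRangeBasis T
  obtain ⟨w, b, -⟩ := exists_hilbertBasis ℂ K
  exact ⟨degreePart ℓ Ω b T e, _,
    { continuous := continuous_sigmaWeak_degreePart
      finite := exists_finiteDimensional_degreePart
      zero_one := degreePart_zero_one hℓ
      succ_one := degreePart_succ_one hℓ he
      zero_mul := fun h x => degreePart_zero_mul hℓ x h
      zero_mul_star := fun h x => degreePart_zero_mul_star hℓ x h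
      succ_mul := fun m h x => degreePart_succ_mul hℓ he x h m
      succ_mul_star := fun m h x => degreePart_succ_mul_star hℓ he x h m },
    hasSum_degreePart hℓ he hT, continuous_sigmaWeak_dilate _ _⟩

theorem isToeplitzFamily_creationL : IsToeplitzFamily (creationL H) (vacuum H) where
  star_mul := star_creation_mul_creation
  star_vacuum := star_creation_vacuum
  inner_vacuum := inner_vacuum_vacuum H

namespace IsQuantization

variable {T : H →L[ℂ] H} {Ψ : (Fock H →L[ℂ] Fock H) →L[ℂ] (Fock H →L[ℂ] Fock H)}

/-- Creators are peeled off from the left and annihilators from the right; normal order makes these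
two rules sufficient. -/
theorem map_creationWord (hΨ : IsQuantization (creationL H) (vacuum H) T Ψ) (a b : List H) :
    Ψ (creationWord a b) = creationWord (a.map T) (b.map T) := by
  induction a with
  | nil =>
    induction b using List.reverseRecOn with
    | nil => rw [List.map_nil, creationWord_nil_nil]; exact hΨ.map_one
    | append_singleton b h ih =>
      have h1 := hΨ.map_mul_star h (creationWord [] b)
      rw [creationL_apply, creationL_apply, ih] at h1
      rw [List.map_append, List.map_cons, List.map_nil, creationWord_append_right,
        creationWord_append_right]
      exact h1
  | cons h a ih =>
    have h1 := hΨ.map_mul h (creationWord a b)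
    rw [creationL_apply, creationL_apply, ih] at h1
    rw [List.map_cons, creationWord_cons_left, creationWord_cons_left]
    exact h1

theorem map_wick (hΨ : IsQuantization (creationL H) (vacuum H) T Ψ) (a : List H) :
    Ψ (wick a) = wick (a.map T) := by
  induction a with
  | nil => exact hΨ.map_one
  | cons h a ih =>
    have h1 := hΨ.map_mul h (wick a)
    rw [creationL_apply, creationL_apply, ih] at h1
    rw [List.map_cons, wick, wick, ← List.map_cons, _root_.map_add, h1, hΨ.map_creationWord]
    rfl

end IsQuantization

namespace IsDegreeFamily

variable {T : H →L[ℂ] H} {A : ℕ → ((Fock H →L[ℂ] Fock H) →L[ℂ] (Fock H →L[ℂ] Fock H))}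

theorem map_creationWord_nil (hA : IsDegreeFamily (creationL H) T A) (b : List H) (m : ℕ) :
    A m (creationWord [] b) = if m = b.length then creationWord [] (b.map T) else 0 := by
  induction b using List.reverseRecOn generalizing m with
  | nil =>
    rw [List.map_nil, creationWord_nil_nil]
    cases m with
    | zero => simpa using hA.zero_one
    | succ m => simpa using hA.succ_one m
  | append_singleton b h ih =>
    rw [List.map_append, List.map_cons, List.map_nil, creationWord_append_right,
      creationWord_append_right, List.length_append, List.length_singleton]
    cases m with
    | zero =>
      rw [if_neg (by omega)]
      exact hA.zero_mul_star h _
    | succ m =>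
      have h1 := hA.succ_mul_star m h (creationWord [] b)
      rw [ih] at h1
      simp only [Nat.add_right_cancel_iff]
      refine h1.trans ?_
      rw [creationL_apply]
      split_ifs
      · rfl
      · exact MulZeroClass.zero_mul _

theorem map_wick (hA : IsDegreeFamily (creationL H) T A) (a : List H) (m : ℕ) :
    A m (wick a) = if m = a.length then wick (a.map T) else 0 := by
  induction a generalizing m with
  | nil =>
    cases m with
    | zero => simpa [wick] using hA.zero_one
    | succ m => simpa [wick] using hA.succ_one m
  | cons h a ih =>
    rw [List.map_cons, wick, wick, ← List.map_cons, _root_.map_add, hA.map_creationWord_nil]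
    cases m with
    | zero =>
      rw [if_neg (by simp), if_neg (by simp), add_zero]
      exact hA.zero_mul h _
    | succ m =>
      have h1 := hA.succ_mul m h (wick a)
      rw [ih, creationL_apply, creationL_apply] at h1
      rw [h1]
      simp only [List.length_cons, Nat.add_right_cancel_iff]
      split_ifs
      · rfl
      · rw [mul_zero, add_zero]

end IsDegreeFamily

/-- A linear map which preserves the set of Wick words in `S`, up to zero, preserves the von Neumann
algebra generated by the semicircular operators of `S`. -/
theorem mem_generatedVN_of_wick {S : Set H}
    {Φ : (Fock H →L[ℂ] Fock H) →L[ℂ] (Fock H →L[ℂ] Fock H)}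
    (hΦ : @Continuous _ _ (sigmaWeak (Fock H)) (sigmaWeak (Fock H)) Φ)
    (h : ∀ a : List H, (∀ ξ ∈ a, ξ ∈ S) →
      Φ (wick a) ∈ StarAlgebra.adjoin ℂ (semicircular '' S)) {x : Fock H →L[ℂ] Fock H}
    (hx : x ∈ (generatedVN (semicircular '' S)).toStarSubalgebra) :
    Φ x ∈ (generatedVN (semicircular '' S)).toStarSubalgebra := by
  refine mapsTo_generatedVN hΦ (fun a ha => ?_) hx
  have h1 : a ∈ Submodule.comap Φ.toLinearMap
      (StarAlgebra.adjoin ℂ (semicircular '' S)).toSubalgebra.toSubmodule := by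
    refine Submodule.span_le.2 ?_ (adjoin_semicircular_le_span ha)
    rintro _ ⟨a, ha, rfl⟩
    exact h a ha
  exact StarSubalgebra.le_topologicalClosure _ |>.trans
    (StarSubalgebra.topologicalClosure_adjoin_le_centralizer_centralizer ℂ _) h1

theorem eq_on_generatedVN_of_wick {S : Set H}
    {Φ Ψ : (Fock H →L[ℂ] Fock H) →L[ℂ] (Fock H →L[ℂ] Fock H)}
    (hΦ : @Continuous _ _ (sigmaWeak (Fock H)) (sigmaWeak (Fock H)) Φ)
    (hΨ : @Continuous _ _ (sigmaWeak (Fock H)) (sigmaWeak (Fock H)) Ψ)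
    (h : ∀ a : List H, Φ (wick a) = Ψ (wick a)) {x : Fock H →L[ℂ] Fock H}
    (hx : x ∈ (generatedVN (semicircular '' S)).toStarSubalgebra) : Φ x = Ψ x := by
  refine eqOn_generatedVN hΦ hΨ (fun a ha => ?_) hx
  have h1 : a ∈ LinearMap.eqLocus Φ.toLinearMap Ψ.toLinearMap := by
    refine Submodule.span_le.2 ?_ (adjoin_semicircular_le_span ha)
    rintro _ ⟨a, ha, rfl⟩
    exact h a
  exact h1

end Quantization

/-! ## Restriction of maps to subalgebras -/

section Restriction

variable {K : Type u} [NormedAddCommGroup K] [InnerProductSpace ℂ K] [CompleteSpace K]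

/-- The restriction to a subalgebra of a bounded map of `B(K)`. -/
noncomputable def restrictMap (A : StarSubalgebra ℂ (K →L[ℂ] K)) (Ψ : (K →L[ℂ] K) →L[ℂ] (K →L[ℂ] K))
    (h : ∀ x ∈ A, Ψ x ∈ A) : A →L[ℂ] A where
  toFun x := ⟨Ψ x, h x x.2⟩
  map_add' x y := Subtype.ext (Ψ.map_add x y)
  map_smul' c x := Subtype.ext (Ψ.map_smul c x)
  cont := (Ψ.continuous.comp continuous_subtype_val).subtype_mk _

@[simp] theorem coe_restrictMap (A : StarSubalgebra ℂ (K →L[ℂ] K))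
    (Ψ : (K →L[ℂ] K) →L[ℂ] (K →L[ℂ] K)) (h : ∀ x ∈ A, Ψ x ∈ A) (x : A) :
    (restrictMap A Ψ h x : K →L[ℂ] K) = Ψ x := rfl

theorem finiteDimensional_range_restrictMap {A : StarSubalgebra ℂ (K →L[ℂ] K)}
    {Ψ : (K →L[ℂ] K) →L[ℂ] (K →L[ℂ] K)} {h : ∀ x ∈ A, Ψ x ∈ A} (Q : Submodule ℂ (K →L[ℂ] K))
    [FiniteDimensional ℂ Q] (hQ : ∀ x, Ψ x ∈ Q) :
    FiniteDimensional ℂ (restrictMap A Ψ h).range := by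
  have hmem : ∀ y : (restrictMap A Ψ h).range, ((y : A) : K →L[ℂ] K) ∈ Q := by
    rintro ⟨_, ⟨x, rfl⟩⟩
    exact hQ x
  let f : (restrictMap A Ψ h).range →ₗ[ℂ] Q :=
    { toFun := fun y => ⟨((y : A) : K →L[ℂ] K), hmem y⟩
      map_add' := fun x y => rfl
      map_smul' := fun c x => rfl }
  refine FiniteDimensional.of_injective f fun x y hxy => ?_
  exact Subtype.ext (Subtype.ext (congrArg (fun q : Q => (q : K →L[ℂ] K)) hxy))

/-- Each summand preserves `A`, so the partial sums are finite rank maps from `A` to itself. The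
limit needs to agree with `Ψ` only on `A`. -/
theorem isNormLimitOfFiniteRank_restrictMap {A : StarSubalgebra ℂ (K →L[ℂ] K)}
    {Ψ Ψ' : (K →L[ℂ] K) →L[ℂ] (K →L[ℂ] K)} (hA : ∀ x ∈ A, Ψ x ∈ A) (hΨ : ∀ x ∈ A, Ψ x = Ψ' x)
    {f : ℕ → ((K →L[ℂ] K) →L[ℂ] (K →L[ℂ] K))} (hf : HasSum f Ψ')
    (hfA : ∀ n, ∀ x ∈ A, f n x ∈ A)
    (hfin : ∀ n, ∃ Q : Submodule ℂ (K →L[ℂ] K), FiniteDimensional ℂ Q ∧ ∀ x, f n x ∈ Q) :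
    IsNormLimitOfFiniteRank A (restrictMap A Ψ hA) := by
  choose Q hQ hfQ using hfin
  refine Metric.mem_closure_iff.2 fun ε hε => ?_
  obtain ⟨N, hN⟩ := Metric.tendsto_atTop.1 hf.tendsto_sum_nat (ε / 2) (half_pos hε)
  have hN := hN N le_rfl
  set S := ∑ n ∈ Finset.range N, f n with hS
  have hSA : ∀ x ∈ A, S x ∈ A := fun x hx => by
    rw [hS, sum_apply]
    exact sum_mem fun n _ => hfA n x hx
  refine ⟨restrictMap A S hSA, ?_, ?_⟩
  · refine finiteDimensional_range_restrictMap (⨆ n : Finset.range N, Q n) fun x => ?_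
    rw [hS, sum_apply]
    exact Submodule.sum_mem _ fun n hn =>
      Submodule.mem_iSup_of_mem (p := fun n : Finset.range N => Q n) ⟨n, hn⟩ (hfQ n x)
  · rw [dist_eq_norm] at hN ⊢
    refine lt_of_le_of_lt (ContinuousLinearMap.opNorm_le_bound _ (half_pos hε).le fun x => ?_)
      (half_lt_self hε)
    have h1 : ((restrictMap A Ψ hA - restrictMap A S hSA) x : A) =
        (⟨Ψ x - S x, sub_mem (hA x x.2) (hSA x x.2)⟩ : A) := rfl
    rw [h1]
    change ‖Ψ x - S x‖ ≤ ε / 2 * ‖(x : K →L[ℂ] K)‖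
    rw [hΨ x x.2, ← norm_neg, neg_sub, ← sub_apply]
    exact (S - Ψ').le_of_opNorm_le hN.le x

theorem IsNormLimitOfFiniteRank.isCompactOperator {A : StarSubalgebra ℂ (K →L[ℂ] K)}
    (hA : IsClosed (A : Set (K →L[ℂ] K))) {Φ : A →L[ℂ] A} (h : IsNormLimitOfFiniteRank A Φ) :
    IsCompactOperator Φ := by
  have : CompleteSpace A := hA.completeSpace_coe
  have hcl : IsClosed {R : A →L[ℂ] A | IsCompactOperator R} := isClosed_setOfPred_isCompactOperator
  refine closure_minimal (fun R hR => ?_) hcl h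
  have hfin : FiniteDimensional ℂ R.range := hR
  have hprop : ProperSpace R.range := FiniteDimensional.proper ℂ R.range
  let R' : A →L[ℂ] R.range := R.codRestrict R.range fun x => ⟨x, rfl⟩
  have h1 : IsCompactOperator R' := isCompactOperator_of_locallyCompactSpace_dom R'
  exact h1.clm_comp R.range.subtypeL

theorem isNormalMap_restrictMap (M : VonNeumannAlgebra K) {Ψ : (K →L[ℂ] K) →L[ℂ] (K →L[ℂ] K)}
    (hΨ : @Continuous _ _ (sigmaWeak K) (sigmaWeak K) Ψ)
    (h : ∀ x ∈ M.toStarSubalgebra, Ψ x ∈ M.toStarSubalgebra) :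
    IsNormalMap M fun x => (restrictMap M.toStarSubalgebra Ψ h x : K →L[ℂ] K) := by
  let _ := sigmaWeak K
  let _ := sigmaWeakOn M.toStarSubalgebra
  exact hΨ.comp continuous_induced_dom

theorem tendsto_apply_of_dense {α : Type*} {l : Filter α} {f : α → (K →L[ℂ] K)} {x : K →L[ℂ] K}
    {C : ℝ} (hC : ∀ a, ‖f a‖ ≤ C) {D : Set K} (hD : Dense D)
    (h : ∀ ξ ∈ D, Filter.Tendsto (fun a => f a ξ) l (nhds (x ξ))) (ζ : K) :
    Filter.Tendsto (fun a => f a ζ) l (nhds (x ζ)) := by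
  rw [Metric.tendsto_nhds]
  intro ε hε
  set R : ℝ := |C| + ‖x‖ + 1 with hR
  have hR0 : 0 < R := by positivity
  obtain ⟨ξ, hξ, hd⟩ := hD.exists_dist_lt ζ (show 0 < ε / 2 / R by positivity)
  filter_upwards [Metric.tendsto_nhds.1 (h ξ hξ) (ε / 2) (half_pos hε)] with a ha
  rw [dist_eq_norm] at ha hd ⊢
  have h1 : f a ζ - x ζ = (f a ξ - x ξ) + (f a - x) (ζ - ξ) := by
    simp only [sub_apply, map_sub]
    abel
  have h2 : ‖(f a - x) (ζ - ξ)‖ ≤ R * ‖ζ - ξ‖ := by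
    refine (f a - x).le_of_opNorm_le ((norm_sub_le _ _).trans ?_) _
    linarith [hC a, le_abs_self C]
  have h3 : R * ‖ζ - ξ‖ < ε / 2 := by
    rw [lt_div_iff₀ hR0] at hd
    linarith
  rw [h1]
  refine (norm_add_le _ _).trans_lt ?_
  linarith

end Restriction

/-! ### The Toeplitz algebra and the action on the vacuum -/

section Toeplitz

variable {H : Type u} [NormedAddCommGroup H] [InnerProductSpace ℂ H] [CompleteSpace H]

theorem IsQuantization.mem_toeplitz {T : H →L[ℂ] H}
    {Ψ : (Fock H →L[ℂ] Fock H) →L[ℂ] (Fock H →L[ℂ] Fock H)}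
    (hΨ : IsQuantization (creationL H) (vacuum H) T Ψ) {x : Fock H →L[ℂ] Fock H}
    (hx : x ∈ toeplitz H) : Ψ x ∈ toeplitz H := by
  have h1 : ∀ y ∈ StarAlgebra.adjoin ℂ (Set.range (creation (H := H))), Ψ y ∈ toeplitz H := by
    intro y hy
    have h2 : y ∈ Submodule.comap Ψ.toLinearMap (toeplitz H).toSubalgebra.toSubmodule := by
      refine Submodule.span_le.2 ?_ (adjoin_creation_le_span hy)
      rintro _ ⟨⟨a, b⟩, rfl⟩
      change Ψ (creationWord a b) ∈ toeplitz H
      rw [hΨ.map_creationWord]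
      exact creationWord_mem_toeplitz _ _
    exact h2
  have hcl : IsClosed (toeplitz H : Set (Fock H →L[ℂ] Fock H)) :=
    StarSubalgebra.isClosed_topologicalClosure _
  exact closure_minimal h1 (hcl.preimage Ψ.continuous) hx

theorem creationWord_nil_apply_vacuum (h : H) (b : List H) :
    creationWord [] (h :: b) (vacuum H) = 0 := by
  rcases List.eq_nil_or_concat (h :: b) with h0 | ⟨c, k, h0⟩
  · simp at h0
  · rw [h0, List.concat_eq_append, creationWord_append_right, mul_apply_eq_comp,
      star_creation_vacuum, map_zero]

theorem wick_apply_vacuum (a : List H) : wick a (vacuum H) = fockVec a := by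
  induction a with
  | nil => rfl
  | cons h a ih =>
    rw [wick, add_apply, creationWord_nil_apply_vacuum, add_zero, mul_apply_eq_comp, ih,
      fockVec_cons]

theorem tendsto_fockVec_map {α : Type*} {l : Filter α} {T : α → (H →L[ℂ] H)}
    (hT : ∀ ξ, Filter.Tendsto (fun i => T i ξ) l (nhds ξ)) (a : List H) :
    Filter.Tendsto (fun i => fockVec (a.map (T i))) l (nhds (fockVec a)) := by
  induction a with
  | nil => exact tendsto_const_nhds
  | cons h a ih =>
    have h1 : Filter.Tendsto (fun i => creationL H (T i h)) l (nhds (creationL H h)) :=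
      ((creationL H).continuous.tendsto h).comp (hT h)
    exact ((isBoundedBilinearMap_apply (𝕜 := ℂ)).continuous.tendsto
      (creationL H h, fockVec a)).comp (h1.prodMk_nhds ih)

/-- The vacuum is cyclic for the semicircular operators of a total set. -/
theorem dense_adjoin_semicircular_vacuum {S : Set H}
    (hS : (Submodule.span ℂ S).topologicalClosure = ⊤) :
    Dense ((fun x : Fock H →L[ℂ] Fock H => x (vacuum H)) ''
      (StarAlgebra.adjoin ℂ (semicircular '' S))) := by
  set N : Submodule ℂ (Fock H) :=
    (StarAlgebra.adjoin ℂ (semicircular '' S)).toSubalgebra.toSubmodule.map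
      (ContinuousLinearMap.apply ℂ (Fock H) (vacuum H)).toLinearMap with hN
  have htop : N.topologicalClosure = ⊤ := by
    refine eq_top_of_semicircular_mem hS _ N.isClosed_topologicalClosure
      (N.le_topologicalClosure ⟨1, one_mem (StarAlgebra.adjoin ℂ _), rfl⟩) fun ξ hξ x hx => ?_
    refine map_mem_closure (creation ξ + star (creation ξ)).continuous hx ?_
    rintro _ ⟨y, hy, rfl⟩
    refine ⟨(creation ξ + star (creation ξ)) * y, ?_, rfl⟩
    have h1 : creation ξ + star (creation ξ) = (2 : ℂ) • semicircular ξ := by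
      rw [semicircular, smul_smul]
      simp
    rw [h1]
    exact mul_mem (S := StarSubalgebra ℂ (Fock H →L[ℂ] Fock H))
      (SMulMemClass.smul_mem _ (StarAlgebra.subset_adjoin ℂ _ ⟨ξ, hξ, rfl⟩)) hy
  exact (Submodule.dense_iff_topologicalClosure_eq_top (s := N)).2 htop

/-- The vacuum is cyclic for the commutant of the semicircular operators of a set `S`, when there is
a total set `S'` of vectors whose inner products with the vectors of `S` are real. -/
theorem dense_centralizer_semicircular_vacuum {S S' : Set H}
    (hS' : (Submodule.span ℂ S').topologicalClosure = ⊤)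
    (hSS' : ∀ ξ ∈ S, ∀ η ∈ S', ⟪η, ξ⟫_ℂ = ⟪ξ, η⟫_ℂ) :
    Dense ((fun x : Fock H →L[ℂ] Fock H => x (vacuum H)) ''
      (StarSubalgebra.centralizer ℂ (semicircular '' S))) := by
  set N : Submodule ℂ (Fock H) :=
    (StarSubalgebra.centralizer ℂ (semicircular '' S)).toSubalgebra.toSubmodule.map
      (ContinuousLinearMap.apply ℂ (Fock H) (vacuum H)).toLinearMap with hN
  have htop : N.topologicalClosure = ⊤ := by
    refine eq_top_of_right_semicircular_mem hS' _ N.isClosed_topologicalClosure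
      (N.le_topologicalClosure ⟨1, one_mem (StarSubalgebra.centralizer ℂ _), rfl⟩)
      fun η hη x hx => ?_
    refine map_mem_closure (rightCreation η + star (rightCreation η)).continuous hx ?_
    rintro _ ⟨y, hy, rfl⟩
    refine ⟨(rightCreation η + star (rightCreation η)) * y, ?_, rfl⟩
    refine mul_mem (S := StarSubalgebra ℂ (Fock H →L[ℂ] Fock H)) ?_ hy
    rw [StarSubalgebra.mem_centralizer_iff]
    rintro _ ⟨ξ, hξ, rfl⟩
    rw [star_semicircular, and_self]
    exact semicircular_comm_right (hSS' ξ hξ η hη)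
  exact (Submodule.dense_iff_topologicalClosure_eq_top (s := N)).2 htop

end Toeplitz

/-! ## The free Araki–Woods algebra -/

theorem IsHaagerupNet.comp_tendsto {K : Type u} [NormedAddCommGroup K] [InnerProductSpace ℂ K]
    [CompleteSpace K] {L : Type v} [NormedAddCommGroup L] [InnerProductSpace ℂ L] [CompleteSpace L]
    {M : VonNeumannAlgebra K} {π : M.toStarSubalgebra →⋆ₐ[ℂ] (L →L[ℂ] L)} {ι ι' : Type*}
    {l : Filter ι} {l' : Filter ι'} {u : ι → (M.toStarSubalgebra →L[ℂ] M.toStarSubalgebra)}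
    (h : IsHaagerupNet M π l u) {f : ι' → ι} (hf : Filter.Tendsto f l' l) :
    IsHaagerupNet M π l' fun i => u (f i) where
  completelyPositive i := h.completelyPositive (f i)
  normal i := h.normal (f i)
  tendsto x := (h.tendsto x).comp hf
  compact i := h.compact (f i)

/-- If `Tᵢ → 1` strongly, then the second quantizations of `Tᵢ` converge strongly on the vacuum. -/
theorem tendsto_quantization_vacuum {H : Type u} [NormedAddCommGroup H] [InnerProductSpace ℂ H]
    [CompleteSpace H] {α : Type*} {l : Filter α} {T : α → (H →L[ℂ] H)}
    {Ψ : α → ((Fock H →L[ℂ] Fock H) →L[ℂ] (Fock H →L[ℂ] Fock H))}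
    (hΨ : ∀ i, IsQuantization (creationL H) (vacuum H) (T i) (Ψ i))
    (hT : ∀ ξ, Filter.Tendsto (fun i => T i ξ) l (nhds ξ)) (x : Fock H →L[ℂ] Fock H) :
    Filter.Tendsto (fun i => Ψ i x (vacuum H)) l (nhds (x (vacuum H))) := by
  have hspan : ∀ y ∈ Submodule.span ℂ (wick '' {a : List H | ∀ ξ ∈ a, ξ ∈ Set.univ}),
      Filter.Tendsto (fun i => Ψ i y (vacuum H)) l (nhds (y (vacuum H))) := by
    intro y hy
    induction hy using Submodule.span_induction with
    | mem y hy =>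
      obtain ⟨a, -, rfl⟩ := hy
      simp only [(hΨ _).map_wick, wick_apply_vacuum]
      exact tendsto_fockVec_map hT a
    | zero =>
      simp only [map_zero, zero_apply]
      exact tendsto_const_nhds
    | add y z _ _ h1 h2 =>
      simp only [map_add, add_apply]
      exact h1.add h2
    | smul c y _ h1 =>
      simp only [map_smul, smul_apply]
      exact h1.const_smul c
  have hdense := dense_adjoin_semicircular_vacuum (H := H) (S := Set.univ)
    (by rw [Submodule.span_univ]; exact top_le_iff.1 (Submodule.le_topologicalClosure _))
  rw [Metric.tendsto_nhds]
  intro ε hε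
  obtain ⟨_, ⟨y, hy, rfl⟩, hd⟩ :=
    hdense.exists_dist_lt (x (vacuum H)) (show 0 < ε / 3 by positivity)
  filter_upwards [Metric.tendsto_nhds.1 (hspan y (adjoin_semicircular_le_span hy)) (ε / 3)
    (by positivity)] with i hi
  -- Contractivity on the vacuum makes this estimate uniform in `i`, although x - y need not be
  -- small in operator norm.
  have h1 : dist (Ψ i x (vacuum H)) (Ψ i y (vacuum H)) < ε / 3 := by
    rw [dist_eq_norm] at hd ⊢
    have h2 := (hΨ i).norm_vacuum_le (x - y)
    rw [map_sub, sub_apply, sub_apply] at h2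
    exact h2.trans_lt hd
  have h3 := dist_triangle4 (Ψ i x (vacuum H)) (Ψ i y (vacuum H)) (y (vacuum H)) (x (vacuum H))
  rw [dist_comm] at hd
  have hd' : dist (y (vacuum H)) (x (vacuum H)) < ε / 3 := hd
  linarith

namespace OrthogonalRep

open Complexified

variable {E : Type u} [NormedAddCommGroup E] [InnerProductSpace ℝ E] [CompleteSpace E]
variable (V : OrthogonalRep E)

theorem dense_commutant_vacuum :
    Dense ((fun x : Fock (Complexified E) →L[ℂ] Fock (Complexified E) => x (vacuum _)) ''
      (StarSubalgebra.centralizer ℂ (semicircular '' V.KR))) := by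
  refine dense_centralizer_semicircular_vacuum V.span_deformationConj_closure ?_
  rintro _ ⟨a, rfl⟩ _ ⟨b, rfl⟩
  exact V.inner_deformation_ofReal a b

theorem mem_arakiWoods_of_mem_adjoin {x : Fock (Complexified E) →L[ℂ] Fock (Complexified E)}
    (hx : x ∈ StarAlgebra.adjoin ℂ (semicircular '' V.KR)) :
    x ∈ V.arakiWoods.toStarSubalgebra :=
  V.mem_arakiWoods_of_mem (StarSubalgebra.le_topologicalClosure _ hx)

theorem commute_of_mem_arakiWoods {x y : Fock (Complexified E) →L[ℂ] Fock (Complexified E)}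
    (hx : x ∈ V.arakiWoods.toStarSubalgebra)
    (hy : y ∈ StarSubalgebra.centralizer ℂ (semicircular '' V.KR)) : y * x = x * y :=
  mem_generatedVN_iff.1 hx y hy

/-- Cyclicity holds because K_ℝ is total; the vacuum is separating because it is cyclic for the
commutant. -/
theorem isL2Representation_vacuum :
    IsL2Representation V.arakiWoods V.arakiWoods.toStarSubalgebra.subtype
      (vacuum (Complexified E)) where
  normal := by
    let _ := sigmaWeak (Fock (Complexified E))
    let _ := sigmaWeakOn V.arakiWoods.toStarSubalgebra
    exact continuous_induced_dom
  cyclic := by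
    refine (dense_adjoin_semicircular_vacuum V.span_KR_closure).mono ?_
    rintro _ ⟨x, hx, rfl⟩
    exact ⟨⟨x, V.mem_arakiWoods_of_mem_adjoin hx⟩, rfl⟩
  separating := by
    intro x x' h
    have h : (x : Fock (Complexified E) →L[ℂ] Fock (Complexified E)) (vacuum _) =
      (x' : Fock (Complexified E) →L[ℂ] Fock (Complexified E)) (vacuum _) := h
    refine Subtype.ext (DFunLike.coe_injective (Continuous.ext_on V.dense_commutant_vacuum
      (ContinuousLinearMap.continuous _) (ContinuousLinearMap.continuous _) ?_))
    rintro _ ⟨y, hy, rfl⟩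
    change (x * y : Fock (Complexified E) →L[ℂ] Fock (Complexified E)) _ =
      (x' * y : Fock (Complexified E) →L[ℂ] Fock (Complexified E)) _
    rw [← V.commute_of_mem_arakiWoods x.2 hy, ← V.commute_of_mem_arakiWoods x'.2 hy,
      mul_apply_eq_comp, mul_apply_eq_comp, h]

theorem isClosed_arakiWoods : IsClosed
    (V.arakiWoods.toStarSubalgebra : Set (Fock (Complexified E) →L[ℂ] Fock (Complexified E))) := by
  have h : (V.arakiWoods.toStarSubalgebra :
      Set (Fock (Complexified E) →L[ℂ] Fock (Complexified E))) =
      ⋂ y ∈ StarSubalgebra.centralizer ℂ (semicircular '' V.KR), {x | y * x = x * y} := by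
    ext x
    simp only [Set.mem_iInter]
    exact mem_generatedVN_iff
  rw [h]
  exact isClosed_biInter fun y _ =>
    isClosed_eq (continuous_const.mul continuous_id) (continuous_id.mul continuous_const)

section Quantization

variable {V} {T : Complexified E →L[ℂ] Complexified E}
variable {Ψ : (Fock (Complexified E) →L[ℂ] Fock (Complexified E)) →L[ℂ]
  (Fock (Complexified E) →L[ℂ] Fock (Complexified E))}

theorem mem_arakiWoods_of_isQuantization
    (hΨ : IsQuantization (creationL (Complexified E)) (vacuum _) T Ψ)
    (hT : ∀ ξ ∈ V.KR, T ξ ∈ V.KR) :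
    ∀ x ∈ V.arakiWoods.toStarSubalgebra, Ψ x ∈ V.arakiWoods.toStarSubalgebra := by
  intro x hx
  refine mem_generatedVN_of_wick hΨ.continuous (fun a ha => ?_) hx
  rw [hΨ.map_wick]
  refine wick_mem_adjoin _ fun ξ hξ => ?_
  obtain ⟨η, hη, rfl⟩ := List.mem_map.1 hξ
  exact hT η (ha η hη)

theorem isSecondQuantization_restrictMap
    (hΨ : IsQuantization (creationL (Complexified E)) (vacuum _) T Ψ)
    (hM : ∀ x ∈ V.arakiWoods.toStarSubalgebra, Ψ x ∈ V.arakiWoods.toStarSubalgebra) :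
    V.IsSecondQuantization T (restrictMap V.arakiWoods.toStarSubalgebra Ψ hM) := by
  refine ⟨⟨restrictMap (toeplitz (Complexified E)) Ψ fun x hx => hΨ.mem_toeplitz hx, ?_, ?_, ?_, ?_⟩,
    isNormalMap_restrictMap _ hΨ.continuous hM⟩
  · exact Subtype.ext hΨ.map_one
  · exact hΨ.completelyPositive _
  · exact fun a b => Subtype.ext (hΨ.map_creationWord a b)
  · exact fun x hx => rfl

/-- The sum of the degree parts and `Ψ` are normal and agree on Wick words, hence on M. Each degree
part sends a Wick word in K_ℝ to such a word or to 0, hence preserves M. -/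
theorem isNormLimitOfFiniteRank_quantization [FiniteDimensional ℂ T.range] (hTn : ‖T‖ < 1)
    (hΨ : IsQuantization (creationL (Complexified E)) (vacuum _) T Ψ)
    (hT : ∀ ξ ∈ V.KR, T ξ ∈ V.KR)
    (hM : ∀ x ∈ V.arakiWoods.toStarSubalgebra, Ψ x ∈ V.arakiWoods.toStarSubalgebra) :
    IsNormLimitOfFiniteRank V.arakiWoods.toStarSubalgebra
      (restrictMap V.arakiWoods.toStarSubalgebra Ψ hM) := by
  obtain ⟨A, Ψ', hA, hsum, hcont⟩ :=
    exists_isDegreeFamily (isToeplitzFamily_creationL (H := Complexified E)) T hTn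
  refine isNormLimitOfFiniteRank_restrictMap (Ψ' := Ψ') hM (fun x hx => ?_) hsum
    (fun n x hx => ?_) hA.finite
  · refine eq_on_generatedVN_of_wick hΨ.continuous hcont (fun a => ?_) hx
    have h1 := hsum.mapL (ContinuousLinearMap.apply ℂ _ (wick a))
    simp only [ContinuousLinearMap.apply_apply, hA.map_wick] at h1
    rw [hΨ.map_wick]
    refine HasSum.unique ?_ h1
    have h2 := hasSum_ite_eq a.length (wick (a.map T))
    exact h2
  · refine mem_generatedVN_of_wick (hA.continuous n) (fun a ha => ?_) hx
    rw [hA.map_wick]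
    split_ifs
    · refine wick_mem_adjoin _ fun ξ hξ => ?_
      obtain ⟨η, hη, rfl⟩ := List.mem_map.1 hξ
      exact hT η (ha η hη)
    · exact zero_mem _

end Quantization

/-- For y in the commutant, Ψ_i(x)yΩ = yΨ_i(x)Ω → yxΩ = x(yΩ). Such vectors are dense and the Ψ_i(x)
are bounded by ‖x‖, so convergence is strong, hence σ-weak. -/
theorem tendsto_quantization {α : Type*} {l : Filter α}
    {T : α → (Complexified E →L[ℂ] Complexified E)}
    {Ψ : α → ((Fock (Complexified E) →L[ℂ] Fock (Complexified E)) →L[ℂ]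
      (Fock (Complexified E) →L[ℂ] Fock (Complexified E)))}
    (hΨ : ∀ i, IsQuantization (creationL (Complexified E)) (vacuum _) (T i) (Ψ i))
    (hM : ∀ i, ∀ x ∈ V.arakiWoods.toStarSubalgebra, Ψ i x ∈ V.arakiWoods.toStarSubalgebra)
    (hT : ∀ ξ, Filter.Tendsto (fun i => T i ξ) l (nhds ξ))
    (x : V.arakiWoods.toStarSubalgebra) :
    Filter.Tendsto (fun i => restrictMap V.arakiWoods.toStarSubalgebra (Ψ i) (hM i) x) l
      (@nhds _ (sigmaWeakOn V.arakiWoods.toStarSubalgebra) x) := by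
  rw [@nhds_induced _ _ (sigmaWeak (Fock (Complexified E))), Filter.tendsto_comap_iff]
  refine tendsto_sigmaWeak_of_strong
    (C := ‖(x : Fock (Complexified E) →L[ℂ] Fock (Complexified E))‖)
    (fun i => (hΨ i).norm_le _) (tendsto_apply_of_dense (fun i => (hΨ i).norm_le _)
      V.dense_commutant_vacuum ?_)
  rintro _ ⟨y, hy, rfl⟩
  have h1 := (y.continuous.tendsto _).comp (tendsto_quantization_vacuum hΨ hT x)
  have h2 : ∀ z ∈ V.arakiWoods.toStarSubalgebra, z (y (vacuum _)) = y (z (vacuum _)) := by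
    intro z hz
    exact (DFunLike.congr_fun (V.commute_of_mem_arakiWoods hz hy) (vacuum _)).symm
  rw [← h2 _ x.2] at h1
  refine h1.congr fun i => ?_
  exact (h2 _ (hM i x x.2)).symm

theorem tendsto_exp_smul {T : ℕ → (Complexified E →L[ℂ] Complexified E)}
    (hT : ∀ ξ, Filter.Tendsto (fun k => T k ξ) Filter.atTop (nhds ξ)) (ξ : Complexified E) :
    Filter.Tendsto
      (fun i : Set.Ioi (0 : ℝ) × ℕ => ((Real.exp (-(i.1 : ℝ)) : ℂ) • T i.2) ξ)
      (Filter.comap (fun t : Set.Ioi (0 : ℝ) => (t : ℝ)) (nhds 0) ×ˢ Filter.atTop) (nhds ξ) := by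
  have h1 : Filter.Tendsto (fun i : Set.Ioi (0 : ℝ) × ℕ => (Real.exp (-(i.1 : ℝ)) : ℂ))
      (Filter.comap (fun t : Set.Ioi (0 : ℝ) => (t : ℝ)) (nhds 0) ×ˢ Filter.atTop) (nhds 1) := by
    have h2 : Continuous fun t : ℝ => (Real.exp (-t) : ℂ) := by fun_prop
    have h3 := (h2.tendsto 0).comp (Filter.tendsto_comap.comp (Filter.tendsto_fst
      (f := Filter.comap (fun t : Set.Ioi (0 : ℝ) => (t : ℝ)) (nhds 0))
      (g := (Filter.atTop : Filter ℕ))))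
    simpa [Function.comp_def] using h3
  have h4 := h1.smul ((hT ξ).comp Filter.tendsto_snd)
  rw [one_smul] at h4
  exact h4

end OrthogonalRep

namespace OrthogonalRep

variable {E : Type u} [NormedAddCommGroup E] [InnerProductSpace ℝ E] [CompleteSpace E]
variable (V : OrthogonalRep E)

theorem isHaagerupNet_restrictMap {α : Type*} {l : Filter α}
    {T : α → (Complexified E →L[ℂ] Complexified E)}
    {Ψ : α → ((Fock (Complexified E) →L[ℂ] Fock (Complexified E)) →L[ℂ]
      (Fock (Complexified E) →L[ℂ] Fock (Complexified E)))}
    (hΨ : ∀ i, IsQuantization (creationL (Complexified E)) (vacuum _) (T i) (Ψ i))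
    (hM : ∀ i, ∀ x ∈ V.arakiWoods.toStarSubalgebra, Ψ i x ∈ V.arakiWoods.toStarSubalgebra)
    (hfin : ∀ i, IsNormLimitOfFiniteRank V.arakiWoods.toStarSubalgebra
      (restrictMap V.arakiWoods.toStarSubalgebra (Ψ i) (hM i)))
    (hT : ∀ ξ, Filter.Tendsto (fun i => T i ξ) l (nhds ξ)) :
    IsHaagerupNet V.arakiWoods V.arakiWoods.toStarSubalgebra.subtype l
      fun i => restrictMap V.arakiWoods.toStarSubalgebra (Ψ i) (hM i) where
  completelyPositive i := (hΨ i).completelyPositive _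
  normal i := isNormalMap_restrictMap _ (hΨ i).continuous (hM i)
  tendsto := V.tendsto_quantization hΨ hM hT
  compact i ξ := by
    have h1 := (hfin i).isCompactOperator V.isClosed_arakiWoods
    exact h1.continuous_comp
      (((ContinuousLinearMap.apply ℂ (Fock (Complexified E)) ξ).continuous).comp
        continuous_subtype_val)

theorem hasHaagerupProperty_of_isHaagerupNet
    {Φ : Set.Ioi (0 : ℝ) × ℕ →
      (V.arakiWoods.toStarSubalgebra →L[ℂ] V.arakiWoods.toStarSubalgebra)}
    (h : IsHaagerupNet V.arakiWoods V.arakiWoods.toStarSubalgebra.subtype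
      (Filter.comap (fun t : Set.Ioi (0 : ℝ) => (t : ℝ)) (nhds 0) ×ˢ Filter.atTop) Φ) :
    HasHaagerupProperty V.arakiWoods := by
  have hdown : Filter.Tendsto (ULift.down : ULift.{u} ℕ → ℕ) Filter.atTop Filter.atTop :=
    Filter.tendsto_atTop.2 fun b => (Filter.eventually_ge_atTop (ULift.up b)).mono fun _ h => h
  -- The diagonal sequence t = 1/(n + 1), k = n is a net over a directed set; the lift of ℕ only
  -- adjusts the universe.
  let f : ULift.{u} ℕ → Set.Ioi (0 : ℝ) × ℕ := fun n =>
    (⟨1 / ((n.down : ℝ) + 1), Set.mem_Ioi.2 (by positivity)⟩, n.down)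
  have hf : Filter.Tendsto f Filter.atTop
      (Filter.comap (fun t : Set.Ioi (0 : ℝ) => (t : ℝ)) (nhds 0) ×ˢ Filter.atTop) := by
    refine Filter.Tendsto.prodMk (Filter.tendsto_comap_iff.2 ?_) hdown
    exact tendsto_one_div_add_atTop_nhds_zero_nat.comp hdown
  have hnet := h.comp_tendsto hf
  exact ⟨Fock (Complexified E), inferInstance, inferInstance, inferInstance,
    V.arakiWoods.toStarSubalgebra.subtype, vacuum _, V.isL2Representation_vacuum, ULift ℕ,
    inferInstance, inferInstance, inferInstance, _, hnet⟩

theorem smul_mem_KR (r : ℝ) {ξ : Complexified E} (hξ : ξ ∈ V.KR) : (r : ℂ) • ξ ∈ V.KR := by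
  obtain ⟨a, rfl⟩ := hξ
  refine ⟨r • a, ?_⟩
  have h1 : Complexified.ofReal (r • a) = (r : ℂ) • Complexified.ofReal a := by
    ext
    · rw [Complexified.re_smul]
      simp [Complexified.ofReal]
    · rw [Complexified.im_smul]
      simp [Complexified.ofReal]
  rw [j, h1, map_smul]
  rfl

theorem norm_exp_smul_lt_one {T : Complexified E →L[ℂ] Complexified E} (hT : ‖T‖ ≤ 1) {t : ℝ}
    (ht : 0 < t) : ‖(Real.exp (-t) : ℂ) • T‖ < 1 := by
  rw [norm_smul, Complex.norm_real, Real.norm_of_nonneg (Real.exp_nonneg _)]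
  have h1 : Real.exp (-t) < 1 := by
    rw [← Real.exp_zero]
    exact Real.exp_lt_exp.2 (neg_lt_zero.2 ht)
  exact (mul_le_of_le_one_right (Real.exp_nonneg _) hT).trans_lt h1

theorem exists_quantization_arakiWoods {T : Complexified E →L[ℂ] Complexified E}
    (hfin : FiniteDimensional ℂ T.range) (hTn : ‖T‖ < 1) (hT : ∀ ξ ∈ V.KR, T ξ ∈ V.KR) :
    ∃ Ψ, IsQuantization (creationL (Complexified E)) (vacuum _) T Ψ ∧
      ∃ hM : ∀ x ∈ V.arakiWoods.toStarSubalgebra, Ψ x ∈ V.arakiWoods.toStarSubalgebra,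
        IsNormLimitOfFiniteRank V.arakiWoods.toStarSubalgebra
          (restrictMap V.arakiWoods.toStarSubalgebra Ψ hM) := by
  obtain ⟨Ψ, hΨ⟩ := exists_isQuantization (isToeplitzFamily_creationL (H := Complexified E)) T hTn
  exact ⟨Ψ, hΨ, mem_arakiWoods_of_isQuantization hΨ hT,
    isNormLimitOfFiniteRank_quantization hTn hΨ hT _⟩

end OrthogonalRep

theorem mainTheorem9 {E : Type*} [NormedAddCommGroup E] [InnerProductSpace ℝ E]
    [CompleteSpace E] [TopologicalSpace.SeparableSpace E] (V : OrthogonalRep E) :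
    HasHaagerupProperty V.arakiWoods ∧
    IsL2Representation V.arakiWoods V.arakiWoods.toStarSubalgebra.subtype
      (vacuum (Complexified E)) ∧
    ∃ T : ℕ → (Complexified E →L[ℂ] Complexified E),
      (∀ k, FiniteDimensional ℂ (T k).range ∧ ‖T k‖ ≤ 1 ∧ V.CommutesWithInv (T k)) ∧
      (∀ ξ, Filter.Tendsto (fun k => T k ξ) Filter.atTop (nhds ξ)) ∧
      ∃ Φ : Set.Ioi (0 : ℝ) × ℕ →
          (V.arakiWoods.toStarSubalgebra →L[ℂ] V.arakiWoods.toStarSubalgebra),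
        (∀ (t : Set.Ioi (0 : ℝ)) (k : ℕ), V.IsSecondQuantization ((Real.exp (-(t : ℝ)) : ℂ) • T k) (Φ (t, k))) ∧
        (∀ i, Φ i 1 = 1) ∧
        IsHaagerupNet V.arakiWoods V.arakiWoods.toStarSubalgebra.subtype
          (Filter.comap (fun t : Set.Ioi (0 : ℝ) => (t : ℝ)) (nhds 0) ×ˢ Filter.atTop) Φ ∧
        ∀ i, IsNormLimitOfFiniteRank V.arakiWoods.toStarSubalgebra (Φ i) := by
  obtain ⟨T, hT, hlim⟩ := V.exists_finiteRank_commuting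
  have hfin : ∀ i : Set.Ioi (0 : ℝ) × ℕ,
      FiniteDimensional ℂ ((Real.exp (-(i.1 : ℝ)) : ℂ) • T i.2).range := fun i => by
    have := (hT i.2).1
    refine Submodule.finiteDimensional_of_le (S₂ := (T i.2).range) ?_
    rintro _ ⟨x, rfl⟩
    exact Submodule.smul_mem _ _ ⟨x, rfl⟩
  -- The factor exp(-t) turns the contraction T_k into a strict one, as the Kraus series requires,
  -- and real scalars preserve K_ℝ.
  choose Ψ hΨ hM hΨfin using fun i : Set.Ioi (0 : ℝ) × ℕ =>
    V.exists_quantization_arakiWoods (hfin i)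
      (OrthogonalRep.norm_exp_smul_lt_one (hT i.2).2.1 i.1.2)
      fun ξ hξ => V.smul_mem_KR _ ((hT i.2).2.2.2 ξ hξ)
  have hnet := V.isHaagerupNet_restrictMap hΨ hM hΨfin (OrthogonalRep.tendsto_exp_smul hlim)
  exact ⟨V.hasHaagerupProperty_of_isHaagerupNet hnet, V.isL2Representation_vacuum, T,
    fun k => ⟨(hT k).1, (hT k).2.1, (hT k).2.2.1⟩, hlim, _,
    fun t k => OrthogonalRep.isSecondQuantization_restrictMap (hΨ (t, k)) (hM (t, k)),
    fun i => Subtype.ext (hΨ i).map_one, hnet, hΨfin⟩
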